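/- Consider the problem $P\,|\,r_j;p_j=p;D_j\,|\sum C_j$: given $n\ge 1$ jobs of equal length $p>0$, $m$ identical parallel machines, release times $r_1,\dots,r_n\in\mathbb R$ and deadlines $D_1,\dots,D_n\in\mathbb R$, assign to every job $j$ a machine and a start time $s_j$ with $r_j\le s_j$ and $s_j+p\le D_j$, such that the intervals $[s_j,s_j+p)$ on any one machine are disjoint, and such that the total completion time $\sum_j(s_j+p)$ is minimal. Let $\mathcal T=\{r_i+ap: 1\le i\le n,\ 0\le a<n\}$, let $t_0$ be an additional point before all points of $\mathcal T$, and for $x\in\mathbb R$ let $\mathrm{round}(x)$ and $\mathrm{prec}(x)$ be the last point of $\mathcal T\cup\{t_0\}$ that is $\le x$, respectively $<x$ ($t_0$ counts as smaller than every real). Let $c_{ij}=|\{k: r_i\le r_k,\ D_k\le D_j\}|$. The skeleton linear program is to minimize $\sum_{t\in\mathcal T}(t+p)(y_t-y_{\mathrm{prec}(t)})$ over real $(y_t)_{t\in\mathcal T\cup\{t_0\}}$ subject to $y_{t_0}=0$, $y_{\max\mathcal T}-y_{t_0}\le n$, and - (order) $y_{\mathrm{prec}(t)}-y_t\le 0$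 for $t\in\mathcal T$; - (load) $y_{\mathrm{prec}(s+p)}-y_{\mathrm{prec}(s)}\le m$ for $s\in\mathcal T$; - (inclusion) $y_{\mathrm{round}(D_j-p)}-y_{\mathrm{prec}(r_i)}\ge c_{ij}$ for all $i,j$ with $c_{ij}>0$. Let $G$ be the directed graph on $\mathcal T\cup\{t_0\}$ that has an arc from $u$ to $v$ of cost $w$ for every constraint $y_v-y_u\le w$ of this program. The model of computation is a random access machine with integers and times, in which additions, subtractions, comparisons, tests and memory accesses cost one step each; there is no multiplication and no conversion between times and integers. **Theorem.** $|\mathcal T|\le n^2$, and there is an algorithm on this machine that solves every instance of $P\,|\,r_j;p_j=p;D_j\,|\sum C_j$ with $n\ge1$ in worst case time $O(n^4)$, with an absolute constant. It first computes all numbers $c_{ij}$ in time $O(n^2)$, then solves the skeleton linear program, and then assigns the jobs. More precisely: - If the instance has no feasible schedule, or the linear program has no solution, then neither exists, and the algorithm reports infeasibility. - Otherwise, the algorithm computes integers $(y_t)$ that are an optimal solution of the skeleton linear program. Each $y_t$ is the length of a shortest path from $t_0$ to $t$ in $G$. Moreover, the linear program is dual to an uncapacitated minimum cost flow problem in $G$,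 in which $t_0$ is the only supply node and every $t\in\mathcal T$ has as its demand the distance to the next point of $\mathcal T$ (demand $0$ for $t=\max\mathcal T$): the value of $(y_t)$ equals $n(\max\mathcal T+p)$ minus the minimum cost of such a flow. Finally, the algorithm outputs an earliest due date assignment of the jobs to the skeleton of $(y_t)$, which has $y_t-y_{\mathrm{prec}(t)}$ slots starting at each $t\in\mathcal T$: the slots are taken from left to right, each receives a job of smallest deadline among the jobs that are already released and not yet assigned, and the $k$-th slot is on machine $k\bmod m$. This is a feasible schedule of minimal total completion time. -/

import Mathlib

noncomputable section

namespace EqualLengthJobs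

open Finset

/-! ### The scheduling problem -/

/-- An instance: `n` jobs of common length `p > 0`, `m` identical parallel machines, and for every
job `j` a release time `r j` and a (hard) deadline `D j`. -/
structure JobInstance where
  n : ℕ
  m : ℕ
  p : ℝ
  p_pos : 0 < p
  r : Fin n → ℝ
  D : Fin n → ℝ

namespace JobInstance

variable (I : JobInstance)

/-- An assignment of a start time and a machine to every job. -/
structure Schedule where
  start : Fin I.n → ℝ
  machine : Fin I.n → Fin I.m

variable {I} in
/-- Every job runs within its release time and its deadline, and the execution intervals
`[s, s + p)` on any one machine are disjoint. -/
structure Schedule.Valid (S : I.Schedule) : Prop where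
  release : ∀ j, I.r j ≤ S.start j
  deadline : ∀ j, S.start j + I.p ≤ I.D j
  disjoint : ∀ i j, i ≠ j → S.machine i = S.machine j →
    S.start i + I.p ≤ S.start j ∨ S.start j + I.p ≤ S.start i

variable {I} in
/-- The total completion time `∑ C_j`. -/
def Schedule.totalCompletion (S : I.Schedule) : ℝ := ∑ j, (S.start j + I.p)

variable {I} in
/-- `S` is valid and minimizes `∑ C_j` among all valid schedules. -/
def Schedule.Optimal (S : I.Schedule) : Prop :=
  S.Valid ∧ ∀ S' : I.Schedule, S'.Valid → S.totalCompletion ≤ S'.totalCompletion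

/-! ### The skeleton linear program

Points of `T' = T ∪ {t₀}` are elements of `WithBot ℝ`, with `t₀ = ⊥`. -/

/-- The time points `r i + a p` with `0 ≤ a < n`. -/
def T : Finset ℝ :=
  (univ : Finset (Fin I.n × Fin I.n)).image fun q => I.r q.1 + (q.2 : ℕ) * I.p

/-- `T' = T ∪ {t₀}`. -/
def T' : Finset (WithBot ℝ) := insert ⊥ (I.T.image fun t : ℝ => (t : WithBot ℝ))

/-- The last point of `T'` that is at most `x` (it is `t₀` if no point of `T` is). -/
def round (x : ℝ) : WithBot ℝ := (I.T.filter fun s => s ≤ x).max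

/-- The last point of `T'` that is less than `x` (it is `t₀` if no point of `T` is). -/
def prec (x : ℝ) : WithBot ℝ := (I.T.filter fun s => s < x).max

/-- The number of jobs that have to be executed within `[r i, D j]`. -/
def c (i j : Fin I.n) : ℕ :=
  #{k : Fin I.n | I.r i ≤ I.r k ∧ I.D k ≤ I.D j}

/-- Feasible solutions of the skeleton linear program: `y t` is the number of slots that start at
or before `t`. Only the values of `y` on `T'` matter. -/
structure LPFeasible (y : WithBot ℝ → ℝ) : Prop where
  source : y ⊥ = 0
  total : y I.T.max - y ⊥ ≤ I.n
  order : ∀ t ∈ I.T, y (I.prec t) - y t ≤ 0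
  /- at most `m` slots start in `[s, s + p)` -/
  load : ∀ s ∈ I.T, y (I.prec (s + I.p)) - y (I.prec s) ≤ I.m
  /- at least `c i j` slots start in `[r i, D j - p]` -/
  incl : ∀ i j, 0 < I.c i j → (I.c i j : ℝ) ≤ y (I.round (I.D j - I.p)) - y (I.prec (I.r i))

/-- The total completion time of the slots described by `y`. -/
def lpObjective (y : WithBot ℝ → ℝ) : ℝ :=
  ∑ t ∈ I.T, (t + I.p) * (y t - y (I.prec t))

def LPOptimal (y : WithBot ℝ → ℝ) : Prop :=
  I.LPFeasible y ∧ ∀ y', I.LPFeasible y' → I.lpObjective y ≤ I.lpObjective y'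

/-! ### The constraint graph, shortest paths and the flow problem -/

/-- The arcs `(tail, head, cost)`: one arc from `u` to `v` of cost `w` for every constraint
`y v - y u ≤ w` of the linear program. -/
def arcs : Finset (WithBot ℝ × WithBot ℝ × ℤ) :=
  {(⊥, I.T.max, (I.n : ℤ))} ∪
  (I.T.image fun t : ℝ => ((t : WithBot ℝ), I.prec t, (0 : ℤ))) ∪
  (I.T.image fun s => (I.prec s, I.prec (s + I.p), (I.m : ℤ))) ∪
  (((univ : Finset (Fin I.n × Fin I.n)).filter fun q => 0 < I.c q.1 q.2).image
    fun q => (I.round (I.D q.2 - I.p), I.prec (I.r q.1), -(I.c q.1 q.2 : ℤ)))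

/-- `Walk u v w`: there is a walk of total cost `w` from `u` to `v`. -/
inductive Walk : WithBot ℝ → WithBot ℝ → ℤ → Prop
  | nil (u : WithBot ℝ) : Walk u u 0
  | snoc {u v x : WithBot ℝ} {w a : ℤ} : Walk u v w → (v, x, a) ∈ I.arcs → Walk u x (w + a)

/-- `y v` is the length of a shortest path from the source `t₀` to `v`, for every `v` in `T'`. -/
def IsDistance (y : WithBot ℝ → ℤ) : Prop :=
  ∀ v ∈ I.T', IsLeast {w : ℤ | I.Walk ⊥ v w} (y v)

/-- Feasible flows, without capacities. The demand of a point `t` of `T` is the distance to the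
next point of `T`, and `0` if `t` is the last one; all of it is supplied by `t₀`. -/
structure IsFlow (f : WithBot ℝ × WithBot ℝ × ℤ → ℝ) : Prop where
  nonneg : ∀ a ∈ I.arcs, 0 ≤ f a
  conserve : ∀ t ∈ I.T,
    (∑ a ∈ I.arcs with a.2.1 = (t : WithBot ℝ), f a) -
      (∑ a ∈ I.arcs with a.1 = (t : WithBot ℝ), f a) =
    ∑ u ∈ I.T with I.prec u = (t : WithBot ℝ), (u - t)

def flowCost (f : WithBot ℝ × WithBot ℝ × ℤ → ℝ) : ℝ := ∑ a ∈ I.arcs, (a.2.2 : ℝ) * f a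

def IsMinCostFlow (f : WithBot ℝ × WithBot ℝ × ℤ → ℝ) : Prop :=
  I.IsFlow f ∧ ∀ f', I.IsFlow f' → I.flowCost f ≤ I.flowCost f'

/-! ### Earliest due date assignment -/

variable {I} in
/-- `S` is an earliest due date assignment of the jobs to the slots of the skeleton `y`.
The slots are numbered from left to right, slot `k` starts at `σ k`, and exactly
`y t - y (prec t)` of them start at `t`. Slot `k` receives the job `π k`, which is released and has
the smallest deadline among the jobs that are released at `σ k` and not yet assigned (those are
among the `π l` with `k ≤ l`); the slot is on machine `k mod m`. -/
def Schedule.IsEDD (S : I.Schedule) (y : WithBot ℝ → ℤ) : Prop :=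
  ∃ (σ : Fin I.n → ℝ) (π : Equiv.Perm (Fin I.n)),
    Monotone σ ∧ (∀ k, σ k ∈ I.T) ∧
    (∀ t ∈ I.T, (#{k : Fin I.n | σ k = t} : ℤ) = y t - y (I.prec t)) ∧
    ∀ k, I.r (π k) ≤ σ k ∧
      (∀ l, k ≤ l → I.r (π l) ≤ σ k → I.D (π k) ≤ I.D (π l)) ∧
      S.start (π k) = σ k ∧ (S.machine (π k) : ℕ) = (k : ℕ) % I.m

end JobInstance

/-! ### The machine model

A random access machine with integer registers, integer arrays, time registers and time arrays.
Integers and times can be added, subtracted and compared; there is no multiplication, no rounding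
and no conversion between the two sorts. (On integral inputs all times stay integral.)
Every elementary operation costs one step. -/

/-- A memory content. Registers are named, and arrays are named and indexed by integers. -/
structure Store where
  ivar : ℕ → ℤ
  iarr : ℕ → ℤ → ℤ
  tvar : ℕ → ℝ
  tarr : ℕ → ℤ → ℝ

/-- Overwrite an integer register. -/
def Store.iset (s : Store) (x : ℕ) (v : ℤ) : Store :=
  { s with ivar := Function.update s.ivar x v }

/-- Overwrite an entry of an integer array. -/
def Store.iput (s : Store) (a : ℕ) (i v : ℤ) : Store :=
  { s with iarr := Function.update s.iarr a (Function.update (s.iarr a) i v) }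

/-- Overwrite a time register. -/
def Store.tset (s : Store) (x : ℕ) (v : ℝ) : Store :=
  { s with tvar := Function.update s.tvar x v }

/-- Overwrite an entry of a time array. -/
def Store.tput (s : Store) (a : ℕ) (i : ℤ) (v : ℝ) : Store :=
  { s with tarr := Function.update s.tarr a (Function.update (s.tarr a) i v) }

/-- Integer expressions. -/
inductive IExp
  | lit (z : ℤ)
  | var (x : ℕ)
  | arr (a : ℕ) (i : IExp)
  | add (e₁ e₂ : IExp)
  | sub (e₁ e₂ : IExp)

def IExp.eval (s : Store) : IExp → ℤ
  | .lit z => z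
  | .var x => s.ivar x
  | .arr a i => s.iarr a (i.eval s)
  | .add e₁ e₂ => e₁.eval s + e₂.eval s
  | .sub e₁ e₂ => e₁.eval s - e₂.eval s

def IExp.cost : IExp → ℕ
  | .lit _ => 1
  | .var _ => 1
  | .arr _ i => i.cost + 1
  | .add e₁ e₂ => e₁.cost + e₂.cost + 1
  | .sub e₁ e₂ => e₁.cost + e₂.cost + 1

/-- Time expressions. -/
inductive TExp
  | var (x : ℕ)
  | arr (a : ℕ) (i : IExp)
  | add (e₁ e₂ : TExp)
  | sub (e₁ e₂ : TExp)

def TExp.eval (s : Store) : TExp → ℝ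
  | .var x => s.tvar x
  | .arr a i => s.tarr a (i.eval s)
  | .add e₁ e₂ => e₁.eval s + e₂.eval s
  | .sub e₁ e₂ => e₁.eval s - e₂.eval s

def TExp.cost : TExp → ℕ
  | .var _ => 1
  | .arr _ i => i.cost + 1
  | .add e₁ e₂ => e₁.cost + e₂.cost + 1
  | .sub e₁ e₂ => e₁.cost + e₂.cost + 1

/-- Tests. -/
inductive Test
  | ile (e₁ e₂ : IExp)
  | tle (e₁ e₂ : TExp)
  | neg (b : Test)
  | conj (b₁ b₂ : Test)

def Test.Holds (s : Store) : Test → Prop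
  | .ile e₁ e₂ => e₁.eval s ≤ e₂.eval s
  | .tle e₁ e₂ => e₁.eval s ≤ e₂.eval s
  | .neg b => ¬ b.Holds s
  | .conj b₁ b₂ => b₁.Holds s ∧ b₂.Holds s

def Test.cost : Test → ℕ
  | .ile e₁ e₂ => e₁.cost + e₂.cost + 1
  | .tle e₁ e₂ => e₁.cost + e₂.cost + 1
  | .neg b => b.cost + 1
  | .conj b₁ b₂ => b₁.cost + b₂.cost + 1

/-- Programs. -/
inductive Program
  | nop
  | iset (x : ℕ) (e : IExp)
  | iput (a : ℕ) (i e : IExp)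
  | tset (x : ℕ) (e : TExp)
  | tput (a : ℕ) (i : IExp) (e : TExp)
  | seq (P Q : Program)
  | branch (b : Test) (P Q : Program)
  | loop (b : Test) (P : Program)

/-- `Exec P s s' k`: started on the memory content `s`, the program `P` halts after exactly `k`
steps with the memory content `s'`. -/
inductive Exec : Program → Store → Store → ℕ → Prop
  | nop (s : Store) : Exec .nop s s 1
  | iset (s : Store) (x : ℕ) (e : IExp) :
      Exec (.iset x e) s (s.iset x (e.eval s)) (e.cost + 1)
  | iput (s : Store) (a : ℕ) (i e : IExp) :
      Exec (.iput a i e) s (s.iput a (i.eval s) (e.eval s))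
        (i.cost + e.cost + 1)
  | tset (s : Store) (x : ℕ) (e : TExp) :
      Exec (.tset x e) s (s.tset x (e.eval s)) (e.cost + 1)
  | tput (s : Store) (a : ℕ) (i : IExp) (e : TExp) :
      Exec (.tput a i e) s (s.tput a (i.eval s) (e.eval s))
        (i.cost + e.cost + 1)
  | seq {P Q : Program} {s s₁ s₂ : Store} {k₁ k₂ : ℕ} :
      Exec P s s₁ k₁ → Exec Q s₁ s₂ k₂ → Exec (.seq P Q) s s₂ (k₁ + k₂)
  | branch_true {b : Test} {P Q : Program} {s s' : Store} {k : ℕ} :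
      b.Holds s → Exec P s s' k → Exec (.branch b P Q) s s' (b.cost + k)
  | branch_false {b : Test} {P Q : Program} {s s' : Store} {k : ℕ} :
      ¬ b.Holds s → Exec Q s s' k → Exec (.branch b P Q) s s' (b.cost + k)
  | loop_done {b : Test} {P : Program} {s : Store} :
      ¬ b.Holds s → Exec (.loop b P) s s b.cost
  | loop_step {b : Test} {P : Program} {s s₁ s₂ : Store} {k₁ k₂ : ℕ} :
      b.Holds s → Exec P s s₁ k₁ → Exec (.loop b P) s₁ s₂ k₂ →
      Exec (.loop b P) s s₂ (b.cost + k₁ + k₂)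

/-! ### Input and output conventions -/

/-- A vector as an array that is `0` outside of the indices `0, …, n - 1`. -/
def toArray {n : ℕ} (v : Fin n → ℝ) (z : ℤ) : ℝ :=
  if h : 0 ≤ z ∧ z.toNat < n then v ⟨z.toNat, h.2⟩ else 0

namespace JobInstance

variable (I : JobInstance)

/-- The initial memory: `n` and `m` in the integer registers `0` and `1`, `p` in the time register
`0`, the release times and the deadlines in the time arrays `0` and `1`, and `0` elsewhere. -/
def input : Store where
  ivar x := if x = 0 then I.n else if x = 1 then I.m else 0
  iarr _ _ := 0
  tvar x := if x = 0 then I.p else 0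
  tarr a := if a = 0 then toArray I.r else if a = 1 then toArray I.D else fun _ => 0

/-- The numbers `c i j` are stored row by row in the integer array `0`. -/
def StoresC (s : Store) : Prop :=
  ∀ i j : Fin I.n, s.iarr 0 ((i : ℕ) * I.n + (j : ℕ) : ℤ) = I.c i j

/-- The points of `T` are stored in increasing order in the time array `2`, their number in the
integer register `3`, and the values of `y` at them in the integer array `1`. -/
def StoresSkeleton (s : Store) (y : WithBot ℝ → ℤ) : Prop :=
  s.ivar 3 = #I.T ∧ ∀ k : Fin #I.T,
    s.tarr 2 ((k : ℕ) : ℤ) = I.T.orderEmbOfFin rfl k ∧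
    s.iarr 1 ((k : ℕ) : ℤ) = y (I.T.orderEmbOfFin rfl k : ℝ)

variable {I} in
/-- The start times are stored in the time array `3` and the machines in the integer array `2`. -/
def Schedule.StoredIn (S : I.Schedule) (s : Store) : Prop :=
  ∀ j : Fin I.n, s.tarr 3 ((j : ℕ) : ℤ) = S.start j ∧
    s.iarr 2 ((j : ℕ) : ℤ) = ((S.machine j : ℕ) : ℤ)

end JobInstance

end EqualLengthJobs

end

open EqualLengthJobs

namespace EqualLengthJobs

open Finset

namespace JobInstance

variable (I : JobInstance)

/-! ### Time points -/

/-! The constraints of the linear program bound differences of two variables, so its feasible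
solutions are the potentials of the constraint graph that vanish at `t₀` (`lpFeasible_iff`). The
inclusion constraint of the first release time and the last deadline, with the total constraint,
forces exactly `n` slots (`LPFeasible.max_eq`). Summation by parts then turns the objective into a
constant minus a nonnegative combination of the `y t` (`lpObjective_eq`). A potential never exceeds
a walk length, so the distances from `t₀` are the pointwise largest potential and hence an optimal
integral solution (`IsDistance.lpOptimal`). Sending each demand along a shortest path gives a flow
of matching cost, which is duality.

The program is a relaxation of scheduling: shifting every job to the left as far as its machine
order permits puts all starts into `T` without delaying any job, and counting starts then gives a
feasible `y` (`Schedule.Valid.exists_lpObjective_le`). Conversely, filling the slots by earliest due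
date is feasible (`Schedule.IsEDD.valid`). The load constraints make the cyclic machine choice
legal, and a missed deadline would expose a block of jobs that violates an inclusion constraint.
Both problems thus have the same optimum, and they are feasible or infeasible together.

For the algorithm, points of `T'` become integer positions, with `t₀` at `-1`. The matrix `c` is
found by bucket counting, one row in linear time. The at most `n ^ 2` points and `O(n ^ 2)` arcs
allow Bellman-Ford with `#T` rounds in time `O(n ^ 4)`. Its entries always remain lengths of walks,
and each round makes at least one more point correct (`IsDistance.card_lt_of_relaxed`). A final
check of all arcs decides feasibility. Running times are proved with a small program logic (`Runs`)
that carries a step bound, a postcondition and the parts of memory left unchanged. -/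

theorem card_T_le : #I.T ≤ I.n ^ 2 := by
  refine card_image_le.trans ?_
  simp [sq]

theorem r_mem_T (i : Fin I.n) : I.r i ∈ I.T :=
  mem_image.2 ⟨(i, ⟨0, i.pos⟩), mem_univ _, by simp⟩

theorem T_nonempty (hn : 0 < I.n) : I.T.Nonempty := ⟨_, I.r_mem_T ⟨0, hn⟩⟩

theorem mem_T' {v : WithBot ℝ} : v ∈ I.T' ↔ v = ⊥ ∨ ∃ t ∈ I.T, (t : WithBot ℝ) = v := by
  simp [T']

theorem bot_mem_T' : ⊥ ∈ I.T' := I.mem_T'.2 (Or.inl rfl)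

theorem coe_mem_T' {t : ℝ} (ht : t ∈ I.T) : (t : WithBot ℝ) ∈ I.T' :=
  I.mem_T'.2 (Or.inr ⟨t, ht, rfl⟩)

theorem max_filter_mem_T' (P : ℝ → Prop) [DecidablePred P] : (I.T.filter P).max ∈ I.T' := by
  rcases h : (I.T.filter P).max with _ | t
  · exact I.bot_mem_T'
  · exact I.coe_mem_T' (mem_filter.1 (mem_of_max h)).1

theorem round_mem_T' (x : ℝ) : I.round x ∈ I.T' := I.max_filter_mem_T' _

theorem prec_mem_T' (x : ℝ) : I.prec x ∈ I.T' := I.max_filter_mem_T' _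

theorem max_mem_T' : I.T.max ∈ I.T' := by
  simpa using I.max_filter_mem_T' fun _ => True

theorem coe_le_round {s x : ℝ} (hs : s ∈ I.T) : (s : WithBot ℝ) ≤ I.round x ↔ s ≤ x := by
  constructor
  · intro h
    obtain ⟨t, ht⟩ := WithBot.ne_bot_iff_exists.1 (ne_bot_of_le_ne_bot WithBot.coe_ne_bot h)
    have := (mem_filter.1 (mem_of_max ht.symm)).2
    rw [← ht] at h
    exact (WithBot.coe_le_coe.1 h).trans this
  · intro h
    exact le_max (mem_filter.2 ⟨hs, h⟩)

theorem coe_le_prec {s x : ℝ} (hs : s ∈ I.T) : (s : WithBot ℝ) ≤ I.prec x ↔ s < x := by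
  constructor
  · intro h
    obtain ⟨t, ht⟩ := WithBot.ne_bot_iff_exists.1 (ne_bot_of_le_ne_bot WithBot.coe_ne_bot h)
    have := (mem_filter.1 (mem_of_max ht.symm)).2
    rw [← ht] at h
    exact (WithBot.coe_le_coe.1 h).trans_lt this
  · intro h
    exact le_max (mem_filter.2 ⟨hs, h⟩)

theorem le_max_T {s : ℝ} (hs : s ∈ I.T) : (s : WithBot ℝ) ≤ I.T.max := le_max hs

/-- The position of a point of `T'`, counted from `-1`. -/
noncomputable def idx (v : WithBot ℝ) : ℤ := #(I.T.filter fun s : ℝ => (s : WithBot ℝ) ≤ v) - 1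

theorem idx_bot : I.idx ⊥ = -1 := by simp [idx]

theorem idx_prec (x : ℝ) : I.idx (I.prec x) = #{s ∈ I.T | s < x} - 1 := by
  rw [idx, filter_congr fun s hs => I.coe_le_prec hs]

theorem idx_round (x : ℝ) : I.idx (I.round x) = #{s ∈ I.T | s ≤ x} - 1 := by
  rw [idx, filter_congr fun s hs => I.coe_le_round hs]

theorem idx_coe (x : ℝ) : I.idx x = #{s ∈ I.T | s ≤ x} - 1 := by
  simp [idx]

theorem idx_max : I.idx I.T.max = #I.T - 1 := by
  rw [idx, filter_true_of_mem fun s hs => I.le_max_T hs]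

/-- The larger point is counted in its own position but not in that of the smaller one. Functions on
`T'` can therefore be kept in arrays without loss. -/
theorem idx_strictMonoOn : StrictMonoOn I.idx I.T' := by
  intro u _ v hv h
  have : #(I.T.filter fun s : ℝ => (s : WithBot ℝ) ≤ u) <
      #(I.T.filter fun s : ℝ => (s : WithBot ℝ) ≤ v) := by
    apply card_lt_card
    rcases I.mem_T'.1 hv with rfl | ⟨t, ht, rfl⟩
    · simp at h
    · refine ⟨fun s hs => ?_, fun hs => ?_⟩
      · rw [mem_filter] at hs ⊢
        exact ⟨hs.1, hs.2.trans h.le⟩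
      · exact h.not_ge (mem_filter.1 (hs (mem_filter.2 ⟨ht, le_rfl⟩))).2
  simp only [idx]
  omega

theorem idx_injOn : Set.InjOn I.idx I.T' := I.idx_strictMonoOn.injOn

theorem filter_le_coe_eq_insert {t : ℝ} (ht : t ∈ I.T) :
    (I.T.filter fun s : ℝ => (s : WithBot ℝ) ≤ t) =
      insert t (I.T.filter fun s : ℝ => (s : WithBot ℝ) ≤ I.prec t) := by
  ext s
  rw [mem_insert, mem_filter, mem_filter, WithBot.coe_le_coe]
  constructor
  · rintro ⟨hs, h⟩
    rcases h.eq_or_lt with h | h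
    · exact Or.inl h
    · exact Or.inr ⟨hs, (I.coe_le_prec hs).2 h⟩
  · rintro (rfl | ⟨hs, h⟩)
    · exact ⟨ht, le_rfl⟩
    · exact ⟨hs, ((I.coe_le_prec hs).1 h).le⟩

theorem notMem_filter_le_prec {t : ℝ} :
    t ∉ (I.T.filter fun s : ℝ => (s : WithBot ℝ) ≤ I.prec t) := by
  intro h
  rw [mem_filter] at h
  exact lt_irrefl _ ((I.coe_le_prec h.1).1 h.2)

/-- Every function on `T'` is the sum of its increments. -/
theorem eq_sum_increments (y : WithBot ℝ → ℝ) {v : WithBot ℝ} (hv : v ∈ I.T') :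
    y v = y ⊥ + ∑ s ∈ I.T.filter fun s : ℝ => (s : WithBot ℝ) ≤ v, (y s - y (I.prec s)) := by
  induction h : #(I.T.filter fun s : ℝ => (s : WithBot ℝ) ≤ v)
    using Nat.strong_induction_on generalizing v with
  | _ k ih =>
    rcases I.mem_T'.1 hv with rfl | ⟨t, ht, rfl⟩
    · simp
    · rw [I.filter_le_coe_eq_insert ht] at h ⊢
      rw [card_insert_of_notMem I.notMem_filter_le_prec] at h
      have := ih _ (by omega) (I.prec_mem_T' t) rfl
      rw [sum_insert I.notMem_filter_le_prec]
      linarith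

theorem prec_eq_sum (y : WithBot ℝ → ℝ) (x : ℝ) :
    y (I.prec x) = y ⊥ + ∑ s ∈ I.T with s < x, (y s - y (I.prec s)) := by
  rw [I.eq_sum_increments y (I.prec_mem_T' x), filter_congr fun s hs => I.coe_le_prec hs]

theorem round_eq_sum (y : WithBot ℝ → ℝ) (x : ℝ) :
    y (I.round x) = y ⊥ + ∑ s ∈ I.T with s ≤ x, (y s - y (I.prec s)) := by
  rw [I.eq_sum_increments y (I.round_mem_T' x), filter_congr fun s hs => I.coe_le_round hs]

theorem max_eq_sum (y : WithBot ℝ → ℝ) :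
    y I.T.max = y ⊥ + ∑ s ∈ I.T, (y s - y (I.prec s)) := by
  rw [I.eq_sum_increments y I.max_mem_T', filter_true_of_mem fun s hs => I.le_max_T hs]

/-! ### The linear program as a system of potential constraints -/

theorem mem_arcs {a : WithBot ℝ × WithBot ℝ × ℤ} : a ∈ I.arcs ↔
    a = (⊥, I.T.max, (I.n : ℤ)) ∨ (∃ t ∈ I.T, a = ((t : WithBot ℝ), I.prec t, 0)) ∨
    (∃ s ∈ I.T, a = (I.prec s, I.prec (s + I.p), (I.m : ℤ))) ∨
    ∃ i j, 0 < I.c i j ∧ a = (I.round (I.D j - I.p), I.prec (I.r i), -(I.c i j : ℤ)) := by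
  simp only [arcs, mem_union, mem_singleton, mem_image, mem_filter, mem_univ, true_and,
    Prod.exists, or_assoc, eq_comm (a := a)]

/-- Each of the four families of constraints is one of the four families of arcs; this is the
passage to shortest paths. -/
theorem lpFeasible_iff (y : WithBot ℝ → ℝ) :
    I.LPFeasible y ↔ y ⊥ = 0 ∧ ∀ a ∈ I.arcs, y a.2.1 ≤ y a.1 + a.2.2 := by
  constructor
  · intro h
    refine ⟨h.source, fun a ha => ?_⟩
    rcases I.mem_arcs.1 ha with rfl | ⟨t, ht, rfl⟩ | ⟨s, hs, rfl⟩ | ⟨i, j, hc, rfl⟩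
    · have := h.total; push_cast; linarith
    · have := h.order t ht; push_cast; linarith
    · have := h.load s hs; push_cast; linarith
    · have := h.incl i j hc; push_cast; linarith
  · rintro ⟨h0, h⟩
    refine ⟨h0, ?_, fun t ht => ?_, fun s hs => ?_, fun i j hc => ?_⟩
    · have := h _ (I.mem_arcs.2 (Or.inl rfl)); push_cast at this; linarith
    · have := h _ (I.mem_arcs.2 (Or.inr (Or.inl ⟨t, ht, rfl⟩))); push_cast at this; linarith
    · have := h _ (I.mem_arcs.2 (Or.inr (Or.inr (Or.inl ⟨s, hs, rfl⟩))))
      push_cast at this; linarith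
    · have := h _ (I.mem_arcs.2 (Or.inr (Or.inr (Or.inr ⟨i, j, hc, rfl⟩))))
      push_cast at this; linarith

theorem arcs_mem_T' {a : WithBot ℝ × WithBot ℝ × ℤ} (ha : a ∈ I.arcs) :
    a.1 ∈ I.T' ∧ a.2.1 ∈ I.T' := by
  rcases I.mem_arcs.1 ha with rfl | ⟨t, ht, rfl⟩ | ⟨s, hs, rfl⟩ | ⟨i, j, hc, rfl⟩
  · exact ⟨I.bot_mem_T', I.max_mem_T'⟩
  · exact ⟨I.coe_mem_T' ht, I.prec_mem_T' _⟩
  · exact ⟨I.prec_mem_T' _, I.prec_mem_T' _⟩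
  · exact ⟨I.round_mem_T' _, I.prec_mem_T' _⟩

variable {I}

theorem LPFeasible.increment_nonneg {y : WithBot ℝ → ℝ} (h : I.LPFeasible y) {t : ℝ}
    (ht : t ∈ I.T) : 0 ≤ y t - y (I.prec t) := by
  have := h.order t ht
  linarith

theorem exists_first_release (hn : 0 < I.n) : ∃ i, ∀ k, I.r i ≤ I.r k := by
  have : Nonempty (Fin I.n) := ⟨⟨0, hn⟩⟩
  exact Finite.exists_min I.r

theorem exists_last_deadline (hn : 0 < I.n) : ∃ j, ∀ k, I.D k ≤ I.D j := by
  have : Nonempty (Fin I.n) := ⟨⟨0, hn⟩⟩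
  exact Finite.exists_max I.D

/-- All jobs lie between the first release time and the last deadline, so one inclusion constraint
asks for `n` slots, and the total constraint allows no more. -/
theorem LPFeasible.max_eq {y : WithBot ℝ → ℝ} (h : I.LPFeasible y) (hn : 0 < I.n) :
    y I.T.max = I.n := by
  obtain ⟨i, hi⟩ := exists_first_release hn
  obtain ⟨j, hj⟩ := exists_last_deadline hn
  have hc : I.c i j = I.n := by simp [c, hi, hj]
  have h1 := h.incl i j (by omega)
  have h2 := h.total
  rw [h.source] at h2
  have h3 : 0 ≤ y (I.prec (I.r i)) := by
    rw [I.prec_eq_sum y, h.source, zero_add]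
    exact sum_nonneg fun s hs => h.increment_nonneg (mem_filter.1 hs).1
  have h4 : y (I.round (I.D j - I.p)) ≤ y I.T.max := by
    rw [I.round_eq_sum y, I.max_eq_sum y]
    gcongr
    · intro s hs _
      exact h.increment_nonneg hs
    · exact filter_subset _ _
  rw [hc] at h1
  linarith

variable (I)

/-- The demand of a point of `T` in the flow problem. -/
noncomputable def demand (t : ℝ) : ℝ := ∑ u ∈ I.T with I.prec u = (t : WithBot ℝ), (u - t)

theorem prec_lt {u t : ℝ} (h : I.prec u = (t : WithBot ℝ)) : t ∈ I.T ∧ t < u :=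
  mem_filter.1 (mem_of_max h)

theorem demand_nonneg (t : ℝ) : 0 ≤ I.demand t := by
  refine sum_nonneg fun u hu => ?_
  have := I.prec_lt (mem_filter.1 hu).2
  linarith [this.2]

/-- Summation by parts. -/
theorem lpObjective_eq {y : WithBot ℝ → ℝ} (hy : y ⊥ = 0) {τ : ℝ} (hτ : I.T.max = τ) :
    I.lpObjective y = (τ + I.p) * y τ - ∑ t ∈ I.T, I.demand t * y t := by
  -- The value at `t₀` is arbitrary: it only occurs multiplied by `y ⊥ = 0`. The identity telescopes
  -- `(e v + p) * y v`.
  let e : WithBot ℝ → ℝ := fun v => WithBot.recBotCoe 0 (fun t => t) v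
  have h1 := I.max_eq_sum fun v => (e v + I.p) * y v
  have h2 : ∑ t ∈ I.T, I.demand t * y t =
      ∑ u ∈ I.T, if I.prec u = ⊥ then 0 else (u - e (I.prec u)) * y (I.prec u) := by
    simp only [demand, sum_mul, sum_filter]
    rw [sum_comm]
    refine sum_congr rfl fun u hu => ?_
    rcases h : I.prec u with _ | q
    · simp only [ite_mul, zero_mul]
      exact (sum_eq_zero fun t _ => if_neg WithBot.bot_ne_coe).trans (if_pos rfl).symm
    · change _ = if (q : WithBot ℝ) = ⊥ then 0 else (u - q) * y q
      rw [if_neg WithBot.coe_ne_bot, sum_eq_single q]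
      · simp [WithBot.some_eq_coe]
      · intro t _ htq
        rw [if_neg, zero_mul]
        intro h'
        exact htq (WithBot.coe_injective h').symm
      · intro hq
        exact absurd (I.prec_lt h).1 hq
  rw [hτ] at h1
  simp only [hy, mul_zero, zero_add] at h1
  change (τ + I.p) * y τ = _ at h1
  rw [h1, h2, ← sum_sub_distrib]
  refine sum_congr rfl fun t _ => ?_
  change _ = (t + I.p) * y t - _ - _
  split_ifs with h
  · simp [h, hy]
  · ring

/-! ### Shortest paths -/

variable {I}

theorem Walk.potential_le {y : WithBot ℝ → ℝ} (hy : ∀ a ∈ I.arcs, y a.2.1 ≤ y a.1 + a.2.2)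
    {u v : WithBot ℝ} {w : ℤ} (h : I.Walk u v w) : y v ≤ y u + w := by
  induction h with
  | nil => simp
  | snoc _ ha ih =>
    have := hy _ ha
    push_cast at this ⊢
    linarith

/-- A potential bounds all walk lengths from below, so a walk that attains the bound is shortest.
This is the optimality certificate for Bellman-Ford. -/
theorem isDistance_of_potential {y : WithBot ℝ → ℤ} (h0 : y ⊥ = 0)
    (hy : ∀ a ∈ I.arcs, y a.2.1 ≤ y a.1 + a.2.2) (hw : ∀ v ∈ I.T', I.Walk ⊥ v (y v)) :
    I.IsDistance y := by
  refine fun v hv => ⟨hw v hv, fun w h => ?_⟩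
  have := Walk.potential_le (y := fun v => (y v : ℝ)) (fun a ha => by exact_mod_cast hy a ha) h
  simp only [h0] at this
  push_cast at this
  rw [zero_add] at this
  exact_mod_cast this

theorem IsDistance.bot_eq {y : WithBot ℝ → ℤ} (h : I.IsDistance y) : y ⊥ = 0 := by
  have hb := h ⊥ I.bot_mem_T'
  have h1 : y ⊥ ≤ 0 := hb.2 (Walk.nil _)
  -- A shortest closed walk at `t₀` can be put in front of any walk. Traversing it twice shows `y ⊥
  -- ≤ y ⊥ + y ⊥`, so its length is not negative.
  have hcat : ∀ {v w}, I.Walk ⊥ v w → I.Walk ⊥ v (y ⊥ + w) := by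
    intro v w hw
    induction hw with
    | nil => simpa using hb.1
    | snoc _ ha ih => simpa [add_assoc] using ih.snoc ha
  have h2 := hb.2 (hcat hb.1)
  omega

theorem IsDistance.arc_le {y : WithBot ℝ → ℤ} (h : I.IsDistance y)
    {a : WithBot ℝ × WithBot ℝ × ℤ} (ha : a ∈ I.arcs) : y a.2.1 ≤ y a.1 + a.2.2 :=
  (h _ (I.arcs_mem_T' ha).2).2 ((h _ (I.arcs_mem_T' ha).1).1.snoc ha)

theorem IsDistance.lpFeasible {y : WithBot ℝ → ℤ} (h : I.IsDistance y) :
    I.LPFeasible fun t => (y t : ℝ) :=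
  (I.lpFeasible_iff _).2
    ⟨by simp [h.bot_eq], fun _ ha => by exact_mod_cast h.arc_le ha⟩

theorem exists_max (hn : 0 < I.n) : ∃ τ ∈ I.T, I.T.max = τ := by
  obtain ⟨τ, hτ⟩ := max_of_nonempty (I.T_nonempty hn)
  exact ⟨τ, mem_of_max hτ, hτ⟩

/-- After summation by parts the first term is the same for all feasible solutions, and the `y t`
enter with coefficients `-demand t ≤ 0`. The pointwise largest potential is therefore the best one.
-/
theorem IsDistance.lpOptimal {y : WithBot ℝ → ℤ} (h : I.IsDistance y) (hn : 0 < I.n) :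
    I.LPOptimal fun t => (y t : ℝ) := by
  refine ⟨h.lpFeasible, fun y' hy' => ?_⟩
  obtain ⟨τ, hτT, hτ⟩ := exists_max hn
  rw [I.lpObjective_eq (h.lpFeasible.source) hτ, I.lpObjective_eq hy'.source hτ]
  have e1 := h.lpFeasible.max_eq hn
  have e2 := hy'.max_eq hn
  rw [hτ] at e1 e2
  rw [e1, e2]
  gcongr with t ht
  · exact I.demand_nonneg t
  · have := (h _ (I.coe_mem_T' ht)).1.potential_le ((I.lpFeasible_iff y').1 hy').2
    rwa [hy'.source, zero_add] at this

/-- If the linear program is feasible, then all distances from `t₀` exist. -/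
theorem LPFeasible.exists_isDistance {y : WithBot ℝ → ℝ} (h : I.LPFeasible y)
    (hw : ∀ v ∈ I.T', ∃ w, I.Walk ⊥ v w) : ∃ δ, I.IsDistance δ := by
  have key : ∀ v : WithBot ℝ, ∃ d : ℤ, v ∈ I.T' → IsLeast {w : ℤ | I.Walk ⊥ v w} d := by
    intro v
    by_cases hv : v ∈ I.T'
    -- The potential bounds the integral walk lengths from below, so the minimum is attained; no
    -- discussion of negative cycles is needed.
    · obtain ⟨d, hd, hmin⟩ := Int.exists_least_of_bdd (P := fun w => I.Walk ⊥ v w)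
        ⟨⌊y v⌋, fun w h' => by
          have := h'.potential_le ((I.lpFeasible_iff y).1 h).2
          rw [h.source, zero_add] at this
          exact_mod_cast (Int.floor_le _).trans this⟩ (hw v hv)
      exact ⟨d, fun _ => ⟨hd, hmin⟩⟩
    · exact ⟨0, fun h' => absurd h' hv⟩
  choose δ hδ using key
  exact ⟨δ, hδ⟩

/-- The arcs of a shortest path are tight. -/
theorem IsDistance.exists_tight_arc {δ : WithBot ℝ → ℤ} (h : I.IsDistance δ)
    {F : Set (WithBot ℝ)} (hF : ⊥ ∈ F) {v : WithBot ℝ} {w : ℤ} (hw : I.Walk ⊥ v w)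
    (hv : v ∉ F) (hδ : w = δ v) :
    ∃ a ∈ I.arcs, a.1 ∈ F ∧ a.2.1 ∉ F ∧ δ a.2.1 = δ a.1 + a.2.2 := by
  have key : ∀ u, u = ⊥ → ∀ v w, I.Walk u v w → v ∉ F → w = δ v →
      ∃ a ∈ I.arcs, a.1 ∈ F ∧ a.2.1 ∉ F ∧ δ a.2.1 = δ a.1 + a.2.2 := by
    intro u hu v w hw
    induction hw with
    | nil => intro h'; exact absurd (hu ▸ hF) h'
    | @snoc v x w a hw ha ih =>
      intro hx hwx
      have h1 := h.arc_le ha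
      have h2 : δ v ≤ w := (h v (I.arcs_mem_T' ha).1).2 (by simpa [hu] using hw)
      simp only at h1
      -- The last arc is tight and the prefix is again shortest, since `δ x ≤ δ v + a` and `δ v ≤ w`
      -- hold with equality. Either this arc leaves `F`, or the prefix ends outside `F` and the
      -- induction continues with it.
      by_cases hvF : v ∈ F
      · exact ⟨_, ha, hvF, hx, by simp only; omega⟩
      · exact ih hvF (by omega)
  exact key ⊥ rfl v w hw hv hδ

variable {I : JobInstance}

/-! ### The flow problem -/

/-- The unit flow along a walk. -/
theorem Walk.exists_flow {u v : WithBot ℝ} {w : ℤ} (h : I.Walk u v w) :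
    ∃ g : WithBot ℝ × WithBot ℝ × ℤ → ℝ, (∀ a, 0 ≤ g a) ∧
      (∀ x, (∑ a ∈ I.arcs with a.2.1 = x, g a) - (∑ a ∈ I.arcs with a.1 = x, g a) =
        (if v = x then 1 else 0) - if u = x then 1 else 0) ∧
      ∑ a ∈ I.arcs, (a.2.2 : ℝ) * g a = w := by
  induction h with
  | nil => exact ⟨fun _ => 0, by simp⟩
  | @snoc v x w c hw ha ih =>
    obtain ⟨g, h0, hg, hc⟩ := ih
    refine ⟨fun a => g a + if a = (v, x, c) then 1 else 0, fun a => ?_, fun z => ?_, ?_⟩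
    · have := h0 a
      positivity
    · have := hg z
      simp only [sum_add_distrib, sum_ite_eq', mem_filter, ha, true_and]
      linarith
    · simp only [mul_add, sum_add_distrib, hc, mul_ite, mul_one, mul_zero, sum_ite_eq', ha,
        if_true]
      push_cast
      rfl

theorem sum_arcs_head (y : WithBot ℝ → ℝ) (f : WithBot ℝ × WithBot ℝ × ℤ → ℝ) :
    ∑ a ∈ I.arcs, y a.2.1 * f a = ∑ v ∈ I.T', y v * ∑ a ∈ I.arcs with a.2.1 = v, f a := by
  rw [← sum_fiberwise_of_maps_to (t := I.T') (g := fun a => a.2.1)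
    fun a ha => (I.arcs_mem_T' ha).2]
  refine sum_congr rfl fun v _ => ?_
  rw [mul_sum]
  refine sum_congr rfl fun a ha => ?_
  rw [(mem_filter.1 ha).2]

theorem sum_arcs_tail (y : WithBot ℝ → ℝ) (f : WithBot ℝ × WithBot ℝ × ℤ → ℝ) :
    ∑ a ∈ I.arcs, y a.1 * f a = ∑ v ∈ I.T', y v * ∑ a ∈ I.arcs with a.1 = v, f a := by
  rw [← sum_fiberwise_of_maps_to (t := I.T') (g := fun a => a.1)
    fun a ha => (I.arcs_mem_T' ha).1]
  refine sum_congr rfl fun v _ => ?_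
  rw [mul_sum]
  refine sum_congr rfl fun a ha => ?_
  rw [(mem_filter.1 ha).2]

theorem sum_T' (F : WithBot ℝ → ℝ) : ∑ v ∈ I.T', F v = F ⊥ + ∑ t ∈ I.T, F t := by
  rw [T', sum_insert (by simp), sum_image fun _ _ _ _ h => WithBot.coe_injective h]

/-- Weak duality. -/
theorem IsFlow.le_flowCost {f : WithBot ℝ × WithBot ℝ × ℤ → ℝ} (hf : I.IsFlow f)
    {y : WithBot ℝ → ℝ} (hy : I.LPFeasible y) :
    ∑ t ∈ I.T, I.demand t * y t ≤ I.flowCost f := by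
  have h1 : ∑ a ∈ I.arcs, (y a.2.1 * f a - y a.1 * f a) ≤ I.flowCost f := by
    refine sum_le_sum fun a ha => ?_
    have h2 := ((I.lpFeasible_iff y).1 hy).2 a ha
    have h3 := mul_le_mul_of_nonneg_right h2 (hf.nonneg a ha)
    linarith
  refine le_trans (le_of_eq ?_) h1
  rw [sum_sub_distrib, sum_arcs_head, sum_arcs_tail, ← sum_sub_distrib, sum_T', hy.source]
  simp only [zero_mul, sub_zero, zero_add, ← mul_sub]
  refine sum_congr rfl fun t ht => ?_
  rw [hf.conserve t ht, demand, mul_comm]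

/-- Superpose, for every `t`, `demand t` units along a shortest path to `t`. The cost equals the
lower bound of weak duality. -/
theorem IsDistance.exists_flow {y : WithBot ℝ → ℤ} (h : I.IsDistance y) :
    ∃ f, I.IsFlow f ∧ I.flowCost f = ∑ t ∈ I.T, I.demand t * y t := by
  have key : ∀ t : ℝ, ∃ g : WithBot ℝ × WithBot ℝ × ℤ → ℝ, t ∈ I.T → (∀ a, 0 ≤ g a) ∧
      (∀ x, (∑ a ∈ I.arcs with a.2.1 = x, g a) - (∑ a ∈ I.arcs with a.1 = x, g a) =
        (if (t : WithBot ℝ) = x then 1 else 0) - if ⊥ = x then 1 else 0) ∧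
      ∑ a ∈ I.arcs, (a.2.2 : ℝ) * g a = y t := by
    intro t
    by_cases ht : t ∈ I.T
    · obtain ⟨g, hg⟩ := (h t (I.coe_mem_T' ht)).1.exists_flow
      exact ⟨g, fun _ => hg⟩
    · exact ⟨fun _ => 0, fun h' => absurd h' ht⟩
  choose g hg using key
  refine ⟨fun a => ∑ t ∈ I.T, I.demand t * g t a, ⟨fun a _ => ?_, fun x hx => ?_⟩, ?_⟩
  · exact sum_nonneg fun t ht => mul_nonneg (I.demand_nonneg t) ((hg t ht).1 a)
  · rw [sum_comm, sum_comm (s := I.arcs.filter fun a => a.1 = _), ← sum_sub_distrib]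
    simp only [← mul_sum, ← mul_sub]
    rw [sum_congr rfl fun t ht => by rw [(hg t ht).2.1 x]]
    simp [hx, demand]
  · simp only [flowCost, mul_sum]
    rw [sum_comm]
    refine sum_congr rfl fun t ht => ?_
    rw [← (hg t ht).2.2, mul_sum]
    exact sum_congr rfl fun a _ => by ring

/-- The linear program is dual to the minimum cost flow problem. -/
theorem IsDistance.exists_isMinCostFlow {y : WithBot ℝ → ℤ} (h : I.IsDistance y) (hn : 0 < I.n) :
    ∃ f, I.IsMinCostFlow f ∧ ∀ τ : ℝ, IsGreatest (I.T : Set ℝ) τ →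
      I.lpObjective (fun t => (y t : ℝ)) = I.n * (τ + I.p) - I.flowCost f := by
  obtain ⟨f, hf, hc⟩ := h.exists_flow
  refine ⟨f, ⟨hf, fun f' hf' => hc ▸ hf'.le_flowCost h.lpFeasible⟩, fun τ hτ => ?_⟩
  obtain ⟨τ', hτ'T, hτ'⟩ := exists_max hn
  have : τ = τ' := le_antisymm (WithBot.coe_le_coe.1 (hτ' ▸ I.le_max_T hτ.1)) (hτ.2 hτ'T)
  subst this
  have e := h.lpFeasible.max_eq hn
  rw [hτ'] at e
  rw [I.lpObjective_eq h.lpFeasible.source hτ', hc, e, mul_comm]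

/-! ### Rounds of the Bellman-Ford algorithm -/

/-- If the arcs are relaxed once, then the number of points with the correct value grows. -/
theorem IsDistance.card_lt_of_relaxed {δ y y' : WithBot ℝ → ℤ} (h : I.IsDistance δ)
    (hb : y ⊥ ≤ 0) (hle : ∀ v ∈ I.T', y' v ≤ y v)
    (hr : ∀ a ∈ I.arcs, y' a.2.1 ≤ y a.1 + a.2.2) {k : ℕ}
    (hk : k ≤ #{v ∈ I.T' | y v ≤ δ v}) (hkT : k < #I.T') :
    k + 1 ≤ #{v ∈ I.T' | y' v ≤ δ v} := by
  have hsub : {v ∈ I.T' | y v ≤ δ v} ⊆ {v ∈ I.T' | y' v ≤ δ v} := by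
    intro v hv
    rw [mem_filter] at hv ⊢
    exact ⟨hv.1, (hle v hv.1).trans hv.2⟩
  by_cases hall : ∀ v ∈ I.T', y v ≤ δ v
  · rw [filter_true_of_mem fun v hv => (hle v hv).trans (hall v hv)]
    omega
  · push Not at hall
    obtain ⟨v, hv, hlt⟩ := hall
    -- A shortest walk to an incorrect point leaves the set of correct points along a tight arc, and
    -- relaxing that arc corrects its head. Points outside `T'` count as correct, so the head found
    -- lies in `T'`.
    have hbF : (⊥ : WithBot ℝ) ∈ ({v | v ∈ I.T' → y v ≤ δ v} : Set (WithBot ℝ)) :=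
      fun _ => hb.trans h.bot_eq.ge
    obtain ⟨a, ha, h1, h2, h3⟩ := h.exists_tight_arc hbF (h v hv).1
      (fun hh => hlt.not_ge (hh hv)) rfl
    have hT := I.arcs_mem_T' ha
    have h4 : ¬ y a.2.1 ≤ δ a.2.1 := fun hh => h2 fun _ => hh
    refine Nat.succ_le_of_lt (hk.trans_lt (card_lt_card ⟨hsub, fun hh => ?_⟩))
    refine h4 (mem_filter.1 (hh (mem_filter.2 ⟨hT.2, ?_⟩))).2
    have := hr a ha
    have := h1 hT.1
    omega

/-! ### Skeletons -/

/-- Grouping the slots by their start turns the telescoping sum into a cardinality. All constraints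
on `y` thereby become statements about counting slots. -/
theorem eq_card_of_increments {σ : Fin I.n → ℝ} (hσ : ∀ k, σ k ∈ I.T) {y : WithBot ℝ → ℝ}
    (h0 : y ⊥ = 0) (hy : ∀ t ∈ I.T, (#{k : Fin I.n | σ k = t} : ℝ) = y t - y (I.prec t))
    {v : WithBot ℝ} (hv : v ∈ I.T') : y v = #{k : Fin I.n | (σ k : WithBot ℝ) ≤ v} := by
  rw [I.eq_sum_increments y hv, h0, zero_add,
    card_eq_sum_card_fiberwise (f := σ) (t := I.T.filter fun s : ℝ => (s : WithBot ℝ) ≤ v)]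
  · push_cast
    refine sum_congr rfl fun t ht => ?_
    rw [mem_filter] at ht
    rw [← hy t ht.1, filter_filter]
    congr 2
    ext k
    simp only [mem_filter, mem_univ, true_and]
    exact ⟨fun h => ⟨h ▸ ht.2, h⟩, fun h => h.2⟩
  · intro k hk
    simpa [hσ] using hk

theorem lpObjective_eq_sum {σ : Fin I.n → ℝ} (hσ : ∀ k, σ k ∈ I.T) {y : WithBot ℝ → ℝ}
    (hy : ∀ t ∈ I.T, (#{k : Fin I.n | σ k = t} : ℝ) = y t - y (I.prec t)) :
    I.lpObjective y = ∑ k, (σ k + I.p) := by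
  rw [← sum_fiberwise_of_maps_to (t := I.T) (g := σ) fun k _ => hσ k]
  refine sum_congr rfl fun t ht => ?_
  rw [← hy t ht, sum_congr rfl fun k hk => by rw [(mem_filter.1 hk).2]]
  rw [sum_const, nsmul_eq_mul, mul_comm]

/-- A valid schedule with start times in `T` yields a feasible solution of the linear program. -/
theorem Schedule.Valid.exists_lpFeasible {S : I.Schedule} (h : S.Valid)
    (hT : ∀ j, S.start j ∈ I.T) :
    ∃ y, I.LPFeasible y ∧ I.lpObjective y = S.totalCompletion := by
  have hp : ∀ x, #{k | (S.start k : WithBot ℝ) ≤ I.prec x} = #{k | S.start k < x} := fun x => by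
    simp only [I.coe_le_prec (hT _)]
  have hr : ∀ x, #{k | (S.start k : WithBot ℝ) ≤ I.round x} = #{k | S.start k ≤ x} := fun x => by
    simp only [I.coe_le_round (hT _)]
  refine ⟨fun v => #{k | (S.start k : WithBot ℝ) ≤ v}, ⟨by simp, ?_, fun t _ => ?_,
    fun s _ => ?_, fun i j hc => ?_⟩, ?_⟩
  · have : #{k | (S.start k : WithBot ℝ) ≤ I.T.max} ≤ I.n := (card_le_univ _).trans (by simp)
    simpa using this
  · rw [hp, sub_nonpos, Nat.cast_le]
    refine card_le_card fun k hk => ?_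
    simp only [mem_filter, mem_univ, true_and, WithBot.coe_le_coe] at hk ⊢
    exact hk.le
  · rw [hp, hp, sub_le_iff_le_add, ← Nat.cast_add, Nat.cast_le]
    have hsub : ({k | S.start k < s + I.p} : Finset (Fin I.n)) ⊆
        ({k | s ≤ S.start k ∧ S.start k < s + I.p} : Finset (Fin I.n)) ∪
          ({k | S.start k < s} : Finset (Fin I.n)) := by
      intro k hk
      simp only [mem_union, mem_filter, mem_univ, true_and] at hk ⊢
      rcases lt_or_ge (S.start k) s with h' | h'
      · exact Or.inr h'
      · exact Or.inl ⟨h', hk⟩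
    refine (card_le_card hsub).trans ((card_union_le _ _).trans ?_)
    gcongr
    rw [← Fintype.card_fin I.m, ← card_univ]
    -- Jobs that start within a half-open window of length `p` overlap, so they occupy different
    -- machines.
    refine card_le_card_of_injOn S.machine (fun _ _ => mem_univ _) fun a ha b hb hab => ?_
    simp only [coe_filter, mem_univ, true_and, Set.mem_ofPred_eq] at ha hb
    by_contra hne
    rcases h.disjoint a b hne hab with h' | h' <;> linarith
  · rw [hp, hr, le_sub_iff_add_le, ← Nat.cast_add, Nat.cast_le, c, ← card_union_of_disjoint]
    -- A job counted by `c i j` witnesses `r i ≤ D j - p`; this is needed for the jobs that start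
    -- before `r i`.
    · obtain ⟨q, hq⟩ := card_pos.1 hc
      simp only [mem_filter, mem_univ, true_and] at hq
      have h1 := h.release q
      have h2 := h.deadline q
      refine card_le_card fun k hk => ?_
      simp only [mem_union, mem_filter, mem_univ, true_and] at hk ⊢
      have h3 := h.deadline k
      rcases hk with hk | hk <;> linarith
    · rw [disjoint_left]
      intro k hk hk'
      simp only [mem_filter, mem_univ, true_and] at hk hk'
      have := h.release k
      linarith
  · refine lpObjective_eq_sum hT fun t _ => ?_
    rw [hp, eq_sub_iff_add_eq, ← Nat.cast_add, ← card_union_of_disjoint]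
    · congr 2
      ext k
      simp only [mem_union, mem_filter, mem_univ, true_and, WithBot.coe_le_coe]
      exact le_iff_eq_or_lt.symm
    · rw [disjoint_left]
      intro k hk hk'
      simp only [mem_filter, mem_univ, true_and] at hk hk'
      exact hk'.ne hk

/-! ### Left shifting a schedule -/

/-- The jobs between `i` and `j` on the machine of `j`. -/
noncomputable def Schedule.between (S : I.Schedule) (i j : Fin I.n) : Finset (Fin I.n) :=
  {k | S.machine k = S.machine j ∧ S.start i ≤ S.start k ∧ S.start k < S.start j}

theorem Schedule.mem_between {S : I.Schedule} {i j k : Fin I.n} : k ∈ S.between i j ↔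
    S.machine k = S.machine j ∧ S.start i ≤ S.start k ∧ S.start k < S.start j := by
  simp [between]

theorem Schedule.Valid.add_le {S : I.Schedule} (h : S.Valid) {j k : Fin I.n}
    (hm : S.machine k = S.machine j) (hlt : S.start k < S.start j) :
    S.start k + I.p ≤ S.start j := by
  have hp := I.p_pos
  rcases h.disjoint k j (by rintro rfl; exact lt_irrefl _ hlt) hm with h' | h'
  · exact h'
  · linarith

/-- Induction that removes the last job `q` in between: the other jobs in between are exactly those
between `i` and `q`, and `q` ends before `j` starts. -/
theorem Schedule.Valid.start_add_between_le {S : I.Schedule} (h : S.Valid) {i j : Fin I.n}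
    (hij : S.start i ≤ S.start j) : S.start i + #(S.between i j) * I.p ≤ S.start j := by
  induction hc : #(S.between i j) using Nat.strong_induction_on generalizing j with
  | _ c ih =>
    subst hc
    rcases (S.between i j).eq_empty_or_nonempty with he | hne
    · simp [he, hij]
    · obtain ⟨q, hq, hmax⟩ := exists_max_image _ S.start hne
      obtain ⟨hqm, hiq, hqj⟩ := Schedule.mem_between.1 hq
      have hsub : S.between i q ⊆ (S.between i j).erase q := by
        intro k hk
        obtain ⟨h1, h2, h3⟩ := Schedule.mem_between.1 hk
        refine mem_erase.2 ⟨by rintro rfl; exact lt_irrefl _ h3, ?_⟩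
        exact Schedule.mem_between.2 ⟨h1.trans hqm, h2, h3.trans hqj⟩
      have hsub' : (S.between i j).erase q ⊆ S.between i q := by
        intro k hk
        obtain ⟨hkq, hk⟩ := mem_erase.1 hk
        obtain ⟨h1, h2, h3⟩ := Schedule.mem_between.1 hk
        refine Schedule.mem_between.2 ⟨h1.trans hqm.symm, h2, ?_⟩
        have := hmax k hk
        have hp := I.p_pos
        rcases h.disjoint k q hkq (h1.trans hqm.symm) with h' | h' <;> linarith
      have hcard : #(S.between i q) + 1 = #(S.between i j) := by
        rw [hsub.antisymm hsub', card_erase_add_one hq]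
      have h1 := ih _ (by omega) hiq rfl
      have h2 := h.add_le hqm hqj
      rw [← hcard]
      push_cast
      linarith

/-- The jobs on the machine of `j` that do not start later than `j`. -/
noncomputable def Schedule.before (S : I.Schedule) (j : Fin I.n) : Finset (Fin I.n) :=
  {i | S.machine i = S.machine j ∧ S.start i ≤ S.start j}

theorem Schedule.before_nonempty (S : I.Schedule) (j : Fin I.n) : (S.before j).Nonempty :=
  ⟨j, by simp [before]⟩

/-- The schedule in which every job starts as early as the order on its machine permits. -/
noncomputable def Schedule.leftShift (S : I.Schedule) : I.Schedule where
  start j := (S.before j).sup' (S.before_nonempty j) fun i => I.r i + #(S.between i j) * I.p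
  machine := S.machine

theorem Schedule.Valid.leftShift_le {S : I.Schedule} (h : S.Valid) (j : Fin I.n) :
    S.leftShift.start j ≤ S.start j := by
  refine sup'_le (S.before_nonempty j) _ fun i hi => ?_
  have h1 := h.start_add_between_le (i := i) (j := j) (mem_filter.1 hi).2.2
  have h2 := h.release i
  linarith

/-- The maximum is attained at some `r i + a p`, and `a < n` because `j` is not among the jobs
between `i` and itself. -/
theorem Schedule.leftShift_mem_T (S : I.Schedule) (j : Fin I.n) : S.leftShift.start j ∈ I.T := by
  obtain ⟨i, _, hi⟩ := exists_mem_eq_sup' (S.before_nonempty j)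
    fun i => I.r i + #(S.between i j) * I.p
  have hlt : #(S.between i j) < I.n := by
    have : #(S.between i j) < #(univ : Finset (Fin I.n)) := by
      refine card_lt_card ⟨subset_univ _, fun hh => ?_⟩
      exact lt_irrefl _ (Schedule.mem_between.1 (hh (mem_univ j))).2.2
    simpa using this
  exact mem_image.2 ⟨(i, ⟨_, hlt⟩), mem_univ _, hi.symm⟩

/-- Every lower bound `r q + a p` for the new start of `i` reappears for `j` with at least one more
job in between, namely `i`. -/
theorem Schedule.leftShift_add_le {S : I.Schedule} {i j : Fin I.n}
    (hm : S.machine i = S.machine j) (hlt : S.start i + I.p ≤ S.start j) :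
    S.leftShift.start i + I.p ≤ S.leftShift.start j := by
  have hp := I.p_pos
  rw [← le_sub_iff_add_le]
  refine sup'_le (S.before_nonempty i) _ fun q hq => ?_
  obtain ⟨-, hqm, hqi⟩ := mem_filter.1 hq
  have hmem : q ∈ S.before j := by
    simp only [Schedule.before, mem_filter, mem_univ, true_and]
    exact ⟨hqm.trans hm, by linarith⟩
  have h1 := le_sup' (fun i => I.r i + #(S.between i j) * I.p) hmem
  have h2 : #(S.between q i) + 1 ≤ #(S.between q j) := by
    have hni : i ∉ S.between q i := fun hh => lt_irrefl _ (Schedule.mem_between.1 hh).2.2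
    rw [← card_insert_of_notMem hni]
    refine card_le_card fun k hk => ?_
    rcases mem_insert.1 hk with rfl | hk
    · exact Schedule.mem_between.2 ⟨hm, hqi, by linarith⟩
    · obtain ⟨a1, a2, a3⟩ := Schedule.mem_between.1 hk
      exact Schedule.mem_between.2 ⟨a1.trans hm, a2, by linarith⟩
  have h3 : ((#(S.between q i) : ℝ) + 1) * I.p ≤ #(S.between q j) * I.p := by
    gcongr
    exact_mod_cast h2
  change _ ≤ S.leftShift.start j at h1
  linarith

theorem Schedule.Valid.leftShift {S : I.Schedule} (h : S.Valid) : S.leftShift.Valid where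
  release j := by
    have hmem : j ∈ S.before j := by simp [Schedule.before]
    have := le_sup' (fun i => I.r i + #(S.between i j) * I.p) hmem
    refine le_trans ?_ this
    have := I.p_pos
    simp only [le_add_iff_nonneg_right]
    positivity
  deadline j := by
    have h1 := h.leftShift_le j
    have h2 := h.deadline j
    linarith
  disjoint i j hij hm := (h.disjoint i j hij hm).imp (leftShift_add_le hm)
    (leftShift_add_le hm.symm)

/-- This is the relaxation bound. It also shows that an infeasible linear program excludes all
schedules. -/
theorem Schedule.Valid.exists_lpObjective_le {S : I.Schedule} (h : S.Valid) :
    ∃ y, I.LPFeasible y ∧ I.lpObjective y ≤ S.totalCompletion := by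
  obtain ⟨y, hy, he⟩ := h.leftShift.exists_lpFeasible S.leftShift_mem_T
  refine ⟨y, hy, he.trans_le (sum_le_sum fun j _ => ?_)⟩
  have := h.leftShift_le j
  linarith

/-! ### Earliest due date assignments -/

theorem LPFeasible.mono {y : WithBot ℝ → ℝ} (h : I.LPFeasible y) {u v : WithBot ℝ}
    (hu : u ∈ I.T') (hv : v ∈ I.T') (huv : u ≤ v) : y u ≤ y v := by
  rw [I.eq_sum_increments y hu, I.eq_sum_increments y hv]
  refine (add_le_add_iff_left _).2 (sum_le_sum_of_subset_of_nonneg (fun s hs => ?_)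
    fun s hs _ => h.increment_nonneg (mem_filter.1 hs).1)
  rw [mem_filter] at hs ⊢
  exact ⟨hs.1, hs.2.trans huv⟩

/-- There are enough released jobs for the slots. -/
theorem LPFeasible.le_card_released {y : WithBot ℝ → ℝ} (h : I.LPFeasible y) (hn : 0 < I.n)
    {t : ℝ} (ht : t ∈ I.T) : y t ≤ #{j : Fin I.n | I.r j ≤ t} := by
  have hmax := h.max_eq hn
  rcases ({j : Fin I.n | ¬ I.r j ≤ t} : Finset (Fin I.n)).eq_empty_or_nonempty with he | hne
  · have : #{j : Fin I.n | I.r j ≤ t} = I.n := by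
      rw [filter_true_of_mem fun j hj => by_contra fun hh => ?_, card_univ, Fintype.card_fin]
      exact notMem_empty j (he ▸ mem_filter.2 ⟨hj, hh⟩)
    rw [this, ← hmax]
    exact h.mono (I.coe_mem_T' ht) I.max_mem_T' (I.le_max_T ht)
  -- Let `i` be the first job released after `t`. The inclusion constraint of `i` and a last
  -- deadline reserves slots after `t` for all unreleased jobs, out of `n` slots altogether.
  · obtain ⟨i, hi, hmin⟩ := exists_min_image _ I.r hne
    obtain ⟨j, hj⟩ := exists_last_deadline hn
    have hti := lt_of_not_ge (mem_filter.1 hi).2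
    have hc : I.c i j = #{k : Fin I.n | ¬ I.r k ≤ t} := by
      rw [c]
      congr 1
      ext k
      simp only [mem_filter, mem_univ, true_and, hj, and_true, not_le]
      exact ⟨fun hk => hti.trans_le hk, fun hk => hmin k (by simpa using hk)⟩
    have hsum := card_filter_add_card_filter_not (s := (univ : Finset (Fin I.n)))
      fun k => I.r k ≤ t
    rw [← hc, card_univ, Fintype.card_fin] at hsum
    have h1 := h.incl i j (by rw [hc]; exact card_pos.2 hne)
    have h2 := h.mono (I.coe_mem_T' ht) (I.prec_mem_T' (I.r i)) ((I.coe_le_prec ht).2 hti)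
    have h3 : y (I.round (I.D j - I.p)) ≤ y I.T.max := by
      refine h.mono (I.round_mem_T' _) I.max_mem_T' ?_
      rw [round]
      exact max_mono (filter_subset _ _)
    have h4 : ((#{k : Fin I.n | I.r k ≤ t} : ℕ) : ℝ) + I.c i j = I.n := by exact_mod_cast hsum
    linarith

/-- An earliest due date assignment to the skeleton of a feasible solution is a valid schedule. -/
theorem Schedule.IsEDD.valid {S : I.Schedule} {y : WithBot ℝ → ℤ} (h : S.IsEDD y)
    (hy : I.LPFeasible fun t => (y t : ℝ)) :
    S.Valid ∧ S.totalCompletion = I.lpObjective fun t => (y t : ℝ) := by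
  obtain ⟨σ, π, hmono, hσ, hcnt, hk⟩ := h
  have hcnt' : ∀ t ∈ I.T, (#{k : Fin I.n | σ k = t} : ℝ) = y t - y (I.prec t) :=
    fun t ht => by exact_mod_cast hcnt t ht
  have hprec : ∀ x, (y (I.prec x) : ℝ) = #{k : Fin I.n | σ k < x} := fun x => by
    have := eq_card_of_increments (y := fun t => (y t : ℝ)) hσ hy.source hcnt' (I.prec_mem_T' x)
    simpa only [I.coe_le_prec (hσ _)] using this
  have hround : ∀ x, (y (I.round x) : ℝ) = #{k : Fin I.n | σ k ≤ x} := fun x => by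
    have := eq_card_of_increments (y := fun t => (y t : ℝ)) hσ hy.source hcnt' (I.round_mem_T' x)
    simpa only [I.coe_le_round (hσ _)] using this
  have hmach : ∀ k l : Fin I.n, k < l → S.machine (π k) = S.machine (π l) →
      σ k + I.p ≤ σ l := by
    intro k l hkl hm
    by_contra! hlt
    -- Two slots on the same machine are at least `m` numbers apart. If they overlapped, slots `k`
    -- to `l` would be more than `m` starts within `[σ k, σ k + p)`, against the load constraint.
    have hmod : (k : ℕ) % I.m = (l : ℕ) % I.m := by
      rw [← (hk k).2.2.2, ← (hk l).2.2.2, hm]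
    have hm' : I.m ≤ (l : ℕ) - k :=
      Nat.le_of_dvd (by omega) ((Nat.modEq_iff_dvd' (by omega)).1 hmod)
    have h1 := hy.load (σ k) (hσ k)
    rw [hprec, hprec, sub_le_iff_le_add, ← Nat.cast_add, Nat.cast_le] at h1
    have h2 : #(Icc k l ∪ ({q | σ q < σ k} : Finset (Fin I.n))) ≤ #{q | σ q < σ k + I.p} := by
      refine card_le_card fun q hq => ?_
      have hp := I.p_pos
      simp only [mem_union, mem_Icc, mem_filter, mem_univ, true_and] at hq ⊢
      rcases hq with hq | hq
      · exact (hmono hq.2).trans_lt hlt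
      · linarith
    rw [card_union_of_disjoint, Fin.card_Icc] at h2
    · omega
    · rw [disjoint_left]
      intro q hq hq'
      simp only [mem_Icc, mem_filter, mem_univ, true_and] at hq hq'
      exact (hmono hq.1).not_gt hq'
  have hdead : ∀ k, σ k + I.p ≤ I.D (π k) := by
    intro k
    by_contra! hlt
    -- `B` is the longest run of slots ending at the late slot `k` whose jobs are due no later than
    -- `π k`, and `b` is its slot with the earliest released job. The inclusion constraint asks for
    -- `#B` slots in `[r (π b), D (π k) - p]`, but only slots of `B` other than `k` can be there.
    let B : Finset (Fin I.n) := {q | q ≤ k ∧ ∀ q', q ≤ q' → q' ≤ k → I.D (π q') ≤ I.D (π k)}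
    have hkB : k ∈ B := by
      simp only [B, mem_filter, mem_univ, true_and]
      exact ⟨le_rfl, fun q' h1 h2 => (le_antisymm h2 h1 ▸ le_rfl)⟩
    obtain ⟨b, hb, hbmin⟩ := exists_min_image B (fun q => I.r (π q)) ⟨k, hkB⟩
    have hbB := (mem_filter.1 hb).2
    have hcB : #B ≤ I.c (π b) (π k) := by
      rw [← card_map π.toEmbedding]
      refine card_le_card fun q hq => ?_
      obtain ⟨q, hqB, rfl⟩ := mem_map.1 hq
      simp only [mem_filter, mem_univ, true_and]
      exact ⟨hbmin q hqB, (mem_filter.1 hqB).2.2 q le_rfl (mem_filter.1 hqB).2.1⟩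
    have hpos : 0 < #B := card_pos.2 ⟨k, hkB⟩
    have h1 := hy.incl (π b) (π k) (by omega)
    rw [hprec, hround, le_sub_iff_add_le, ← Nat.cast_add, Nat.cast_le] at h1
    have h2 : ({q | σ q ≤ I.D (π k) - I.p} : Finset (Fin I.n)) ⊆
        B.erase k ∪ ({q | σ q < I.r (π b)} : Finset (Fin I.n)) := by
      intro x hx
      simp only [mem_union, mem_filter, mem_univ, true_and, mem_erase] at hx ⊢
      rcases lt_or_ge (σ x) (I.r (π b)) with hxb | hxb
      · exact Or.inr hxb
      · have hxk : x < k := hmono.reflect_lt (by linarith)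
        refine Or.inl ⟨hxk.ne, ?_⟩
        by_contra hxB
        simp only [B, mem_filter, mem_univ, true_and, not_and, not_forall] at hxB
        obtain ⟨q, hxq, hqk, hD⟩ := hxB hxk.le
        -- Slot `q` holds a job due later than `π k`. Since `q` precedes `b`, the job `π b` was
        -- still free there, and it was already released, contradicting the earliest due date rule.
        have hqb : q < b := by
          by_contra! hbq
          exact hD (hbB.2 q hbq hqk)
        exact hD (((hk q).2.1 b hqb.le (hxb.trans (hmono hxq))).trans (hbB.2 b le_rfl hbB.1))
    have h3 := (card_le_card h2).trans (card_union_le _ _)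
    rw [card_erase_of_mem hkB] at h3
    omega
  have hstart : ∀ j, S.start j = σ (π.symm j) := fun j => by
    simpa using (hk (π.symm j)).2.2.1
  refine ⟨⟨fun j => ?_, fun j => ?_, fun i j hij hm => ?_⟩, ?_⟩
  · simpa [hstart] using (hk (π.symm j)).1
  · simpa [hstart] using hdead (π.symm j)
  · rw [hstart, hstart]
    rcases lt_or_gt_of_ne (π.symm.injective.ne hij) with h' | h'
    · exact Or.inl (hmach _ _ h' (by simpa using hm))
    · exact Or.inr (hmach _ _ h' (by simpa using hm.symm))
  · rw [lpObjective_eq_sum hσ hcnt', Schedule.totalCompletion, ← Equiv.sum_comp π]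
    exact sum_congr rfl fun k _ => by rw [(hk k).2.2.1]

theorem Schedule.IsEDD.optimal {S : I.Schedule} {y : WithBot ℝ → ℤ} (h : S.IsEDD y)
    (hy : I.LPOptimal fun t => (y t : ℝ)) : S.Optimal := by
  refine ⟨(h.valid hy.1).1, fun S' hS' => ?_⟩
  obtain ⟨y', hy', hle⟩ := hS'.exists_lpObjective_le
  exact (h.valid hy.1).2.trans_le ((hy.2 y' hy').trans hle)

end JobInstance

/-! ### Reasoning about programs -/

@[simp] theorem Store.iset_ivar (s : Store) (x : ℕ) (v : ℤ) (y : ℕ) :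
    (s.iset x v).ivar y = if y = x then v else s.ivar y := by
  simp [Store.iset, Function.update_apply]

@[simp] theorem Store.iset_iarr (s : Store) (x : ℕ) (v : ℤ) : (s.iset x v).iarr = s.iarr := rfl
@[simp] theorem Store.iset_tvar (s : Store) (x : ℕ) (v : ℤ) : (s.iset x v).tvar = s.tvar := rfl
@[simp] theorem Store.iset_tarr (s : Store) (x : ℕ) (v : ℤ) : (s.iset x v).tarr = s.tarr := rfl

@[simp] theorem Store.iput_iarr (s : Store) (a : ℕ) (i v : ℤ) (b : ℕ) :
    (s.iput a i v).iarr b = if b = a then Function.update (s.iarr a) i v else s.iarr b := by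
  simp [Store.iput, Function.update_apply]

@[simp] theorem Store.iput_ivar (s : Store) (a : ℕ) (i v : ℤ) : (s.iput a i v).ivar = s.ivar := rfl
@[simp] theorem Store.iput_tvar (s : Store) (a : ℕ) (i v : ℤ) : (s.iput a i v).tvar = s.tvar := rfl
@[simp] theorem Store.iput_tarr (s : Store) (a : ℕ) (i v : ℤ) : (s.iput a i v).tarr = s.tarr := rfl

@[simp] theorem Store.tset_tvar (s : Store) (x : ℕ) (v : ℝ) (y : ℕ) :
    (s.tset x v).tvar y = if y = x then v else s.tvar y := by
  simp [Store.tset, Function.update_apply]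

@[simp] theorem Store.tset_iarr (s : Store) (x : ℕ) (v : ℝ) : (s.tset x v).iarr = s.iarr := rfl
@[simp] theorem Store.tset_ivar (s : Store) (x : ℕ) (v : ℝ) : (s.tset x v).ivar = s.ivar := rfl
@[simp] theorem Store.tset_tarr (s : Store) (x : ℕ) (v : ℝ) : (s.tset x v).tarr = s.tarr := rfl

@[simp] theorem Store.tput_tarr (s : Store) (a : ℕ) (i : ℤ) (v : ℝ) (b : ℕ) :
    (s.tput a i v).tarr b = if b = a then Function.update (s.tarr a) i v else s.tarr b := by
  simp [Store.tput, Function.update_apply]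

@[simp] theorem Store.tput_iarr (s : Store) (a : ℕ) (i : ℤ) (v : ℝ) :
    (s.tput a i v).iarr = s.iarr := rfl
@[simp] theorem Store.tput_ivar (s : Store) (a : ℕ) (i : ℤ) (v : ℝ) :
    (s.tput a i v).ivar = s.ivar := rfl
@[simp] theorem Store.tput_tvar (s : Store) (a : ℕ) (i : ℤ) (v : ℝ) :
    (s.tput a i v).tvar = s.tvar := rfl

attribute [simp] IExp.eval TExp.eval Test.Holds

namespace Program

/-- Does the program assign the integer register `x`? -/
def setsI (x : ℕ) : Program → Bool
  | nop => false
  | iset y _ => y == x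
  | iput _ _ _ => false
  | tset _ _ => false
  | tput _ _ _ => false
  | seq P Q => P.setsI x || Q.setsI x
  | branch _ P Q => P.setsI x || Q.setsI x
  | loop _ P => P.setsI x

/-- Does the program write to the integer array `a`? -/
def putsI (a : ℕ) : Program → Bool
  | nop => false
  | iset _ _ => false
  | iput b _ _ => b == a
  | tset _ _ => false
  | tput _ _ _ => false
  | seq P Q => P.putsI a || Q.putsI a
  | branch _ P Q => P.putsI a || Q.putsI a
  | loop _ P => P.putsI a

/-- Does the program assign the time register `x`? -/
def setsT (x : ℕ) : Program → Bool
  | nop => false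
  | iset _ _ => false
  | iput _ _ _ => false
  | tset y _ => y == x
  | tput _ _ _ => false
  | seq P Q => P.setsT x || Q.setsT x
  | branch _ P Q => P.setsT x || Q.setsT x
  | loop _ P => P.setsT x

/-- Does the program write to the time array `a`? -/
def putsT (a : ℕ) : Program → Bool
  | nop => false
  | iset _ _ => false
  | iput _ _ _ => false
  | tset _ _ => false
  | tput b _ _ => b == a
  | seq P Q => P.putsT a || Q.putsT a
  | branch _ P Q => P.putsT a || Q.putsT a
  | loop _ P => P.putsT a

/-- `s` and `s'` agree outside of what `P` writes. -/
structure Frame (P : Program) (s s' : Store) : Prop where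
  ivar : ∀ x, P.setsI x = false → s'.ivar x = s.ivar x
  iarr : ∀ a, P.putsI a = false → s'.iarr a = s.iarr a
  tvar : ∀ x, P.setsT x = false → s'.tvar x = s.tvar x
  tarr : ∀ a, P.putsT a = false → s'.tarr a = s.tarr a

theorem Frame.refl (P : Program) (s : Store) : P.Frame s s :=
  ⟨fun _ _ => rfl, fun _ _ => rfl, fun _ _ => rfl, fun _ _ => rfl⟩

theorem Frame.trans {P : Program} {s s' s'' : Store} (h : P.Frame s s') (h' : P.Frame s' s'') :
    P.Frame s s'' :=
  ⟨fun x hx => (h'.ivar x hx).trans (h.ivar x hx), fun x hx => (h'.iarr x hx).trans (h.iarr x hx),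
    fun x hx => (h'.tvar x hx).trans (h.tvar x hx), fun x hx => (h'.tarr x hx).trans (h.tarr x hx)⟩

end Program

/-- The frame is read off the program text, so that specifications need to mention only what a
program changes. The auxiliary `left` and `right` enlarge the write set of a part to that of the
whole. -/
theorem Exec.frame {P : Program} {s s' : Store} {k : ℕ} (h : Exec P s s' k) : P.Frame s s' := by
  have left : ∀ {P Q R : Program} {s s' : Store}, P.Frame s s' →
      (∀ x, R.setsI x = (P.setsI x || Q.setsI x)) → (∀ x, R.putsI x = (P.putsI x || Q.putsI x)) →
      (∀ x, R.setsT x = (P.setsT x || Q.setsT x)) → (∀ x, R.putsT x = (P.putsT x || Q.putsT x)) →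
      R.Frame s s' := by
    intro P Q R s s' h h1 h2 h3 h4
    refine ⟨fun x hx => h.ivar x ?_, fun x hx => h.iarr x ?_, fun x hx => h.tvar x ?_,
      fun x hx => h.tarr x ?_⟩ <;> simp_all
  have right : ∀ {P Q R : Program} {s s' : Store}, Q.Frame s s' →
      (∀ x, R.setsI x = (P.setsI x || Q.setsI x)) → (∀ x, R.putsI x = (P.putsI x || Q.putsI x)) →
      (∀ x, R.setsT x = (P.setsT x || Q.setsT x)) → (∀ x, R.putsT x = (P.putsT x || Q.putsT x)) →
      R.Frame s s' := by
    intro P Q R s s' h h1 h2 h3 h4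
    refine ⟨fun x hx => h.ivar x ?_, fun x hx => h.iarr x ?_, fun x hx => h.tvar x ?_,
      fun x hx => h.tarr x ?_⟩ <;> simp_all
  induction h with
  | nop s => exact .refl _ _
  | iset s x e =>
    refine ⟨fun y hy => ?_, fun _ _ => rfl, fun _ _ => rfl, fun _ _ => rfl⟩
    simp only [Program.setsI, beq_eq_false_iff_ne, ne_eq] at hy
    simp [Ne.symm hy]
  | iput s a i e =>
    refine ⟨fun _ _ => rfl, fun y hy => ?_, fun _ _ => rfl, fun _ _ => rfl⟩
    simp only [Program.putsI, beq_eq_false_iff_ne, ne_eq] at hy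
    simp [Ne.symm hy]
  | tset s x e =>
    refine ⟨fun _ _ => rfl, fun _ _ => rfl, fun y hy => ?_, fun _ _ => rfl⟩
    simp only [Program.setsT, beq_eq_false_iff_ne, ne_eq] at hy
    simp [Ne.symm hy]
  | tput s a i e =>
    refine ⟨fun _ _ => rfl, fun _ _ => rfl, fun _ _ => rfl, fun y hy => ?_⟩
    simp only [Program.putsT, beq_eq_false_iff_ne, ne_eq] at hy
    simp [Ne.symm hy]
  | seq _ _ ih₁ ih₂ =>
    exact (left ih₁ (fun _ => rfl) (fun _ => rfl) (fun _ => rfl) fun _ => rfl).trans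
      (right ih₂ (fun _ => rfl) (fun _ => rfl) (fun _ => rfl) fun _ => rfl)
  | branch_true _ _ ih => exact left ih (fun _ => rfl) (fun _ => rfl) (fun _ => rfl) fun _ => rfl
  | branch_false _ _ ih => exact right ih (fun _ => rfl) (fun _ => rfl) (fun _ => rfl) fun _ => rfl
  | loop_done _ => exact .refl _ _
  | loop_step _ _ _ ih₁ ih₂ => exact Program.Frame.trans ⟨ih₁.1, ih₁.2, ih₁.3, ih₁.4⟩ ih₂

/-- Started on `s`, the program halts within `K` steps in a state that satisfies `Q` and agrees
with `s` outside of what the program writes. -/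
def Runs (P : Program) (s : Store) (K : ℕ) (Q : Store → Prop) : Prop :=
  ∃ s' k, Exec P s s' k ∧ k ≤ K ∧ P.Frame s s' ∧ Q s'

theorem Exec.runs {P : Program} {s s' : Store} {k K : ℕ} {Q : Store → Prop} (h : Exec P s s' k)
    (hk : k ≤ K) (hQ : Q s') : Runs P s K Q :=
  ⟨s', k, h, hk, h.frame, hQ⟩

namespace Program

open Classical in
/-- The result of a program without loops. -/
noncomputable def result : Program → Store → Store
  | nop, s => s
  | iset x e, s => s.iset x (e.eval s)
  | iput a i e, s => s.iput a (i.eval s) (e.eval s)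
  | tset x e, s => s.tset x (e.eval s)
  | tput a i e, s => s.tput a (i.eval s) (e.eval s)
  | seq P Q, s => Q.result (P.result s)
  | branch b P Q, s => if b.Holds s then P.result s else Q.result s
  | loop _ _, s => s

/-- A program without loops. -/
def loopFree : Program → Bool
  | seq P Q => P.loopFree && Q.loopFree
  | branch _ P Q => P.loopFree && Q.loopFree
  | loop _ _ => false
  | _ => true

/-- An upper bound for the running time of a program without loops. -/
def time : Program → ℕ
  | nop => 1
  | iset _ e => e.cost + 1
  | iput _ i e => i.cost + e.cost + 1
  | tset _ e => e.cost + 1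
  | tput _ i e => i.cost + e.cost + 1
  | seq P Q => P.time + Q.time
  | branch b P Q => b.cost + P.time + Q.time
  | loop _ _ => 0

theorem exists_exec_result (P : Program) (hP : P.loopFree = true) (s : Store) :
    ∃ k ≤ P.time, Exec P s (P.result s) k := by
  induction P generalizing s with
  | nop => exact ⟨_, le_rfl, .nop s⟩
  | iset x e => exact ⟨_, le_rfl, .iset s x e⟩
  | iput a i e => exact ⟨_, le_rfl, .iput s a i e⟩
  | tset x e => exact ⟨_, le_rfl, .tset s x e⟩
  | tput a i e => exact ⟨_, le_rfl, .tput s a i e⟩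
  | seq P Q ihP ihQ =>
    simp only [loopFree, Bool.and_eq_true] at hP
    obtain ⟨k₁, h₁, e₁⟩ := ihP hP.1 s
    obtain ⟨k₂, h₂, e₂⟩ := ihQ hP.2 (P.result s)
    exact ⟨_, Nat.add_le_add h₁ h₂, .seq e₁ e₂⟩
  | branch b P Q ihP ihQ =>
    simp only [loopFree, Bool.and_eq_true] at hP
    by_cases hb : b.Holds s
    · obtain ⟨k, h, e⟩ := ihP hP.1 s
      exact ⟨b.cost + k, by simp only [time]; omega,
        by simpa [result, hb] using Exec.branch_true hb e⟩
    · obtain ⟨k, h, e⟩ := ihQ hP.2 s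
      exact ⟨b.cost + k, by simp only [time]; omega,
        by simpa [result, hb] using Exec.branch_false hb e⟩
  | loop b P => simp [loopFree] at hP

theorem runs_result (P : Program) (hP : P.loopFree = true) (s : Store) {K : ℕ} {Q : Store → Prop}
    (hK : P.time ≤ K) (hQ : Q (P.result s)) : Runs P s K Q := by
  obtain ⟨k, hk, h⟩ := P.exists_exec_result hP s
  exact h.runs (hk.trans hK) hQ

/-- Run `P` for the values `0, 1, …` of the register `x` that are smaller than register `b`. -/
def each (x b : ℕ) (P : Program) : Program :=
  seq (iset x (.lit 0))
    (loop (.neg (.ile (.var b) (.var x))) (seq P (iset x (.add (.var x) (.lit 1)))))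

end Program

/-- Each pass adds `4` steps for the test and `4` for the increment to the body; the initialization
and the last test cost `6`. The invariant must tolerate writes to `x`, since the counter changes
between passes. -/
theorem Runs.each {x b : ℕ} {P : Program} {K N : ℕ} {s₀ : Store} (Inv : ℕ → Store → Prop)
    (hb : s₀.ivar b = N) (hx : P.setsI x = false) (hPb : P.setsI b = false) (hxb : x ≠ b)
    (h0 : Inv 0 s₀)
    (hinv : ∀ (i : ℕ) (s : Store) (v : ℤ), Inv i s → Inv i (s.iset x v))
    (hstep : ∀ (i : ℕ) (s : Store), i < N → s.ivar x = i →
      (Program.each x b P).Frame s₀ s → Inv i s →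
      Runs P s K (Inv (i + 1))) :
    Runs (Program.each x b P) s₀ (N * (K + 8) + 6) (Inv N) := by
  have hbx : (Program.each x b P).setsI b = false := by
    simp [Program.each, Program.setsI, hPb, hxb]
  have key : ∀ (d i : ℕ) (s : Store), i + d = N → s.ivar x = i →
      (Program.each x b P).Frame s₀ s → Inv i s →
      ∃ s' k, Exec (.loop (.neg (.ile (.var b) (.var x)))
        (.seq P (.iset x (.add (.var x) (.lit 1))))) s s' k ∧ k ≤ d * (K + 8) + 4 ∧ Inv N s' := by
    intro d
    induction d with
    | zero =>
      intro i s hi hs hf hI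
      refine ⟨s, _, .loop_done ?_, ?_, ?_⟩
      · simp only [Test.Holds, IExp.eval, not_not, hs, hf.ivar b hbx, hb]
        omega
      · simp [Test.cost, IExp.cost]
      · rwa [← hi]
    | succ d ih =>
      intro i s hi hs hf hI
      obtain ⟨s₁, k₁, e₁, hk₁, hf₁, hI₁⟩ := hstep i s (by omega) hs hf hI
      have hx₁ : s₁.ivar x = i := (hf₁.ivar x hx).trans hs
      have e₂ := Exec.seq e₁ (Exec.iset s₁ x (.add (.var x) (.lit 1)))
      have hf₂ : (Program.each x b P).Frame s (s₁.iset x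
          (IExp.eval s₁ (.add (.var x) (.lit 1)))) := by
        have := e₂.frame
        refine ⟨fun y hy => this.ivar y ?_, fun y hy => this.iarr y ?_, fun y hy => this.tvar y ?_,
          fun y hy => this.tarr y ?_⟩ <;>
        simp_all [Program.each, Program.setsI, Program.putsI, Program.setsT, Program.putsT]
      obtain ⟨s₃, k₃, e₃, hk₃, hI₃⟩ := ih (i + 1) _ (by omega) (by simp [hx₁]) (hf.trans hf₂)
        (hinv _ _ _ hI₁)
      refine ⟨s₃, _, .loop_step ?_ e₂ e₃, ?_, hI₃⟩
      · simp only [Test.Holds, IExp.eval, hs, hf.ivar b hbx, hb]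
        omega
      · simp only [Test.cost, IExp.cost]
        linarith
  have e₀ := Exec.iset s₀ x (.lit 0)
  have hf₀ : (Program.each x b P).Frame s₀ (s₀.iset x (IExp.eval s₀ (.lit 0))) := by
    have := e₀.frame
    refine ⟨fun y hy => this.ivar y ?_, fun y hy => this.iarr y ?_, fun y hy => this.tvar y ?_,
      fun y hy => this.tarr y ?_⟩ <;>
    simp_all [Program.each, Program.setsI, Program.putsI, Program.setsT, Program.putsT]
  obtain ⟨s', k, e, hk, hI⟩ := key N 0 _ (by omega) (by simp) hf₀ (hinv _ _ _ h0)
  refine (Exec.seq e₀ e).runs ?_ hI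
  simp only [IExp.cost]
  omega

theorem Runs.mono {P : Program} {s : Store} {K K' : ℕ} {Q Q' : Store → Prop} (h : Runs P s K Q)
    (hK : K ≤ K') (hQ : ∀ s', P.Frame s s' → Q s' → Q' s') : Runs P s K' Q' := by
  obtain ⟨s', k, e, hk, hf, hq⟩ := h
  exact ⟨s', k, e, hk.trans hK, hf, hQ s' hf hq⟩

theorem Runs.seq {P P' : Program} {s : Store} {K₁ K₂ : ℕ} {R Q : Store → Prop}
    (h : Runs P s K₁ R) (h' : ∀ s', P.Frame s s' → R s' → Runs P' s' K₂ Q) :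
    Runs (.seq P P') s (K₁ + K₂) Q := by
  obtain ⟨s₁, k₁, e₁, hk₁, hf₁, hq₁⟩ := h
  obtain ⟨s₂, k₂, e₂, hk₂, hf₂, hq₂⟩ := h' s₁ hf₁ hq₁
  exact (Exec.seq e₁ e₂).runs (Nat.add_le_add hk₁ hk₂) hq₂

/-- Run a loop-free program first. -/
theorem Runs.seq_result {P P' : Program} (hP : P.loopFree = true) {s : Store} {K : ℕ}
    {Q : Store → Prop} (h' : P.Frame s (P.result s) → Runs P' (P.result s) K Q) :
    Runs (.seq P P') s (P.time + K) Q := by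
  obtain ⟨k, hk, e⟩ := P.exists_exec_result hP s
  obtain ⟨s₂, k₂, e₂, hk₂, hf₂, hq₂⟩ := h' e.frame
  exact (Exec.seq e e₂).runs (Nat.add_le_add hk hk₂) hq₂

theorem Runs.branch {b : Test} {P P' : Program} {s : Store} {K : ℕ} {Q : Store → Prop}
    (h : b.Holds s → Runs P s K Q) (h' : ¬ b.Holds s → Runs P' s K Q) :
    Runs (.branch b P P') s (b.cost + K) Q := by
  by_cases hb : b.Holds s
  · obtain ⟨s', k, e, hk, _, hq⟩ := h hb
    exact (Exec.branch_true hb e).runs (Nat.add_le_add_left hk _) hq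
  · obtain ⟨s', k, e, hk, _, hq⟩ := h' hb
    exact (Exec.branch_false hb e).runs (Nat.add_le_add_left hk _) hq

namespace Program

/-- Count in the register `acc` for how many values of `x` the test `t` holds. -/
def count (acc x b : ℕ) (t : Test) : Program :=
  seq (iset acc (.lit 0)) (Program.each x b (branch t (iset acc (.add (.var acc) (.lit 1))) nop))

end Program

theorem Runs.count {acc x b N : ℕ} {t : Test} {s₀ : Store} (pr : ℕ → Prop) [DecidablePred pr]
    (hb : s₀.ivar b = N) (hax : acc ≠ x) (hab : acc ≠ b) (hxb : x ≠ b)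
    (ht : ∀ (i : ℕ) (s : Store), i < N → s.ivar x = i → (Program.count acc x b t).Frame s₀ s →
      (t.Holds s ↔ pr i)) :
    Runs (Program.count acc x b t) s₀ (N * (t.cost + 13) + 8)
      fun s => s.ivar acc = #{i ∈ range N | pr i} := by
  have h := Runs.each (x := x) (b := b) (K := t.cost + 5) (N := N)
    (P := .branch t (.iset acc (.add (.var acc) (.lit 1))) .nop) (s₀ := s₀.iset acc 0)
    (fun k s => s.ivar acc = #{i ∈ range k | pr i}) (by simp [hab.symm, hb])
    (by simp [Program.setsI, hax]) (by simp [Program.setsI, hab]) hxb (by simp)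
    (by intro i s v h; simpa [hax] using h) ?_
  · have e := Exec.iset s₀ acc (.lit 0)
    obtain ⟨s', k, e', hk, hf, hq⟩ := h
    refine (Exec.seq e e').runs ?_ hq
    simp only [IExp.cost]
    linarith
  · intro i s hi hs hf hI
    have hf' : (Program.count acc x b t).Frame s₀ s := by
      have f0 : (Program.iset acc (.lit 0)).Frame s₀ (s₀.iset acc 0) :=
        (Exec.iset s₀ acc (.lit 0)).frame
      refine ⟨fun y hy => ?_, fun y hy => ?_, fun y hy => ?_, fun y hy => ?_⟩
      · rw [hf.ivar y, f0.ivar y] <;>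
        simp_all [Program.each, Program.count, Program.setsI]
      · exact hf.iarr y (by simp_all [Program.each, Program.count, Program.putsI])
      · exact hf.tvar y (by simp_all [Program.each, Program.count, Program.setsT])
      · exact hf.tarr y (by simp_all [Program.each, Program.count, Program.putsT])
    refine Runs.mono (Runs.branch (K := 5)
      (Q := fun s => s.ivar acc = #{i ∈ range (i + 1) | pr i}) (fun h => ?_) fun h => ?_)
      le_rfl fun _ _ h => h
    · refine Program.runs_result _ rfl _ (by simp [Program.time, IExp.cost]) ?_
      rw [ht i s hi hs hf'] at h
      simp [Program.result, range_add_one, filter_insert, h, hI]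
    · refine Program.runs_result _ rfl _ (by simp [Program.time]) ?_
      rw [ht i s hi hs hf'] at h
      simp [Program.result, range_add_one, filter_insert, h, hI]

/-! ### Computing the numbers `c i j` -/

@[simp] theorem toArray_coe {n : ℕ} (v : Fin n → ℝ) (k : Fin n) :
    toArray v ((k : ℕ) : ℤ) = v k := by
  simp [toArray]

theorem toArray_of_lt {n : ℕ} (v : Fin n → ℝ) {k : ℕ} (h : k < n) : toArray v k = v ⟨k, h⟩ :=
  toArray_coe v ⟨k, h⟩

theorem card_filter_range {n : ℕ} (p : ℕ → Prop) [DecidablePred p] :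
    #{i ∈ range n | p i} = #{k : Fin n | p k} := by
  rw [← card_map Fin.valEmbedding]
  congr 1
  ext i
  simp only [mem_filter, mem_range, mem_map, mem_univ, true_and, Fin.valEmbedding_apply]
  constructor
  · rintro ⟨h, hp⟩
    exact ⟨⟨i, h⟩, hp, rfl⟩
  · rintro ⟨k, hp, rfl⟩
    exact ⟨k.2, hp⟩

theorem card_filter_lt_succ {n K : ℕ} (hK : K < n) (p : Fin n → Prop) [DecidablePred p] :
    #{k : Fin n | (k : ℕ) < K + 1 ∧ p k} =
      #{k : Fin n | (k : ℕ) < K ∧ p k} + if p ⟨K, hK⟩ then 1 else 0 := by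
  split_ifs with h
  · rw [← card_insert_of_notMem (a := (⟨K, hK⟩ : Fin n)) (by simp)]
    congr 1
    ext k
    simp only [mem_filter, mem_univ, true_and, mem_insert, Fin.ext_iff]
    constructor
    · rintro ⟨h1, h2⟩
      by_cases h3 : (k : ℕ) = K
      · exact Or.inl h3
      · exact Or.inr ⟨by omega, h2⟩
    · rintro (h1 | ⟨h1, h2⟩)
      · exact ⟨by omega, by rwa [show k = ⟨K, hK⟩ from Fin.ext h1]⟩
      · exact ⟨by omega, h2⟩
  · rw [add_zero]
    congr 1
    ext k
    simp only [mem_filter, mem_univ, true_and]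
    constructor
    · rintro ⟨h1, h2⟩
      by_cases h3 : (k : ℕ) = K
      · exact absurd (by rwa [show k = ⟨K, hK⟩ from Fin.ext h3] at h2) h
      · exact ⟨by omega, h2⟩
    · rintro ⟨h1, h2⟩
      exact ⟨by omega, h2⟩

theorem add_mul_inj {n i j i' j' : ℕ} (hj : j < n) (hj' : j' < n)
    (h : i * n + j = i' * n + j') : i = i' ∧ j = j' := by
  have h1 := congrArg (· / n) h
  have h2 := congrArg (· % n) h
  have hn : 0 < n := by omega
  simp only [mul_comm _ n, Nat.mul_add_div hn, Nat.div_eq_of_lt hj, Nat.div_eq_of_lt hj',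
    Nat.mul_add_mod, Nat.mod_eq_of_lt hj, Nat.mod_eq_of_lt hj'] at h1 h2
  omega

namespace JobInstance

variable (I : JobInstance)

/-- The instance is in memory. -/
structure Loaded (s : Store) : Prop where
  n : s.ivar 0 = I.n
  m : s.ivar 1 = I.m
  p : s.tvar 0 = I.p
  r : s.tarr 0 = toArray I.r
  D : s.tarr 1 = toArray I.D

theorem loaded_input : I.Loaded I.input := ⟨rfl, rfl, rfl, rfl, rfl⟩

variable {I}

/-- The write sets are Boolean functions of the program, so for concrete programs the default
arguments discharge the side conditions by evaluation. -/
theorem Loaded.frame {s s' : Store} (h : I.Loaded s) {P : Program} (f : P.Frame s s')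
    (h₁ : P.setsI 0 = false := by rfl) (h₂ : P.setsI 1 = false := by rfl)
    (h₃ : P.setsT 0 = false := by rfl) (h₄ : P.putsT 0 = false := by rfl)
    (h₅ : P.putsT 1 = false := by rfl) : I.Loaded s' :=
  ⟨(f.ivar 0 h₁).trans h.n, (f.ivar 1 h₂).trans h.m, (f.tvar 0 h₃).trans h.p,
    (f.tarr 0 h₄).trans h.r, (f.tarr 1 h₅).trans h.D⟩

variable (I)

/-- The number of deadlines up to that of `j`, minus one. -/
noncomputable def rank (j : Fin I.n) : ℕ := #{k : Fin I.n | I.D k ≤ I.D j} - 1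

theorem card_deadlines_pos (j : Fin I.n) : 0 < #{k : Fin I.n | I.D k ≤ I.D j} :=
  card_pos.2 ⟨j, by simp⟩

theorem rank_lt (j : Fin I.n) : I.rank j < I.n := by
  have h1 := I.card_deadlines_pos j
  have h2 : #{k : Fin I.n | I.D k ≤ I.D j} ≤ I.n := (card_le_univ _).trans (by simp)
  rw [rank]
  omega

/-- Ranks replace deadlines by integers below `n`, with ties preserved, so they can serve as bucket
indices. -/
theorem rank_le_rank {k j : Fin I.n} : I.rank k ≤ I.rank j ↔ I.D k ≤ I.D j := by
  have h1 := I.card_deadlines_pos j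
  have h2 := I.card_deadlines_pos k
  constructor
  · intro h
    by_contra! hlt
    have : #{q : Fin I.n | I.D q ≤ I.D j} < #{q : Fin I.n | I.D q ≤ I.D k} := by
      refine card_lt_card ⟨fun q hq => ?_, fun hh => ?_⟩
      · simp only [mem_filter, mem_univ, true_and] at hq ⊢
        exact hq.trans hlt.le
      · have := hh (mem_filter.2 ⟨mem_univ k, le_rfl⟩)
        simp only [mem_filter, mem_univ, true_and] at this
        exact this.not_gt hlt
    simp only [rank] at h
    omega
  · intro h
    have : #{q : Fin I.n | I.D q ≤ I.D k} ≤ #{q : Fin I.n | I.D q ≤ I.D j} := by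
      refine card_le_card fun q hq => ?_
      simp only [mem_filter, mem_univ, true_and] at hq ⊢
      exact hq.trans h
    simp only [rank]
    omega

end JobInstance

namespace Program

/-- Store the ranks of the deadlines in the integer array `3`. -/
def ranks : Program :=
  each 4 0 (seq (count 6 5 0 (.tle (.arr 1 (.var 5)) (.arr 1 (.var 4))))
    (iput 3 (.var 4) (.sub (.var 6) (.lit 1))))

/-- Clear the buckets. -/
def clear : Program := each 5 0 (iput 4 (.var 5) (.lit 0))

/-- Count the jobs released from `r i` on by the rank of their deadlines. -/
def fill : Program :=
  each 5 0 (branch (.tle (.arr 0 (.var 4)) (.arr 0 (.var 5)))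
    (iput 4 (.arr 3 (.var 5)) (.add (.arr 4 (.arr 3 (.var 5))) (.lit 1))) nop)

/-- Form the prefix sums of the buckets. -/
def accumulate : Program :=
  each 5 0 (seq (iset 6 (.add (.var 6) (.arr 4 (.var 5)))) (iput 4 (.var 5) (.var 6)))

/-- Write a row of the matrix `c`. -/
def writeRow : Program := each 5 0 (iput 0 (.add (.var 7) (.var 5)) (.arr 4 (.arr 3 (.var 5))))

/-- Compute the matrix `c`. -/
def matrix : Program :=
  seq ranks (each 4 0 (seq clear (seq fill (seq (iset 6 (.lit 0)) (seq accumulate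
    (seq writeRow (iset 7 (.add (.var 7) (.var 0)))))))))

end Program

namespace JobInstance

variable {I : JobInstance}

theorem runs_ranks {s₀ : Store} (hL : I.Loaded s₀) :
    Runs .ranks s₀ (I.n * (I.n * 19 + 22) + 6) fun s =>
      ∀ j : Fin I.n, s.iarr 3 (j : ℕ) = I.rank j := by
  refine (Runs.each (K := I.n * 19 + 14) (N := I.n)
    (fun k s => ∀ j : Fin I.n, (j : ℕ) < k → s.iarr 3 (j : ℕ) = I.rank j) hL.n rfl rfl (by decide)
    (by simp) (by simp) fun i s hi hs f hI => ?_).mono le_rfl fun s _ h j => h j j.2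
  refine (Runs.seq (Runs.count (N := I.n) (fun k => toArray I.D k ≤ I.D ⟨i, hi⟩) (hL.frame f).n
    (by decide) (by decide) (by decide) fun k s' hk hs' f' => ?_) fun s₁ f₁ h₁ =>
    Program.runs_result (K := 6) _ rfl s₁ (by decide) ?_).mono
    (by simp only [Test.cost, TExp.cost, IExp.cost]; linarith) fun s _ h => h
  · simp only [Test.Holds, TExp.eval, IExp.eval, hs', ((hL.frame f).frame f').D]
    rw [f'.ivar 4 rfl, hs, toArray_of_lt I.D hi]
  · intro j hj
    have h4 : s₁.ivar 4 = i := (f₁.ivar 4 rfl).trans hs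
    have h3 : s₁.iarr 3 = s.iarr 3 := f₁.iarr 3 rfl
    simp only [Program.result, Store.iput_iarr, if_true, IExp.eval, h4, h₁, h3]
    rw [card_filter_range]
    by_cases hji : (j : ℕ) = i
    · have : j = ⟨i, hi⟩ := Fin.ext hji
      subst this
      have := I.card_deadlines_pos ⟨i, hi⟩
      simp only [Function.update_self, toArray_coe, rank]
      omega
    · rw [Function.update_of_ne (by exact_mod_cast hji)]
      exact hI j (by omega)

theorem runs_clear {s₀ : Store} (hL : I.Loaded s₀) :
    Runs .clear s₀ (I.n * 11 + 6) fun s => ∀ z < I.n, s.iarr 4 (z : ℕ) = 0 := by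
  refine (Runs.each (K := 3) (N := I.n)
    (fun k s => ∀ z < k, s.iarr 4 (z : ℕ) = 0) hL.n rfl rfl (by decide)
    (by simp) (by simp) fun i s hi hs f hI => ?_).mono le_rfl fun s _ h => h
  refine Program.runs_result _ rfl s (by decide) fun z hz => ?_
  simp only [Program.result, Store.iput_iarr, if_true, IExp.eval, hs]
  by_cases hzi : z = i
  · simp [hzi]
  · rw [Function.update_of_ne (by exact_mod_cast hzi)]
    exact hI z (by omega)

theorem runs_fill {s₀ : Store} (hL : I.Loaded s₀)
    (h3 : ∀ j : Fin I.n, s₀.iarr 3 (j : ℕ) = I.rank j) {i : Fin I.n} (h4 : s₀.ivar 4 = (i : ℕ))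
    (h0 : ∀ z < I.n, s₀.iarr 4 (z : ℕ) = 0) :
    Runs .fill s₀ (I.n * 22 + 6) fun s => ∀ z < I.n,
      s.iarr 4 (z : ℕ) = #{k : Fin I.n | I.r i ≤ I.r k ∧ I.rank k = z} := by
  refine (Runs.each (K := 14) (N := I.n)
    (fun K s => ∀ z < I.n,
      s.iarr 4 (z : ℕ) = #{k : Fin I.n | (k : ℕ) < K ∧ I.r i ≤ I.r k ∧ I.rank k = z})
    hL.n rfl rfl (by decide)
    (by simpa using h0) (by simp) fun K s hK hs f hI => ?_).mono (by linarith)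
    fun s _ h => by simpa using h
  refine Program.runs_result _ rfl s (by decide) fun z hz => ?_
  have e3 : s.iarr 3 = s₀.iarr 3 := f.iarr 3 rfl
  have e4 : s.ivar 4 = (i : ℕ) := (f.ivar 4 rfl).trans h4
  have hr : s.iarr 3 (K : ℕ) = I.rank ⟨K, hK⟩ := e3 ▸ h3 ⟨K, hK⟩
  have hb : Test.Holds s (.tle (.arr 0 (.var 4)) (.arr 0 (.var 5))) ↔ I.r i ≤ I.r ⟨K, hK⟩ := by
    simp only [Test.Holds, TExp.eval, IExp.eval, hs, e4, (hL.frame f).r, toArray_coe,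
      toArray_of_lt I.r hK]
  simp only [Program.result, hb]
  rw [card_filter_lt_succ hK]
  have hz' := hI z hz
  by_cases h : I.r i ≤ I.r ⟨K, hK⟩
  · simp only [h, if_true, true_and, Store.iput_iarr, IExp.eval, hs, hr]
    by_cases hzr : I.rank ⟨K, hK⟩ = z
    · simp [hzr, hz']
    · rw [Function.update_of_ne (by exact_mod_cast Ne.symm hzr)]
      simp [hzr, hz']
  · simp [h, hz']

/-- The prefix sums are formed in place: the entries before the loop index are already sums, the
others are still bucket sizes, and register `6` carries the running total. -/
theorem runs_accumulate {s₀ : Store} (hL : I.Loaded s₀) (p : Fin I.n → Prop) [DecidablePred p]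
    (h6 : s₀.ivar 6 = 0)
    (h4 : ∀ z < I.n, s₀.iarr 4 (z : ℕ) = #{k : Fin I.n | p k ∧ I.rank k = z}) :
    Runs .accumulate s₀ (I.n * 16 + 6) fun s => ∀ z < I.n,
      s.iarr 4 (z : ℕ) = #{k : Fin I.n | p k ∧ I.rank k ≤ z} := by
  refine (Runs.each (K := 8) (N := I.n)
    (fun K s => s.ivar 6 = #{k : Fin I.n | p k ∧ I.rank k < K} ∧ (∀ z < K,
      s.iarr 4 (z : ℕ) = #{k : Fin I.n | p k ∧ I.rank k ≤ z}) ∧ ∀ z < I.n, K ≤ z →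
      s.iarr 4 (z : ℕ) = #{k : Fin I.n | p k ∧ I.rank k = z})
    hL.n rfl rfl (by decide)
    (by simpa [h6] using h4) (by simp) fun K s hK hs f hI => ?_).mono (by linarith)
    fun s _ h => h.2.1
  refine Program.runs_result _ rfl s (by decide) ?_
  obtain ⟨hI1, hI2, hI3⟩ := hI
  have hsum : (#{k : Fin I.n | p k ∧ I.rank k < K} : ℤ) + #{k : Fin I.n | p k ∧ I.rank k = K} =
      #{k : Fin I.n | p k ∧ I.rank k < K + 1} := by
    rw [← Nat.cast_add, ← card_union_of_disjoint]
    · congr 2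
      ext k
      simp only [mem_union, mem_filter, mem_univ, true_and]
      rw [Nat.lt_succ_iff_lt_or_eq, and_or_left]
    · rw [disjoint_left]
      intro k hk hk'
      simp only [mem_filter, mem_univ, true_and] at hk hk'
      omega
  have hnew : s.ivar 6 + s.iarr 4 (K : ℕ) = #{k : Fin I.n | p k ∧ I.rank k < K + 1} := by
    rw [hI1, hI3 K hK le_rfl, hsum]
  simp only [Program.result, IExp.eval, Store.iset_ivar, Store.iset_iarr, Store.iput_iarr,
    Store.iput_ivar, hs, hnew, if_true, show ¬ (5 : ℕ) = 6 by decide, if_false]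
  refine ⟨trivial, fun z hz => ?_, fun z hz hKz => ?_⟩
  · by_cases hzK : z = K
    · subst hzK
      simp
    · rw [Function.update_of_ne (by exact_mod_cast hzK)]
      exact hI2 z (by omega)
  · rw [Function.update_of_ne (by norm_cast; omega)]
    exact hI3 z hz (by omega)

/-- Without multiplication the row offset `i * n` has to be carried along, in register `7`. The
entry for `j` is the prefix sum at the rank of `D j`. -/
theorem runs_writeRow {s₀ : Store} (hL : I.Loaded s₀)
    (h3 : ∀ j : Fin I.n, s₀.iarr 3 (j : ℕ) = I.rank j) {i : Fin I.n}
    (h7 : s₀.ivar 7 = (i : ℕ) * I.n)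
    (h4 : ∀ z < I.n, s₀.iarr 4 (z : ℕ) = #{k : Fin I.n | I.r i ≤ I.r k ∧ I.rank k ≤ z})
    (h0 : ∀ i' j : Fin I.n, i' < i → s₀.iarr 0 ((i' : ℕ) * I.n + (j : ℕ) : ℤ) = I.c i' j) :
    Runs .writeRow s₀ (I.n * 15 + 6) fun s =>
      ∀ i' j : Fin I.n, i' ≤ i → s.iarr 0 ((i' : ℕ) * I.n + (j : ℕ) : ℤ) = I.c i' j := by
  refine (Runs.each (K := 7) (N := I.n)
    (fun K s => ∀ i' j : Fin I.n, i' < i ∨ i' = i ∧ (j : ℕ) < K →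
      s.iarr 0 ((i' : ℕ) * I.n + (j : ℕ) : ℤ) = I.c i' j)
    hL.n rfl rfl (by decide)
    (by simpa using h0) (by simp) fun K s hK hs f hI => ?_).mono (by linarith)
    fun s _ h i' j hi => h i' j (hi.lt_or_eq.imp_right fun hh => ⟨hh, j.2⟩)
  refine Program.runs_result _ rfl s (by decide) fun i' j hij => ?_
  have e7 : s.ivar 7 = (i : ℕ) * I.n := (f.ivar 7 rfl).trans h7
  have hr : s.iarr 3 (K : ℕ) = I.rank ⟨K, hK⟩ := f.iarr 3 rfl ▸ h3 ⟨K, hK⟩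
  have hv : s.iarr 4 (I.rank ⟨K, hK⟩) = I.c i ⟨K, hK⟩ := by
    rw [f.iarr 4 rfl, h4 _ (I.rank_lt _), c]
    simp only [rank_le_rank]
  simp only [Program.result, Store.iput_iarr, if_true, IExp.eval, hs, e7, hr, hv]
  by_cases heq : i' = i ∧ (j : ℕ) = K
  · obtain ⟨rfl, hj⟩ := heq
    have : j = ⟨K, hK⟩ := Fin.ext hj
    subst this
    simp
  · rw [Function.update_of_ne]
    · refine hI i' j (hij.imp_right fun hh => ⟨hh.1, ?_⟩)
      have : (j : ℕ) ≠ K := fun h => heq ⟨hh.1, h⟩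
      omega
    · intro h
      have := add_mul_inj j.2 hK (by exact_mod_cast h)
      exact heq ⟨Fin.ext this.1, this.2⟩

theorem runs_matrix {s₀ : Store} (hL : I.Loaded s₀) (hn : 0 < I.n) (h7 : s₀.ivar 7 = 0) :
    Runs .matrix s₀ (200 * I.n ^ 2) I.StoresC := by
  refine (Runs.seq (runs_ranks hL) fun s₁ f₁ h₁ => Runs.each (K := I.n * 64 + 30) (N := I.n)
    (fun K s => s.ivar 7 = K * I.n ∧ ∀ i j : Fin I.n, (i : ℕ) < K →
      s.iarr 0 ((i : ℕ) * I.n + (j : ℕ) : ℤ) = I.c i j)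
    (hL.frame f₁).n rfl rfl (by decide) ⟨by simp [f₁.ivar 7 rfl, h7], by simp⟩ (by simp)
    fun K s hK hs f hI => ?_).mono ?_ fun s _ h i j => h.2 i j i.2
  · have hLs := (hL.frame f₁).frame f
    have h3 : ∀ j : Fin I.n, s.iarr 3 (j : ℕ) = I.rank j := fun j => f.iarr 3 rfl ▸ h₁ j
    refine (Runs.seq (runs_clear hLs) fun s₂ f₂ h₂ => Runs.seq (runs_fill (i := ⟨K, hK⟩)
      (hLs.frame f₂) (by rwa [f₂.iarr 3 rfl]) (by rwa [f₂.ivar 4 rfl]) h₂) fun s₃ f₃ h₃ =>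
      Runs.seq_result (P := .iset 6 (.lit 0)) rfl fun f₄ =>
    Runs.seq (runs_accumulate (((hLs.frame f₂).frame f₃).frame f₄)
      (fun k => I.r ⟨K, hK⟩ ≤ I.r k) rfl h₃) fun s₅ f₅ h₅ =>
      Runs.seq (runs_writeRow (i := ⟨K, hK⟩) ((((hLs.frame f₂).frame f₃).frame f₄).frame f₅)
        ?_ ?_ h₅ ?_) fun s₆ f₆ h₆ => Program.runs_result (K := 4) _ rfl _ (by decide) ?_).mono ?_
        fun _ _ h => h
    · rwa [f₅.iarr 3 rfl, f₄.iarr 3 rfl, f₃.iarr 3 rfl, f₂.iarr 3 rfl]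
    · rw [f₅.ivar 7 rfl, f₄.ivar 7 rfl, f₃.ivar 7 rfl, f₂.ivar 7 rfl, hI.1]
    · rw [f₅.iarr 0 rfl, f₄.iarr 0 rfl, f₃.iarr 0 rfl, f₂.iarr 0 rfl]
      exact fun i' j h => hI.2 i' j h
    · have e7 : s₆.ivar 7 = K * I.n := by
        rw [f₆.ivar 7 rfl, f₅.ivar 7 rfl, f₄.ivar 7 rfl, f₃.ivar 7 rfl, f₂.ivar 7 rfl, hI.1]
      have e0 := (((((hLs.frame f₂).frame f₃).frame f₄).frame f₅).frame f₆).n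
      refine ⟨?_, fun i j h => h₆ i j (Nat.lt_succ_iff.1 h)⟩
      simp only [Program.result, Store.iset_ivar, if_true, IExp.eval, e7, e0]
      push_cast
      ring
    · have : (Program.iset 6 (.lit 0)).time = 2 := rfl
      omega
  · have h1 : I.n ≤ I.n ^ 2 := Nat.le_self_pow (by decide) _
    nlinarith

end JobInstance

/-! ### Computing the time points -/

/-- The first entries of the array `u` list the elements of `A` without repetition. -/
def Lists (u : ℤ → ℝ) (A : Finset ℝ) : Prop := (range #A).image (fun k : ℕ => u k) = A

theorem Lists.injOn {u : ℤ → ℝ} {A : Finset ℝ} (h : Lists u A) :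
    Set.InjOn (fun k : ℕ => u k) (range #A) :=
  card_image_iff.1 (by rw [h, card_range])

theorem Lists.mem {u : ℤ → ℝ} {A : Finset ℝ} (h : Lists u A) {k : ℕ} (hk : k < #A) : u k ∈ A := by
  have := mem_image_of_mem (fun k : ℕ => u k) (mem_range.2 hk)
  rwa [h] at this

theorem Lists.exists {u : ℤ → ℝ} {A : Finset ℝ} (h : Lists u A) {x : ℝ} (hx : x ∈ A) :
    ∃ k < #A, u k = x := by
  rw [← h] at hx
  simpa using hx

theorem Lists.card_filter {u : ℤ → ℝ} {A : Finset ℝ} (h : Lists u A) (p : ℝ → Prop)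
    [DecidablePred p] : #((range #A).filter fun k : ℕ => p (u k)) = #{s ∈ A | p s} := by
  conv_rhs => rw [← h]
  rw [filter_image, card_image_of_injOn]
  exact h.injOn.mono (coe_subset.2 (filter_subset _ _))

theorem Lists.insert {u : ℤ → ℝ} {A : Finset ℝ} (h : Lists u A) {x : ℝ} (hx : x ∉ A) :
    Lists (Function.update u (#A : ℕ) x) (insert x A) := by
  rw [Lists, card_insert_of_notMem hx, range_add_one, image_insert, Function.update_self]
  congr 1
  conv_rhs => rw [← h]
  refine image_congr fun k hk => ?_
  simp only [coe_range, Set.mem_Iio] at hk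
  exact Function.update_of_ne (by exact_mod_cast hk.ne) _ _

namespace JobInstance

variable (I : JobInstance)

theorem card_lt_orderEmbOfFin (k : Fin #I.T) :
    #{s ∈ I.T | s < I.T.orderEmbOfFin rfl k} = k := by
  have : {s ∈ I.T | s < I.T.orderEmbOfFin rfl k} =
      (Iio k).map (I.T.orderEmbOfFin rfl).toEmbedding := by
    ext s
    simp only [mem_filter, mem_map, mem_Iio, RelEmbedding.coe_toEmbedding]
    constructor
    · rintro ⟨hs, hlt⟩
      have hr : s ∈ Set.range (I.T.orderEmbOfFin rfl) := by
        rw [range_orderEmbOfFin]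
        exact hs
      obtain ⟨j, rfl⟩ := hr
      exact ⟨j, (I.T.orderEmbOfFin rfl).lt_iff_lt.1 hlt, rfl⟩
    · rintro ⟨j, hj, rfl⟩
      exact ⟨orderEmbOfFin_mem _ _ _, (I.T.orderEmbOfFin rfl).lt_iff_lt.2 hj⟩
  rw [this, card_map, Fin.card_Iio]

theorem card_lt_injOn {s t : ℝ} (hs : s ∈ I.T) (ht : t ∈ I.T)
    (h : #{x ∈ I.T | x < s} = #{x ∈ I.T | x < t}) : s = t := by
  have key : ∀ s ∈ I.T, ∀ t ∈ I.T, s < t → #{x ∈ I.T | x < s} < #{x ∈ I.T | x < t} := by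
    intro s hs t _ hst
    refine card_lt_card ⟨fun x hx => ?_, fun hh => ?_⟩
    · rw [mem_filter] at hx ⊢
      exact ⟨hx.1, hx.2.trans hst⟩
    · exact lt_irrefl _ (mem_filter.1 (hh (mem_filter.2 ⟨hs, hst⟩))).2
  rcases lt_trichotomy s t with h' | h' | h'
  · exact absurd h (key s hs t ht h').ne
  · exact h'
  · exact absurd h (key t ht s hs h').ne'

/-- The points of `T` are stored in increasing order in the time array `2`. -/
structure HasPoints (s : Store) : Prop where
  card : s.ivar 3 = #I.T
  point : ∀ k : Fin #I.T, s.tarr 2 ((k : ℕ) : ℤ) = I.T.orderEmbOfFin rfl k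

variable {I}

theorem HasPoints.lists {s : Store} (h : I.HasPoints s) : Lists (s.tarr 2) I.T := by
  ext x
  simp only [mem_image, mem_range]
  constructor
  · rintro ⟨k, hk, rfl⟩
    rw [h.point ⟨k, hk⟩]
    exact orderEmbOfFin_mem _ _ _
  · intro hx
    have hr : x ∈ Set.range (I.T.orderEmbOfFin rfl) := by
      rw [range_orderEmbOfFin]
      exact hx
    obtain ⟨k, rfl⟩ := hr
    exact ⟨k, k.2, h.point k⟩

theorem HasPoints.frame {s s' : Store} (h : I.HasPoints s) {P : Program} (f : P.Frame s s')
    (h₁ : P.setsI 3 = false := by rfl) (h₂ : P.putsT 2 = false := by rfl) : I.HasPoints s' :=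
  ⟨(f.ivar 3 h₁).trans h.card, fun k => f.tarr 2 h₂ ▸ h.point k⟩

theorem HasPoints.card_lt {s : Store} (h : I.HasPoints s) {k : ℕ} (hk : k < #I.T) :
    #{x ∈ I.T | x < s.tarr 2 k} = k := by
  rw [h.point ⟨k, hk⟩]
  exact I.card_lt_orderEmbOfFin ⟨k, hk⟩

variable (I)

/-- The points that arise from the first pairs of a release time and a multiple of `p`. -/
noncomputable def partialT (i a : ℕ) : Finset ℝ :=
  ({q | (q.1 : ℕ) < i ∨ (q.1 : ℕ) = i ∧ (q.2 : ℕ) < a} : Finset (Fin I.n × Fin I.n)).image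
    fun q => I.r q.1 + (q.2 : ℕ) * I.p

theorem partialT_zero : I.partialT 0 0 = ∅ := by simp [partialT]

theorem partialT_subset (i a : ℕ) : I.partialT i a ⊆ I.T := image_subset_image (filter_subset _ _)

theorem partialT_n : I.partialT I.n 0 = I.T := by
  rw [partialT, filter_true_of_mem fun q _ => Or.inl q.1.2, T]

theorem partialT_row (i : ℕ) : I.partialT i I.n = I.partialT (i + 1) 0 := by
  rw [partialT, partialT]
  congr 2
  ext q
  have := q.2.2
  omega

theorem partialT_step {i a : ℕ} (hi : i < I.n) (ha : a < I.n) :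
    I.partialT i (a + 1) = insert (I.r ⟨i, hi⟩ + a * I.p) (I.partialT i a) := by
  rw [partialT, partialT, ← image_insert (fun q : Fin I.n × Fin I.n => I.r q.1 + (q.2 : ℕ) * I.p)
    (⟨i, hi⟩, ⟨a, ha⟩)]
  congr 1
  ext q
  simp only [mem_filter, mem_univ, true_and, mem_insert, Prod.ext_iff, Fin.ext_iff]
  omega

theorem card_partialT_le (i a : ℕ) : #(I.partialT i a) ≤ I.n ^ 2 :=
  (card_le_card (I.partialT_subset i a)).trans I.card_T_le

end JobInstance

namespace Program

/-- Append the time register `1` to the list in the time array `4`, unless it is there. -/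
def append : Program :=
  seq (count 6 5 3 (.conj (.tle (.arr 4 (.var 5)) (.var 1)) (.tle (.var 1) (.arr 4 (.var 5)))))
    (seq (branch (.ile (.var 6) (.lit 0))
      (seq (tput 4 (.var 3) (.var 1)) (iset 3 (.add (.var 3) (.lit 1)))) nop)
      (tset 1 (.add (.var 1) (.var 0))))

/-- List the points of `T` in the time array `4`. -/
def collect : Program :=
  seq (iset 3 (.lit 0)) (each 4 0 (seq (tset 1 (.arr 0 (.var 4))) (each 9 0 append)))

/-- Sort the points of `T` into the time array `2`. -/
def sort : Program :=
  each 4 3 (seq (count 6 5 3 (.neg (.tle (.arr 4 (.var 4)) (.arr 4 (.var 5)))))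
    (tput 2 (.var 6) (.arr 4 (.var 4))))

end Program

namespace JobInstance

variable {I : JobInstance}

theorem runs_append {s₀ : Store} (hL : I.Loaded s₀) {A : Finset ℝ} {x : ℝ}
    (h3 : s₀.ivar 3 = #A) (h4 : Lists (s₀.tarr 4) A) (h1 : s₀.tvar 1 = x) :
    Runs .append s₀ (#A * 22 + 23) fun s => s.ivar 3 = #(insert x A) ∧
      Lists (s.tarr 4) (insert x A) ∧ s.tvar 1 = x + I.p := by
  refine (Runs.seq (Runs.count (N := #A) (fun k => s₀.tarr 4 k = x) h3
    (by decide) (by decide) (by decide) fun k s' hk hs' f' => ?_) fun s₁ f₁ h₁ =>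
    Program.runs_result (K := 15) _ rfl s₁ (by decide) ?_).mono
    (by simp only [Test.cost, TExp.cost, IExp.cost]; linarith) fun s _ h => h
  · simp only [Test.Holds, TExp.eval, IExp.eval, hs', f'.tarr 4 rfl, f'.tvar 1 rfl, h1]
    exact le_antisymm_iff.symm
  · have e3 : s₁.ivar 3 = #A := (f₁.ivar 3 rfl).trans h3
    have e1 : s₁.tvar 1 = x := (f₁.tvar 1 rfl).trans h1
    have e4 : s₁.tarr 4 = s₀.tarr 4 := f₁.tarr 4 rfl
    have ep := (hL.frame f₁).p
    rw [h4.card_filter fun y => y = x, filter_eq'] at h₁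
    by_cases hx : x ∈ A
    · simp [Program.result, h₁, hx, e1, e3, e4, h4, ep]
    · simp [Program.result, h₁, hx, e1, e3, e4, h4.insert hx, ep]

/-- The candidates `r i + a p` are generated by repeated addition of `p`. Each of the `n ^ 2`
candidates is looked up in a list of at most `n ^ 2` points, which fits into `O(n ^ 4)`. -/
theorem runs_collect {s₀ : Store} (hL : I.Loaded s₀) :
    Runs .collect s₀ (I.n * (I.n * (I.n ^ 2 * 22 + 31) + 17) + 8) fun s => s.ivar 3 = #I.T ∧
      Lists (s.tarr 4) I.T := by
  refine (Runs.seq_result (P := .iset 3 (.lit 0)) rfl fun f₁ =>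
    Runs.each (K := I.n * (I.n ^ 2 * 22 + 31) + 9) (N := I.n)
    (fun i s => s.ivar 3 = #(I.partialT i 0) ∧ Lists (s.tarr 4) (I.partialT i 0))
    (hL.frame f₁).n rfl rfl (by decide) ?_ (by simp) fun i s hi hs f hI => ?_).mono
      (by simp only [Program.time, IExp.cost]; linarith)
      fun s _ h => by rwa [partialT_n] at h
  · simp [partialT_zero, Program.result, Lists]
  · have hLs := (hL.frame f₁).frame f
    refine (Runs.seq_result (P := .tset 1 (.arr 0 (.var 4))) rfl fun f₂ =>
      Runs.each (K := I.n ^ 2 * 22 + 23) (N := I.n)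
      (fun a s => s.ivar 3 = #(I.partialT i a) ∧ Lists (s.tarr 4) (I.partialT i a) ∧
        s.tvar 1 = I.r ⟨i, hi⟩ + a * I.p)
      (hLs.frame f₂).n rfl rfl (by decide) ?_ (by simp) fun a s' ha hs' f' hI' => ?_).mono
      (by simp only [Program.time, IExp.cost, TExp.cost]; linarith)
      fun s _ h => by rw [← partialT_row]; exact ⟨h.1, h.2.1⟩
    · simpa [Program.result, hs, hLs.r, toArray_of_lt I.r hi] using hI
    · refine (runs_append ((hLs.frame f₂).frame f') hI'.1 hI'.2.1 hI'.2.2).mono ?_ fun s _ h => ?_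
      · have := I.card_partialT_le i a
        linarith
      · rw [I.partialT_step hi ha]
        refine ⟨h.1, h.2.1, h.2.2.trans ?_⟩
        push_cast
        ring

/-- Every point is written at the index equal to the number of smaller points. -/
theorem runs_sort {s₀ : Store} (h3 : s₀.ivar 3 = #I.T) (h4 : Lists (s₀.tarr 4) I.T) :
    Runs .sort s₀ (#I.T * (#I.T * 19 + 21) + 6) I.HasPoints := by
  refine (Runs.each (K := #I.T * 19 + 13) (N := #I.T)
    (fun k s => ∀ q < k, s.tarr 2 #{x ∈ I.T | x < s₀.tarr 4 q} = s₀.tarr 4 q)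
    h3 rfl rfl (by decide) (by simp) (by simp) fun i s hi hs f hI => ?_).mono
      (by linarith) fun s f h => ⟨(f.ivar 3 rfl).trans h3, fun k => ?_⟩
  · refine (Runs.seq (Runs.count (N := #I.T) (fun k => s₀.tarr 4 k < s₀.tarr 4 i)
      ((f.ivar 3 rfl).trans h3)
      (by decide) (by decide) (by decide) fun k s' hk hs' f' => ?_) fun s₁ f₁ h₁ =>
      Program.runs_result (K := 4) _ rfl s₁ (by decide) ?_).mono
      (by simp only [Test.cost, TExp.cost, IExp.cost]; linarith) fun s _ h => h
    · simp only [Test.Holds, TExp.eval, IExp.eval, hs', f'.tarr 4 rfl, f'.ivar 4 rfl, hs,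
        f.tarr 4 rfl, not_le]
    · intro q hq
      have e4 : s₁.tarr 4 = s₀.tarr 4 := (f₁.tarr 4 rfl).trans (f.tarr 4 rfl)
      have ei : s₁.ivar 4 = i := (f₁.ivar 4 rfl).trans hs
      have e2 : s₁.tarr 2 = s.tarr 2 := f₁.tarr 2 rfl
      rw [h4.card_filter fun y => y < s₀.tarr 4 i] at h₁
      simp only [Program.result, Store.tput_tarr, if_true, TExp.eval, IExp.eval, h₁, ei, e4, e2]
      by_cases h : #{x ∈ I.T | x < s₀.tarr 4 q} = #{x ∈ I.T | x < s₀.tarr 4 i}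
      · rw [h, Function.update_self]
        exact (I.card_lt_injOn (h4.mem (by omega)) (h4.mem hi) h).symm
      · rw [Function.update_of_ne (by exact_mod_cast h)]
        refine hI q (lt_of_le_of_ne (Nat.lt_succ_iff.1 hq) ?_)
        rintro rfl
        exact h rfl
  · obtain ⟨q, hq, hqk⟩ := h4.exists (orderEmbOfFin_mem I.T rfl k)
    have := h q hq
    rwa [hqk, card_lt_orderEmbOfFin] at this

end JobInstance

/-! ### Computing the constraint graph -/

/-- The arcs in `A` are stored by their tails, heads, and costs in the integer arrays `5`, `6`, `7`,
and register `8` is their number. -/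
structure StoresArcs (s : Store) (E : ℕ) (A : Set (ℤ × ℤ × ℤ)) : Prop where
  card : s.ivar 8 = E
  arc : A = {a | ∃ e < E, a = (s.iarr 5 (e : ℕ), s.iarr 6 (e : ℕ), s.iarr 7 (e : ℕ))}

theorem StoresArcs.frame {s s' : Store} {E : ℕ} {A : Set (ℤ × ℤ × ℤ)} (h : StoresArcs s E A)
    {P : Program} (f : P.Frame s s')
    (h₁ : P.setsI 8 = false := by rfl) (h₂ : P.putsI 5 = false := by rfl)
    (h₃ : P.putsI 6 = false := by rfl) (h₄ : P.putsI 7 = false := by rfl) : StoresArcs s' E A :=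
  ⟨(f.ivar 8 h₁).trans h.card, by rw [f.iarr 5 h₂, f.iarr 6 h₃, f.iarr 7 h₄]; exact h.arc⟩

theorem StoresArcs.mem {s : Store} {E : ℕ} {A : Set (ℤ × ℤ × ℤ)} (h : StoresArcs s E A) {e : ℕ}
    (he : e < E) : (s.iarr 5 (e : ℕ), s.iarr 6 (e : ℕ), s.iarr 7 (e : ℕ)) ∈ A := by
  rw [h.arc]
  exact ⟨e, he, rfl⟩

namespace Program

/-- Store an arc. -/
def push (t h c : IExp) : Program :=
  seq (iput 5 (.var 8) t) (seq (iput 6 (.var 8) h) (seq (iput 7 (.var 8) c)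
    (iset 8 (.add (.var 8) (.lit 1)))))

/-- Store the order arcs and the load arcs. -/
def orderLoadArcs : Program :=
  each 4 3 (seq (push (.var 4) (.sub (.var 4) (.lit 1)) (.lit 0))
    (seq (tset 1 (.add (.arr 2 (.var 4)) (.var 0)))
    (seq (count 6 5 3 (.neg (.tle (.var 1) (.arr 2 (.var 5)))))
    (push (.sub (.var 4) (.lit 1)) (.sub (.var 6) (.lit 1)) (.var 1)))))

/-- Store the inclusion arc of `i` and `j`. -/
def inclusionArc : Program :=
  seq (tset 1 (.sub (.arr 1 (.var 9)) (.var 0)))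
    (seq (count 6 5 3 (.tle (.arr 2 (.var 5)) (.var 1)))
    (branch (.neg (.ile (.arr 0 (.add (.var 7) (.var 9))) (.lit 0)))
      (push (.sub (.var 6) (.lit 1)) (.sub (.var 10) (.lit 1))
        (.sub (.lit 0) (.arr 0 (.add (.var 7) (.var 9))))) nop))

/-- Store the inclusion arcs. -/
def inclusionArcs : Program :=
  each 4 0 (seq (tset 1 (.arr 0 (.var 4)))
    (seq (count 10 5 3 (.neg (.tle (.var 1) (.arr 2 (.var 5)))))
    (seq (each 9 0 inclusionArc) (iset 7 (.add (.var 7) (.var 0))))))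

/-- Store the arcs of the constraint graph. -/
def graph : Program :=
  seq (seq (iset 8 (.lit 0)) (push (.lit (-1)) (.sub (.var 3) (.lit 1)) (.var 0)))
    (seq orderLoadArcs (seq (iset 7 (.lit 0)) inclusionArcs))

end Program

/-- Head and cost are evaluated after the earlier writes of the same arc, hence the quantified
stores. An arc may be stored repeatedly: `E` counts entries, while `A` is a set. -/
theorem runs_push {t h c : IExp} {s : Store} {E : ℕ} {A : Set (ℤ × ℤ × ℤ)} (hA : StoresArcs s E A)
    {a b w : ℤ} (ht : t.eval s = a) (hh : ∀ i v, h.eval (s.iput 5 i v) = b)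
    (hc : ∀ i v i' v', c.eval ((s.iput 5 i v).iput 6 i' v') = w) :
    Runs (.push t h c) s (t.cost + h.cost + c.cost + 10)
      fun s' => StoresArcs s' (E + 1) (insert (a, b, w) A) := by
  refine Program.runs_result _ rfl s ?_ ⟨?_, ?_⟩
  · simp only [Program.push, Program.time, IExp.cost]
    omega
  · simp [Program.push, Program.result, hA.card]
  · simp only [Program.push, Program.result, ht, hh, hc, IExp.eval, Store.iput_ivar, hA.card,
      Store.iset_iarr, Store.iput_iarr]
    norm_num
    ext x
    rw [Set.mem_insert_iff, hA.arc]
    constructor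
    · rintro (rfl | ⟨e, he, rfl⟩)
      · exact ⟨E, by omega, by simp⟩
      · refine ⟨e, by omega, ?_⟩
        rw [Function.update_of_ne, Function.update_of_ne, Function.update_of_ne] <;>
        exact_mod_cast he.ne
    · rintro ⟨e, he, rfl⟩
      rcases (by omega : e < E ∨ e = E) with he | rfl
      · refine Or.inr ⟨e, he, ?_⟩
        rw [Function.update_of_ne, Function.update_of_ne, Function.update_of_ne] <;>
        exact_mod_cast he.ne
      · simp

namespace JobInstance

variable (I : JobInstance)

/-- The arcs of the total constraint and of the order and load constraints of the first points,
between positions. -/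
def orderLoadSet (u : ℤ → ℝ) (K : ℕ) : Set (ℤ × ℤ × ℤ) :=
  {a | a = (-1, (#I.T : ℤ) - 1, (I.n : ℤ)) ∨ ∃ k < K, a = ((k : ℤ), (k : ℤ) - 1, 0) ∨
    a = ((k : ℤ) - 1, I.idx (I.prec (u (k : ℕ) + I.p)), (I.m : ℤ))}

/-- The arcs of the first inclusion constraints, between positions. -/
def inclusionSet (i j : ℕ) : Set (ℤ × ℤ × ℤ) :=
  {a | ∃ i' j' : Fin I.n, ((i' : ℕ) < i ∨ (i' : ℕ) = i ∧ (j' : ℕ) < j) ∧ 0 < I.c i' j' ∧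
    a = (I.idx (I.round (I.D j' - I.p)), I.idx (I.prec (I.r i')), -(I.c i' j' : ℤ))}

/-- An arc between positions. -/
noncomputable def arcIdx (a : WithBot ℝ × WithBot ℝ × ℤ) : ℤ × ℤ × ℤ :=
  (I.idx a.1, I.idx a.2.1, a.2.2)

theorem orderLoadSet_succ (u : ℤ → ℝ) (K : ℕ) : I.orderLoadSet u (K + 1) =
    insert ((K : ℤ) - 1, I.idx (I.prec (u (K : ℕ) + I.p)), (I.m : ℤ))
      (insert ((K : ℤ), (K : ℤ) - 1, 0) (I.orderLoadSet u K)) := by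
  ext a
  simp only [orderLoadSet, Set.mem_ofPred_eq, Set.mem_insert_iff]
  constructor
  · rintro (h | ⟨k, hk, h⟩)
    · exact Or.inr (Or.inr (Or.inl h))
    · rcases Nat.lt_succ_iff_lt_or_eq.1 hk with hk | rfl
      · exact Or.inr (Or.inr (Or.inr ⟨k, hk, h⟩))
      · rcases h with h | h
        · exact Or.inr (Or.inl h)
        · exact Or.inl h
  · rintro (h | h | h | ⟨k, hk, h⟩)
    · exact Or.inr ⟨K, by omega, Or.inr h⟩
    · exact Or.inr ⟨K, by omega, Or.inl h⟩
    · exact Or.inl h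
    · exact Or.inr ⟨k, by omega, h⟩

theorem inclusionSet_succ {i j : ℕ} (hi : i < I.n) (hj : j < I.n) (h : 0 < I.c ⟨i, hi⟩ ⟨j, hj⟩) :
    I.inclusionSet i (j + 1) = insert (I.idx (I.round (I.D ⟨j, hj⟩ - I.p)),
      I.idx (I.prec (I.r ⟨i, hi⟩)), -(I.c ⟨i, hi⟩ ⟨j, hj⟩ : ℤ)) (I.inclusionSet i j) := by
  ext a
  simp only [inclusionSet, Set.mem_ofPred_eq, Set.mem_insert_iff]
  constructor
  · rintro ⟨i', j', hij, hc, rfl⟩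
    by_cases heq : (i' : ℕ) = i ∧ (j' : ℕ) = j
    · obtain ⟨rfl, rfl⟩ := heq
      exact Or.inl rfl
    · exact Or.inr ⟨i', j', by omega, hc, rfl⟩
  · rintro (rfl | ⟨i', j', hij, hc, rfl⟩)
    · exact ⟨⟨i, hi⟩, ⟨j, hj⟩, by simp, h, rfl⟩
    · exact ⟨i', j', by omega, hc, rfl⟩

theorem inclusionSet_succ_of_eq_zero {i j : ℕ} (hi : i < I.n) (hj : j < I.n)
    (h : ¬ 0 < I.c ⟨i, hi⟩ ⟨j, hj⟩) : I.inclusionSet i (j + 1) = I.inclusionSet i j := by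
  ext a
  simp only [inclusionSet, Set.mem_ofPred_eq]
  constructor
  · rintro ⟨i', j', hij, hc, rfl⟩
    by_cases heq : (i' : ℕ) = i ∧ (j' : ℕ) = j
    · obtain ⟨rfl, rfl⟩ := heq
      exact absurd hc h
    · exact ⟨i', j', by omega, hc, rfl⟩
  · rintro ⟨i', j', hij, hc, rfl⟩
    exact ⟨i', j', by omega, hc, rfl⟩

theorem inclusionSet_zero : I.inclusionSet 0 0 = ∅ := by simp [inclusionSet]

theorem inclusionSet_row (i : ℕ) : I.inclusionSet i I.n = I.inclusionSet (i + 1) 0 := by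
  ext a
  simp only [inclusionSet, Set.mem_ofPred_eq]
  refine exists_congr fun i' => exists_congr fun j' => and_congr_left fun _ => ?_
  have := j'.2
  omega

variable {I}

theorem HasPoints.idx_prec {s : Store} (h : I.HasPoints s) {k : ℕ} (hk : k < #I.T) :
    I.idx (I.prec (s.tarr 2 k)) = (k : ℤ) - 1 := by
  rw [I.idx_prec, h.card_lt hk]

theorem HasPoints.idx {s : Store} (h : I.HasPoints s) {k : ℕ} (hk : k < #I.T) :
    I.idx (s.tarr 2 k : ℝ) = k := by
  have hT := h.lists.mem hk
  have := I.filter_le_coe_eq_insert hT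
  rw [JobInstance.idx, this, card_insert_of_notMem I.notMem_filter_le_prec]
  have h2 := h.idx_prec hk
  rw [JobInstance.idx] at h2
  push_cast
  linarith

theorem HasPoints.image_arcs {s : Store} (h : I.HasPoints s) :
    I.orderLoadSet (s.tarr 2) #I.T ∪ I.inclusionSet I.n 0 = I.arcIdx '' I.arcs := by
  ext a
  simp only [Set.mem_union, Set.mem_image, mem_coe, I.mem_arcs, orderLoadSet, inclusionSet,
    Set.mem_ofPred_eq]
  constructor
  · rintro ((rfl | ⟨k, hk, rfl | rfl⟩) | ⟨i, j, -, hc, rfl⟩)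
    · exact ⟨_, Or.inl rfl, by simp [arcIdx, idx_bot, idx_max]⟩
    · exact ⟨_, Or.inr (Or.inl ⟨_, h.lists.mem hk, rfl⟩), by
        simp only [arcIdx, h.idx hk, h.idx_prec hk]⟩
    · exact ⟨_, Or.inr (Or.inr (Or.inl ⟨_, h.lists.mem hk, rfl⟩)), by
        simp only [arcIdx, h.idx_prec hk]⟩
    · exact ⟨_, Or.inr (Or.inr (Or.inr ⟨i, j, hc, rfl⟩)), rfl⟩
  · rintro ⟨_, rfl | ⟨t, ht, rfl⟩ | ⟨t, ht, rfl⟩ | ⟨i, j, hc, rfl⟩, rfl⟩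
    · exact Or.inl (Or.inl (by simp [arcIdx, idx_bot, idx_max]))
    · obtain ⟨k, hk, rfl⟩ := h.lists.exists ht
      exact Or.inl (Or.inr ⟨k, hk, Or.inl (by simp only [arcIdx, h.idx hk, h.idx_prec hk])⟩)
    · obtain ⟨k, hk, rfl⟩ := h.lists.exists ht
      exact Or.inl (Or.inr ⟨k, hk, Or.inr (by simp only [arcIdx, h.idx_prec hk])⟩)
    · exact Or.inr ⟨i, j, Or.inl i.2, hc, rfl⟩

/-- Count the points before the time register `1`. -/
theorem runs_count_lt {acc : ℕ} {s₀ : Store} (h : I.HasPoints s₀) (h5 : acc ≠ 5) (h3 : acc ≠ 3)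
    {x : ℝ} (hx : s₀.tvar 1 = x) :
    Runs (.count acc 5 3 (.neg (.tle (.var 1) (.arr 2 (.var 5))))) s₀ (#I.T * 18 + 8)
      fun s => s.ivar acc - 1 = I.idx (I.prec x) := by
  refine (Runs.count (N := #I.T) (fun k => s₀.tarr 2 k < x) h.card h5 h3
    (by decide) fun k s' hk hs' f' => ?_).mono le_rfl fun s _ hs => ?_
  · simp only [Test.Holds, TExp.eval, IExp.eval, hs', f'.tarr 2 rfl, f'.tvar 1 rfl, hx, not_le]
  · rw [hs, h.lists.card_filter fun y => y < x, I.idx_prec]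

/-- Count the points up to the time register `1`. -/
theorem runs_count_le {acc : ℕ} {s₀ : Store} (h : I.HasPoints s₀) (h5 : acc ≠ 5) (h3 : acc ≠ 3)
    {x : ℝ} (hx : s₀.tvar 1 = x) :
    Runs (.count acc 5 3 (.tle (.arr 2 (.var 5)) (.var 1))) s₀ (#I.T * 17 + 8)
      fun s => s.ivar acc - 1 = I.idx (I.round x) := by
  refine (Runs.count (N := #I.T) (fun k => s₀.tarr 2 k ≤ x) h.card h5 h3
    (by decide) fun k s' hk hs' f' => ?_).mono le_rfl fun s _ hs => ?_
  · simp only [Test.Holds, TExp.eval, IExp.eval, hs', f'.tarr 2 rfl, f'.tvar 1 rfl, hx]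
  · rw [hs, h.lists.card_filter fun y => y ≤ x, I.idx_round]

theorem runs_orderLoadArcs {s₀ : Store} (hL : I.Loaded s₀) (hP : I.HasPoints s₀)
    (hA : StoresArcs s₀ 1 (I.orderLoadSet (s₀.tarr 2) 0)) :
    Runs .orderLoadArcs s₀ (#I.T * (#I.T * 18 + 60) + 6) fun s =>
      StoresArcs s (1 + 2 * #I.T) (I.orderLoadSet (s₀.tarr 2) #I.T) := by
  refine (Runs.each (K := #I.T * 18 + 52) (N := #I.T)
    (fun k s => StoresArcs s (1 + 2 * k) (I.orderLoadSet (s₀.tarr 2) k))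
    hP.card rfl rfl (by decide) hA (fun i s v h => ⟨by simpa using h.card, h.arc⟩)
    fun k s hk hs f hI => ?_).mono (by linarith) fun s f h => h
  have hLs := hL.frame f
  have hPs := hP.frame f
  refine (Runs.seq (runs_push hI (t := .var 4) (a := k) (b := (k : ℤ) - 1) (w := 0)
    hs (by simp [hs])
    (by simp)) fun s₁ f₁ h₁ => Runs.seq_result (P := .tset 1 (.add (.arr 2 (.var 4)) (.var 0)))
    rfl fun f₂ => Runs.seq (runs_count_lt ((hPs.frame f₁).frame f₂) (by decide) (by decide)
      (x := s₀.tarr 2 k + I.p) ?_) fun s₃ f₃ h₃ => (runs_push ((h₁.frame f₂).frame f₃)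
      (a := (k : ℤ) - 1) (b := I.idx (I.prec (s₀.tarr 2 k + I.p))) (w := I.m) ?_ ?_ ?_)).mono
      ?_ fun s' _ h => ?_
  · simp [Program.result, f₁.tarr 2 rfl, f₁.ivar 4 rfl, hs, f.tarr 2 rfl, (hLs.frame f₁).p]
  · simp [f₃.ivar 4 rfl, f₂.ivar 4 rfl, f₁.ivar 4 rfl, hs]
  · intro i v
    simpa using h₃
  · intro i v i' v'
    simpa using (((hLs.frame f₁).frame f₂).frame f₃).m
  · simp only [Program.time, IExp.cost, TExp.cost]
    linarith
  · rw [orderLoadSet_succ]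
    exact h

theorem runs_inclusionArc {s₀ : Store} (hL : I.Loaded s₀) (hP : I.HasPoints s₀)
    (hC : I.StoresC s₀) {i j : Fin I.n} (h7 : s₀.ivar 7 = (i : ℕ) * I.n) (h9 : s₀.ivar 9 = (j : ℕ))
    (h10 : s₀.ivar 10 - 1 = I.idx (I.prec (I.r i))) {E : ℕ} {S : Set (ℤ × ℤ × ℤ)}
    (hA : StoresArcs s₀ E (S ∪ I.inclusionSet i j)) :
    Runs .inclusionArc s₀ (#I.T * 17 + 45) fun s =>
      ∃ E' ≤ E + 1, StoresArcs s E' (S ∪ I.inclusionSet i (j + 1)) := by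
  refine (Runs.seq_result (P := .tset 1 (.sub (.arr 1 (.var 9)) (.var 0))) rfl fun f₁ =>
    Runs.seq (runs_count_le (hP.frame f₁) (by decide) (by decide) (x := I.D j - I.p) ?_)
    fun s₂ f₂ h₂ => Runs.branch (K := 22) (fun hb => ?_) fun hb => ?_).mono ?_ fun s' _ h => h
  · simp [Program.result, h9, hL.D, hL.p]
  on_goal 3 =>
    simp only [Program.time, IExp.cost, TExp.cost, Test.cost]
    linarith
  all_goals
    have e7 : s₂.ivar 7 = (i : ℕ) * I.n := by rw [f₂.ivar 7 rfl, f₁.ivar 7 rfl, h7]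
    have e9 : s₂.ivar 9 = (j : ℕ) := by rw [f₂.ivar 9 rfl, f₁.ivar 9 rfl, h9]
    have e10 : s₂.ivar 10 - 1 = I.idx (I.prec (I.r i)) := by
      rw [f₂.ivar 10 rfl, f₁.ivar 10 rfl, h10]
    have e0 : s₂.iarr 0 ((i : ℕ) * I.n + (j : ℕ) : ℤ) = I.c i j := by
      rw [f₂.iarr 0 rfl, f₁.iarr 0 rfl]
      exact hC i j
    try simp only [Test.Holds, IExp.eval, e7, e9, e0, not_le, not_lt] at hb
  · have hc : 0 < I.c i j := by exact_mod_cast hb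
    refine (runs_push ((hA.frame f₁).frame f₂) (a := I.idx (I.round (I.D j - I.p)))
      (b := I.idx (I.prec (I.r i))) (w := -(I.c i j : ℤ)) ?_ ?_ ?_).mono (by simp [IExp.cost])
      fun s' _ h => ⟨_, le_rfl, ?_⟩
    · simpa using h₂
    · intro k v
      simpa using e10
    · intro k v k' v'
      simp [e7, e9, e0]
    · rw [I.inclusionSet_succ i.2 j.2 hc, Set.union_insert]
      exact h
  · refine Program.runs_result _ rfl _ (by decide) ⟨E, by omega, ?_⟩
    rw [I.inclusionSet_succ_of_eq_zero i.2 j.2 (by simpa using hb)]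
    exact (hA.frame f₁).frame f₂

/-- The head `prec (r i)` is located once per row, the tail once per pair, each by one scan of the
points. Only a bound for the number of entries is kept, because pairs with `c i j = 0` are skipped.
-/
theorem runs_inclusionArcs {s₀ : Store} (hL : I.Loaded s₀) (hP : I.HasPoints s₀)
    (hC : I.StoresC s₀) (h7 : s₀.ivar 7 = 0) {E : ℕ} {S : Set (ℤ × ℤ × ℤ)}
    (hA : StoresArcs s₀ E S) :
    Runs .inclusionArcs s₀ (I.n * (I.n * (#I.T * 17 + 53) + #I.T * 18 + 40) + 6) fun s =>
      ∃ E' ≤ E + I.n ^ 2, StoresArcs s E' (S ∪ I.inclusionSet I.n 0) := by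
  refine (Runs.each (K := I.n * (#I.T * 17 + 53) + #I.T * 18 + 32) (N := I.n)
    (fun i s => s.ivar 7 = (i : ℕ) * I.n ∧
      ∃ E' ≤ E + i * I.n, StoresArcs s E' (S ∪ I.inclusionSet i 0))
    hL.n rfl rfl (by decide) ⟨by simpa using h7, E, by simp, by simpa [inclusionSet_zero] using hA⟩
    (fun i s v h => ⟨by simpa using h.1, h.2.imp fun E' hE => ⟨hE.1, by simpa using hE.2.card,
      hE.2.arc⟩⟩)
    fun i s hi hs f hI => ?_).mono (by linarith) fun s f h => by
      obtain ⟨E', hE', h⟩ := h.2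
      exact ⟨E', by rwa [sq], h⟩
  have hLs := hL.frame f
  have hPs := hP.frame f
  obtain ⟨hI7, E', hE', hIA⟩ := hI
  refine (Runs.seq_result (P := .tset 1 (.arr 0 (.var 4))) rfl fun f₁ =>
    Runs.seq (runs_count_lt (hPs.frame f₁) (by decide) (by decide) (x := I.r ⟨i, hi⟩) ?_)
    fun s₂ f₂ h₂ => Runs.seq (Runs.each (K := #I.T * 17 + 45) (N := I.n)
      (fun j s => ∃ E'' ≤ E' + j, StoresArcs s E'' (S ∪ I.inclusionSet i j))
      ((hLs.frame f₁).frame f₂).n rfl rfl (by decide) ⟨E', le_rfl, (hIA.frame f₁).frame f₂⟩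
      (fun i s v h => h.imp fun E' hE => ⟨hE.1, by simpa using hE.2.card, hE.2.arc⟩)
      fun j s₃ hj hs₃ f₃ hI₃ => ?_) fun s₄ f₄ h₄ =>
      Program.runs_result (K := 4) _ rfl _ (by decide) ?_).mono ?_ fun s' _ h => h
  · simp [Program.result, hs, hLs.r, toArray_of_lt I.r hi]
  · obtain ⟨E'', hE'', h⟩ := hI₃
    refine (runs_inclusionArc (((hLs.frame f₁).frame f₂).frame f₃)
      (((hPs.frame f₁).frame f₂).frame f₃) ?_ (i := ⟨i, hi⟩) (j := ⟨j, hj⟩) ?_ hs₃ ?_ h).mono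
      le_rfl fun s' _ h => ?_
    · intro i' j'
      rw [f₃.iarr 0 rfl, f₂.iarr 0 rfl, f₁.iarr 0 rfl, f.iarr 0 rfl]
      exact hC i' j'
    · rw [f₃.ivar 7 rfl, f₂.ivar 7 rfl, f₁.ivar 7 rfl, hI7]
    · rw [f₃.ivar 10 rfl, h₂]
    · obtain ⟨E₃, hE₃, h⟩ := h
      exact ⟨E₃, by omega, h⟩
  · have hL₄ := ((hLs.frame f₁).frame f₂).frame f₄
    obtain ⟨E'', hE'', h⟩ := h₄
    have e7 : s₄.ivar 7 = (i : ℕ) * I.n := by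
      rw [f₄.ivar 7 rfl, f₂.ivar 7 rfl, f₁.ivar 7 rfl, hI7]
    refine ⟨?_, E'', by linarith, ?_, ?_⟩
    · simp only [Program.result, IExp.eval, Store.iset_ivar, if_true, hL₄.n, e7]
      push_cast
      ring
    · simpa [Program.result] using h.card
    · rw [← inclusionSet_row]
      exact h.arc
  · simp only [Program.time, IExp.cost, TExp.cost]
    linarith

theorem runs_graph {s₀ : Store} (hL : I.Loaded s₀) (hP : I.HasPoints s₀) (hC : I.StoresC s₀) :
    Runs .graph s₀ (#I.T * (#I.T * 18 + 60) +
      I.n * (I.n * (#I.T * 17 + 53) + #I.T * 18 + 40) + 31) fun s =>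
      ∃ E ≤ 1 + 2 * #I.T + I.n ^ 2, StoresArcs s E (I.arcIdx '' I.arcs) := by
  refine (Runs.seq (Runs.seq_result (P := .iset 8 (.lit 0)) rfl fun f₀ => runs_push (E := 0)
      (A := ∅) ⟨by simp [Program.result], by simp⟩ (a := -1) (b := (#I.T : ℤ) - 1)
      (w := (I.n : ℤ)) rfl ?_ ?_) fun s₁ f₁ h₁ => Runs.seq (runs_orderLoadArcs (hL.frame f₁)
      (hP.frame f₁) ?_) fun s₂ f₂ h₂ => Runs.seq_result (P := .iset 7 (.lit 0)) rfl fun f₃ =>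
      runs_inclusionArcs (((hL.frame f₁).frame f₂).frame f₃) (((hP.frame f₁).frame f₂).frame f₃)
      (E := 1 + 2 * #I.T) (S := I.orderLoadSet (s₀.tarr 2) #I.T)
      ?_ rfl ?_).mono ?_ fun s' f' h => ?_
  · intro i v
    simp [Program.result, hP.card]
  · intro i v i' v'
    simp [Program.result, hL.n]
  · convert h₁ using 1
    ext a
    simp [orderLoadSet]
  · intro i j
    rw [f₃.iarr 0 rfl, f₂.iarr 0 rfl, f₁.iarr 0 rfl]
    exact hC i j
  · rw [← f₁.tarr 2 rfl]
    exact h₂.frame f₃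
  · simp only [Program.time, IExp.cost]
    linarith
  · rwa [hP.image_arcs] at h

end JobInstance

/-! ### Solving the linear program -/

namespace Program

/-- Is arc number `x` violated by the values in the integer array `1`? -/
def violated (x : ℕ) : Test :=
  .neg (.ile (.arr 1 (.arr 6 (.var x))) (.add (.arr 1 (.arr 5 (.var x))) (.arr 7 (.var x))))

/-- Start with the value `0` at the source and the value `n` elsewhere. -/
def startValues : Program := seq (iput 1 (.lit (-1)) (.lit 0)) (each 4 3 (iput 1 (.var 4) (.var 0)))

/-- Relax all arcs. -/
def relax : Program :=
  each 5 8 (branch (violated 5)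
    (iput 1 (.arr 6 (.var 5)) (.add (.arr 1 (.arr 5 (.var 5))) (.arr 7 (.var 5)))) nop)

/-- Set register `2` to `1` if no arc is violated, and to `0` otherwise. -/
def verdict : Program :=
  seq (count 6 5 8 (violated 5))
    (branch (.ile (.var 6) (.lit 0)) (iset 2 (.lit 1)) (iset 2 (.lit 0)))

/-- The Bellman-Ford algorithm. -/
def bellmanFord : Program := seq startValues (seq (each 4 3 relax) verdict)

/-- Solve the skeleton linear program. -/
def solve : Program := seq collect (seq sort (seq graph bellmanFord))

end Program

namespace JobInstance

variable {I : JobInstance}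

theorem HasPoints.idx_surj {s : Store} (h : I.HasPoints s) {v : WithBot ℝ} (hv : v ∈ I.T') :
    v = ⊥ ∧ I.idx v = -1 ∨ ∃ k < #I.T, v = (s.tarr 2 k : ℝ) ∧ I.idx v = k := by
  rcases I.mem_T'.1 hv with rfl | ⟨t, ht, rfl⟩
  · exact Or.inl ⟨rfl, I.idx_bot⟩
  · obtain ⟨k, hk, rfl⟩ := h.lists.exists ht
    exact Or.inr ⟨k, hk, rfl, h.idx hk⟩

variable (I)

/-- The entries of the array `d` are lengths of walks from the source. -/
def Walks (d : ℤ → ℤ) : Prop := ∀ v ∈ I.T', I.Walk ⊥ v (d (I.idx v))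

variable {I}

/-- Go from `t₀` to the last point by the arc of cost `n`, then down along order arcs of cost `0`.
Hence `n` is a legitimate start value and no infinite distances are needed. -/
theorem walk_top {t : WithBot ℝ} (ht : t ∈ I.T') (h : t ≠ ⊥) : I.Walk ⊥ t I.n := by
  induction hc : #I.T - #(I.T.filter fun s : ℝ => (s : WithBot ℝ) ≤ t) using
    Nat.strong_induction_on generalizing t with
  | _ k ih =>
    rcases I.mem_T'.1 ht with rfl | ⟨t, htT, rfl⟩
    · exact absurd rfl h
    · by_cases hu : ∃ u ∈ I.T, t < u
      · obtain ⟨u, hu, hmin⟩ := exists_min_image (I.T.filter fun u => t < u) id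
          (by obtain ⟨u, hu, h⟩ := hu; exact ⟨u, mem_filter.2 ⟨hu, h⟩⟩)
        rw [mem_filter] at hu
        have hp : I.prec u = t := by
          apply I.idx_injOn (I.prec_mem_T' u) ht
          rw [I.idx_prec, I.idx_coe]
          congr 3
          ext s
          simp only [mem_filter, and_congr_right_iff]
          refine fun hs => ⟨fun hsu => ?_, fun hst => hst.trans_lt hu.2⟩
          by_contra! hts
          exact (hmin s (mem_filter.2 ⟨hs, hts⟩)).not_gt hsu
        have hlt := I.idx_strictMonoOn ht (I.coe_mem_T' hu.1) (WithBot.coe_lt_coe.2 hu.2)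
        simp only [idx] at hlt
        have hle := card_filter_le I.T fun s : ℝ => (s : WithBot ℝ) ≤ u
        have hw := ih _ (by omega) (I.coe_mem_T' hu.1) WithBot.coe_ne_bot rfl
        have := hw.snoc (I.mem_arcs.2 (Or.inr (Or.inl ⟨u, hu.1, rfl⟩)))
        simpa [hp] using this
      · push Not at hu
        have hmax : I.T.max = t := by
          refine le_antisymm (Finset.max_le fun s hs => WithBot.coe_le_coe.2 (hu s hs))
            (I.le_max_T htT)
        have := (Walk.nil (I := I) ⊥).snoc (I.mem_arcs.2 (Or.inl rfl))
        simpa [hmax] using this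

theorem runs_startValues {s₀ : Store} (hL : I.Loaded s₀) (hP : I.HasPoints s₀) :
    Runs .startValues s₀ (#I.T * 11 + 9) fun s => I.Walks (s.iarr 1) ∧ s.iarr 1 (I.idx ⊥) ≤ 0 := by
  refine (Runs.seq_result (P := .iput 1 (.lit (-1)) (.lit 0)) rfl fun f₁ => Runs.each (K := 3)
    (N := #I.T) (fun k s => s.iarr 1 (-1) = 0 ∧ ∀ q < k, s.iarr 1 (q : ℕ) = I.n)
    (hP.frame f₁).card rfl rfl (by decide) (by simp [Program.result]) (by simp)
    fun k s hk hs f hI => ?_).mono ?_ fun s f h => ⟨fun v hv => ?_, by rw [idx_bot, h.1]⟩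
  · refine Program.runs_result _ rfl _ (by decide) ?_
    simp only [Program.result, IExp.eval, hs, Store.iput_iarr, if_true,
      ((hL.frame f₁).frame f).n]
    refine ⟨?_, fun q hq => ?_⟩
    · rw [Function.update_of_ne (by omega), hI.1]
    · by_cases hqk : q = k
      · rw [hqk, Function.update_self]
      · rw [Function.update_of_ne (by exact_mod_cast hqk)]
        exact hI.2 q (by omega)
  · simp only [Program.time, IExp.cost]
    linarith
  · rcases hP.idx_surj hv with ⟨rfl, hi⟩ | ⟨k, hk, rfl, hi⟩
    · rw [hi, h.1]
      exact .nil _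
    · rw [hi, h.2 k hk]
      exact walk_top hv WithBot.coe_ne_bot

theorem violated_holds {s : Store} {x e : ℕ} (hx : s.ivar x = e) :
    (Program.violated x).Holds s ↔
      s.iarr 1 (s.iarr 5 e) + s.iarr 7 e < s.iarr 1 (s.iarr 6 e) := by
  simp only [Program.violated, Test.Holds, IExp.eval, hx, not_le]

/-- Values are updated in place, so a tail may already have improved in the same round. Since values
only decrease, every arc is relaxed at least relative to the values at the start of the round. -/
theorem runs_relax {s₀ : Store} {E : ℕ} (hA : StoresArcs s₀ E (I.arcIdx '' I.arcs))
    (hW : I.Walks (s₀.iarr 1)) :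
    Runs .relax s₀ (E * 29 + 6) fun s => I.Walks (s.iarr 1) ∧
      (∀ z, s.iarr 1 z ≤ s₀.iarr 1 z) ∧
      ∀ a ∈ I.arcs, s.iarr 1 (I.idx a.2.1) ≤ s₀.iarr 1 (I.idx a.1) + a.2.2 := by
  refine (Runs.each (K := 21) (N := E) (fun k s => I.Walks (s.iarr 1) ∧
      (∀ z, s.iarr 1 z ≤ s₀.iarr 1 z) ∧ ∀ e < k, s.iarr 1 (s₀.iarr 6 (e : ℕ)) ≤
        s₀.iarr 1 (s₀.iarr 5 (e : ℕ)) + s₀.iarr 7 (e : ℕ))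
      hA.card rfl rfl (by decide) ⟨hW, by simp, by simp⟩ (by simp)
      fun k s hk hs f hI => ?_).mono (by linarith) fun s f h => ⟨h.1, h.2.1, fun a ha => ?_⟩
  · refine Program.runs_result _ rfl _ (by decide) ?_
    obtain ⟨hI1, hI2, hI3⟩ := hI
    obtain ⟨a, ha, hae⟩ := hA.mem hk
    simp only [arcIdx, Prod.ext_iff] at hae
    obtain ⟨ht, hh, hc⟩ := hae
    simp only [Program.result, violated_holds hs, f.iarr 5 rfl, f.iarr 6 rfl, f.iarr 7 rfl]
    have h0 := hI2 (s₀.iarr 5 k)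
    by_cases hv : s.iarr 1 (s₀.iarr 5 k) + s₀.iarr 7 k < s.iarr 1 (s₀.iarr 6 k)
    · simp only [hv, if_true, IExp.eval, hs, Store.iput_iarr, f.iarr 5 rfl, f.iarr 6 rfl,
        f.iarr 7 rfl]
      have hle : ∀ z, Function.update (s.iarr 1) (s₀.iarr 6 k)
          (s.iarr 1 (s₀.iarr 5 k) + s₀.iarr 7 k) z ≤ s.iarr 1 z := by
        intro z
        by_cases hz : z = s₀.iarr 6 k
        · rw [hz, Function.update_self]
          exact hv.le
        · rw [Function.update_of_ne hz]
      refine ⟨fun v hvT => ?_, fun z => (hle z).trans (hI2 z), fun e he => ?_⟩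
      · by_cases hz : I.idx v = s₀.iarr 6 k
        · have : v = a.2.1 := I.idx_injOn hvT (I.arcs_mem_T' ha).2 (hz.trans hh.symm)
          subst this
          rw [hz, Function.update_self, ← ht, ← hc]
          exact (hI1 _ (I.arcs_mem_T' ha).1).snoc ha
        · rw [Function.update_of_ne hz]
          exact hI1 v hvT
      · rcases Nat.lt_succ_iff_lt_or_eq.1 he with he | rfl
        · exact (hle _).trans (hI3 e he)
        · rw [Function.update_self]
          linarith
    · simp only [hv, if_false]
      refine ⟨hI1, hI2, fun e he => ?_⟩
      rcases Nat.lt_succ_iff_lt_or_eq.1 he with he | rfl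
      · exact hI3 e he
      · linarith
  · have : I.arcIdx a ∈ I.arcIdx '' I.arcs := ⟨a, ha, rfl⟩
    rw [hA.arc] at this
    obtain ⟨e, he, hae⟩ := this
    simp only [arcIdx, Prod.ext_iff] at hae
    rw [hae.1, hae.2.1, hae.2.2]
    exact h.2.2 e he

theorem runs_verdict {s₀ : Store} {E : ℕ} (hA : StoresArcs s₀ E (I.arcIdx '' I.arcs)) :
    Runs .verdict s₀ (E * 24 + 15) fun s =>
      s.ivar 2 = 1 ∧ (∀ a ∈ I.arcs, s₀.iarr 1 (I.idx a.2.1) ≤ s₀.iarr 1 (I.idx a.1) + a.2.2) ∨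
      s.ivar 2 = 0 ∧ ¬ ∀ a ∈ I.arcs, s₀.iarr 1 (I.idx a.2.1) ≤ s₀.iarr 1 (I.idx a.1) + a.2.2 := by
  refine (Runs.seq (Runs.count (N := E) (fun e : ℕ => s₀.iarr 1 (s₀.iarr 5 e) + s₀.iarr 7 e <
    s₀.iarr 1 (s₀.iarr 6 e)) hA.card (by decide) (by decide) (by decide)
    fun k s' hk hs' f' => ?_) fun s₁ f₁ h₁ =>
    Program.runs_result (K := 7) _ rfl s₁ (by decide) ?_).mono ?_ fun s f h => h
  · rw [violated_holds hs', f'.iarr 1 rfl, f'.iarr 5 rfl, f'.iarr 6 rfl, f'.iarr 7 rfl]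
  · have key : s₁.ivar 6 ≤ 0 ↔
        ∀ a ∈ I.arcs, s₀.iarr 1 (I.idx a.2.1) ≤ s₀.iarr 1 (I.idx a.1) + a.2.2 := by
      rw [h₁, Nat.cast_nonpos, card_eq_zero, filter_eq_empty_iff]
      simp only [mem_range, not_lt]
      constructor
      · intro h a ha
        have : I.arcIdx a ∈ I.arcIdx '' I.arcs := ⟨a, ha, rfl⟩
        rw [hA.arc] at this
        obtain ⟨e, he, hae⟩ := this
        simp only [arcIdx, Prod.ext_iff] at hae
        rw [hae.1, hae.2.1, hae.2.2]
        exact h he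
      · intro h e he
        obtain ⟨a, ha, hae⟩ := hA.mem he
        simp only [arcIdx, Prod.ext_iff] at hae
        have := h a ha
        rwa [hae.1, hae.2.1, hae.2.2] at this
    by_cases h : s₁.ivar 6 ≤ 0
    · exact Or.inl ⟨by simp [Program.result, h], key.1 h⟩
    · exact Or.inr ⟨by simp [Program.result, h], fun hh => h (key.2 hh)⟩
  · simp only [Program.violated, Test.cost, IExp.cost]
    linarith

theorem Walks.isDistance {d : ℤ → ℤ} (hW : I.Walks d) (hb : d (I.idx ⊥) ≤ 0)
    (h : ∀ a ∈ I.arcs, d (I.idx a.2.1) ≤ d (I.idx a.1) + a.2.2) :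
    I.IsDistance fun v => d (I.idx v) := by
  refine isDistance_of_potential (le_antisymm hb ?_) h hW
  have := (hW ⊥ I.bot_mem_T').potential_le (y := fun v => (d (I.idx v) : ℝ))
    fun a ha => by exact_mod_cast h a ha
  have h2 : d (I.idx ⊥) ≤ d (I.idx ⊥) + d (I.idx ⊥) := by exact_mod_cast this
  omega

theorem card_T' : #I.T' = #I.T + 1 := by
  rw [T', card_insert_of_notMem (by simp), card_image_of_injective _ WithBot.coe_injective]

/-- The progress invariant is conditional on the existence of distances, so a single loop proof
covers feasible and infeasible instances. Only `t₀` is known to be correct at first, and `#T` rounds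
suffice for the `#T + 1` points. -/
theorem runs_bellmanFord {s₀ : Store} (hL : I.Loaded s₀) (hP : I.HasPoints s₀) {E : ℕ}
    (hA : StoresArcs s₀ E (I.arcIdx '' I.arcs)) :
    Runs .bellmanFord s₀ (#I.T * (E * 29 + 25) + E * 24 + 30) fun s =>
      s.ivar 2 = 1 ∧ I.IsDistance (fun v => s.iarr 1 (I.idx v)) ∨
      s.ivar 2 = 0 ∧ ¬ ∃ y, I.LPFeasible y := by
  refine (Runs.seq (runs_startValues hL hP) fun s₁ f₁ h₁ => Runs.seq
    (Runs.each (K := E * 29 + 6) (N := #I.T) (fun k s => I.Walks (s.iarr 1) ∧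
      s.iarr 1 (I.idx ⊥) ≤ 0 ∧ ∀ δ, I.IsDistance δ →
        k + 1 ≤ #{v ∈ I.T' | s.iarr 1 (I.idx v) ≤ δ v})
      (hP.frame f₁).card rfl rfl (by decide) ⟨h₁.1, h₁.2, fun δ hδ => ?_⟩ (fun _ _ _ h => h)
      fun k s hk hs f hI => ?_) fun s₂ f₂ h₂ => (runs_verdict ((hA.frame f₁).frame f₂)).mono
      le_rfl fun s f h => ?_).mono ?_ fun s f h => h
  · refine card_pos.2 ⟨⊥, mem_filter.2 ⟨I.bot_mem_T', ?_⟩⟩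
    rw [hδ.bot_eq]
    exact h₁.2
  · obtain ⟨hW, hb, hI⟩ := hI
    refine (runs_relax ((hA.frame f₁).frame f) hW).mono le_rfl fun s' _ h =>
      ⟨h.1, (h.2.1 _).trans hb, fun δ hδ => ?_⟩
    refine hδ.card_lt_of_relaxed (y := fun v => s.iarr 1 (I.idx v))
      (y' := fun v => s'.iarr 1 (I.idx v)) hb (fun v _ => h.2.1 _) h.2.2 (hI δ hδ) ?_
    rw [card_T']
    omega
  · obtain ⟨hW, hb, hI⟩ := h₂
    have e1 : s.iarr 1 = s₂.iarr 1 := f.iarr 1 rfl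
    refine h.imp (fun h => ⟨h.1, ?_⟩) fun h => ⟨h.1, ?_⟩
    · rw [e1]
      exact hW.isDistance hb h.2
    · rintro ⟨y, hy⟩
      -- If the program were feasible, distances would exist and by now all entries would equal
      -- them; then no arc could be violated.
      obtain ⟨δ, hδ⟩ := hy.exists_isDistance fun v hv => ⟨_, hW v hv⟩
      refine h.2 fun a ha => ?_
      have hall := filter_card_eq (le_antisymm (card_filter_le _ _) (by
        rw [card_T']; exact hI δ hδ))
      have heq : ∀ v ∈ I.T', s₂.iarr 1 (I.idx v) = δ v := fun v hv =>
        le_antisymm (hall v hv) ((hδ v hv).2 (hW v hv))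
      rw [heq _ (I.arcs_mem_T' ha).1, heq _ (I.arcs_mem_T' ha).2]
      exact hδ.arc_le ha
  · linarith

theorem runs_solve {s₀ : Store} (hL : I.Loaded s₀) (hC : I.StoresC s₀) (hn : 0 < I.n) :
    Runs .solve s₀ (1000 * I.n ^ 4) fun s => I.HasPoints s ∧
      (s.ivar 2 = 1 ∧ I.IsDistance (fun v => s.iarr 1 (I.idx v)) ∨
      s.ivar 2 = 0 ∧ ¬ ∃ y, I.LPFeasible y) := by
  have hT := I.card_T_le
  have hn2 : I.n ≤ I.n ^ 2 := Nat.le_self_pow (by decide) _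
  have h4 : I.n ^ 4 = I.n ^ 2 * I.n ^ 2 := by ring
  have h24 : I.n ^ 2 ≤ I.n ^ 2 * I.n ^ 2 := Nat.le_mul_self _
  have hE : ∀ E, E ≤ 1 + 2 * #I.T + I.n ^ 2 → #I.T * (E * 29 + 25) + E * 24 + 30 ≤
      300 * I.n ^ 4 := by
    intro E hE
    calc #I.T * (E * 29 + 25) + E * 24 + 30
        ≤ I.n ^ 2 * ((4 * I.n ^ 2) * 29 + 25) + (4 * I.n ^ 2) * 24 + 30 := by
          have : E ≤ 4 * I.n ^ 2 := by omega
          gcongr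
      _ ≤ 300 * I.n ^ 4 := by rw [h4]; linarith
  refine (Runs.seq (runs_collect hL) fun s₁ f₁ h₁ => Runs.seq (runs_sort h₁.1 h₁.2)
    fun s₂ f₂ h₂ => Runs.seq (runs_graph ((hL.frame f₁).frame f₂) h₂ ?_) fun s₃ f₃ h₃ =>
    Runs.mono (K := 300 * I.n ^ 4) (Q := fun s => I.HasPoints s ∧
      (s.ivar 2 = 1 ∧ I.IsDistance (fun v => s.iarr 1 (I.idx v)) ∨
      s.ivar 2 = 0 ∧ ¬ ∃ y, I.LPFeasible y)) ?_ le_rfl fun s f h => h).mono ?_ fun s f h => h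
  · intro i j
    rw [f₂.iarr 0 rfl, f₁.iarr 0 rfl]
    exact hC i j
  · obtain ⟨E, hE', hA⟩ := h₃
    have hL₃ := ((hL.frame f₁).frame f₂).frame f₃
    have hP₃ := h₂.frame f₃
    exact (runs_bellmanFord hL₃ hP₃ hA).mono (hE E hE') fun s f h => ⟨hP₃.frame f, h⟩
  · calc _ ≤ I.n * (I.n * (I.n ^ 2 * 22 + 31) + 17) + 8 + (I.n ^ 2 * (I.n ^ 2 * 19 + 21) + 6 +
          (I.n ^ 2 * (I.n ^ 2 * 18 + 60) +
          I.n * (I.n * (I.n ^ 2 * 17 + 53) + I.n ^ 2 * 18 + 40) + 31 + 300 * I.n ^ 4)) := by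
          gcongr
      _ ≤ 1000 * I.n ^ 4 := by
          have h3 : I.n * I.n ^ 2 ≤ I.n ^ 2 * I.n ^ 2 := Nat.mul_le_mul_right _ hn2
          rw [h4]
          nlinarith

end JobInstance

/-! ### Assigning the jobs -/

namespace Program

/-- Find an unassigned job that is released at the time in register `1`, of smallest deadline. -/
def select : Program :=
  seq (iset 10 (.lit (-1))) (each 9 0 (branch (.conj (.conj (.ile (.arr 8 (.var 9)) (.lit 0))
      (.tle (.arr 0 (.var 9)) (.var 1)))
    (.neg (.conj (.ile (.lit 0) (.var 10)) (.tle (.arr 1 (.var 10)) (.arr 1 (.var 9))))))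
    (iset 10 (.var 9)) nop))

/-- Write the start time and the machine of the selected job, and advance the machine. -/
def record : Program :=
  seq (tput 3 (.var 10) (.var 1)) (seq (iput 2 (.var 10) (.var 11)) (seq (iput 8 (.var 10) (.lit 1))
    (seq (iset 11 (.add (.var 11) (.lit 1)))
    (branch (.ile (.var 1) (.var 11)) (iset 11 (.lit 0)) nop))))

/-- Fill a slot. -/
def slot : Program :=
  seq (count 6 5 3 (.ile (.arr 1 (.var 5)) (.var 4))) (seq (tset 1 (.arr 2 (.var 6)))
    (seq select record))

/-- The earliest due date assignment. -/
def assign : Program :=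
  branch (.ile (.lit 1) (.var 2)) (seq (iset 11 (.lit 0)) (each 4 0 slot)) nop

end Program

namespace JobInstance

variable {I : JobInstance}

/-- Without machines the load constraints leave no slots. Positivity is needed to choose machines
modulo `m`. -/
theorem LPFeasible.m_pos {y : WithBot ℝ → ℝ} (h : I.LPFeasible y) (hn : 0 < I.n) : 0 < I.m := by
  by_contra! hm
  have hm0 : (I.m : ℝ) = 0 := by exact_mod_cast Nat.le_zero.1 hm
  have hmax := h.max_eq hn
  rw [I.max_eq_sum y, h.source, zero_add, sum_eq_zero] at hmax
  · exact hn.ne (by exact_mod_cast hmax)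
  · intro t ht
    have h1 := h.load t ht
    have h2 := h.mono (I.coe_mem_T' ht) (I.prec_mem_T' (t + I.p))
      ((I.coe_le_prec ht).2 (by linarith [I.p_pos]))
    have h3 := h.increment_nonneg ht
    linarith

/-- The slots of a skeleton, from left to right. -/
theorem LPFeasible.exists_slots {y : WithBot ℝ → ℤ} (h : I.LPFeasible fun t => (y t : ℝ))
    (hn : 0 < I.n) :
    ∃ σ : ℕ → ℝ, ∀ k < I.n, σ k ∈ I.T ∧ ∀ t ∈ I.T, y t ≤ k ↔ t < σ k := by
  have key : ∀ k : ℕ, ∃ s : ℝ, k < I.n → s ∈ I.T ∧ ∀ t ∈ I.T, y t ≤ k ↔ t < s := by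
    intro k
    by_cases hk : k < I.n
    · obtain ⟨τ, hτT, hτ⟩ := exists_max hn
      have hmax := h.max_eq hn
      rw [hτ] at hmax
      have hmax' : y τ = I.n := by exact_mod_cast hmax
      -- Slot `k` starts at the first point up to which more than `k` slots have started. Its index
      -- is the number of points with `y t ≤ k`, which the program can count.
      obtain ⟨s, hs, hmin⟩ := exists_min_image (I.T.filter fun t : ℝ => (k : ℤ) < y t) id
        ⟨τ, mem_filter.2 ⟨hτT, by omega⟩⟩
      rw [mem_filter] at hs
      refine ⟨s, fun _ => ⟨hs.1, fun t ht => ⟨fun htk => ?_, fun hts => ?_⟩⟩⟩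
      · by_contra! hst
        have h1 := h.mono (I.coe_mem_T' hs.1) (I.coe_mem_T' ht) (WithBot.coe_le_coe.2 hst)
        have h2 : y s ≤ y t := by exact_mod_cast h1
        omega
      · by_contra! hlt
        exact (hmin t (mem_filter.2 ⟨ht, hlt⟩)).not_gt hts
    · exact ⟨0, fun h' => absurd h' hk⟩
  choose σ hσ using key
  exact ⟨σ, hσ⟩

theorem slots_mono {y : WithBot ℝ → ℤ} {σ : ℕ → ℝ}
    (hσ : ∀ k < I.n, σ k ∈ I.T ∧ ∀ t ∈ I.T, y t ≤ k ↔ t < σ k) {k l : ℕ} (hl : l < I.n)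
    (hkl : k ≤ l) : σ k ≤ σ l := by
  by_contra! hlt
  have hk := hσ k (hkl.trans_lt hl)
  have h1 := (hk.2 _ (hσ l hl).1).2 hlt
  exact lt_irrefl _ (((hσ l hl).2 _ (hσ l hl).1).1 (h1.trans (by exact_mod_cast hkl)))

/-- The slots starting at `t` are the numbers `k` with `y (prec t) ≤ k < y t`. -/
theorem card_slots {y : WithBot ℝ → ℤ} (h : I.LPFeasible fun t => (y t : ℝ)) (hn : 0 < I.n)
    {σ : ℕ → ℝ} (hσ : ∀ k < I.n, σ k ∈ I.T ∧ ∀ t ∈ I.T, y t ≤ k ↔ t < σ k) {t : ℝ}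
    (ht : t ∈ I.T) : (#{k : Fin I.n | σ k = t} : ℤ) = y t - y (I.prec t) := by
  have h0 : 0 ≤ y (I.prec t) := by
    have := h.mono I.bot_mem_T' (I.prec_mem_T' t) bot_le
    rw [h.source] at this
    exact_mod_cast this
  have h1 : y (I.prec t) ≤ y t := by exact_mod_cast sub_nonneg.1 (h.increment_nonneg ht)
  have h2 : y t ≤ I.n := by
    have := h.mono (I.coe_mem_T' ht) I.max_mem_T' (I.le_max_T ht)
    rw [h.max_eq hn] at this
    exact_mod_cast this
  have h3 : ∀ k : ℕ, k < I.n → (σ k = t ↔ (y (I.prec t)).toNat ≤ k ∧ k < (y t).toNat) := by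
    intro k hk
    have e1 : (k : ℤ) < y t ↔ σ k ≤ t := by
      rw [← not_le, (hσ k hk).2 t ht, not_lt]
    have e2 : y (I.prec t) ≤ k ↔ t ≤ σ k := by
      rcases I.mem_T'.1 (I.prec_mem_T' t) with hb | ⟨q, hq, hqt⟩
      · have hy0 : y ⊥ = 0 := by exact_mod_cast h.source
        rw [hb, hy0]
        refine iff_of_true (by omega) ?_
        by_contra! hlt
        have := (I.coe_le_prec (hσ k hk).1).2 hlt
        rw [hb] at this
        simp at this
      · rw [← hqt, (hσ k hk).2 q hq]
        constructor
        · intro hlt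
          by_contra! hlt'
          have := (I.coe_le_prec (hσ k hk).1).2 hlt'
          rw [← hqt, WithBot.coe_le_coe] at this
          exact this.not_gt hlt
        · exact fun hle => ((I.coe_le_prec hq).1 hqt.le).trans_le hle
    rw [show (y (I.prec t)).toNat ≤ k ↔ y (I.prec t) ≤ k by omega, e2,
      show k < (y t).toNat ↔ (k : ℤ) < y t by omega, e1, and_comm]
    exact le_antisymm_iff
  have h4 : #{k : Fin I.n | σ k = t} = #(Ico (y (I.prec t)).toNat (y t).toNat) := by
    rw [← card_filter_range fun k => σ k = t]
    congr 1
    ext k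
    simp only [mem_filter, mem_range, mem_Ico]
    constructor
    · rintro ⟨hk, hk'⟩
      exact (h3 k hk).1 hk'
    · intro hk
      have hkn : k < I.n := by omega
      exact ⟨hkn, (h3 k hkn).2 hk⟩
  rw [h4, Nat.card_Ico]
  omega

theorem runs_select {s₀ : Store} (hL : I.Loaded s₀) {U : Finset (Fin I.n)}
    (hU : ∀ j : Fin I.n, s₀.iarr 8 (j : ℕ) ≤ 0 ↔ j ∈ U) {x : ℝ} (hx : s₀.tvar 1 = x)
    (hne : ∃ j ∈ U, I.r j ≤ x) :
    Runs .select s₀ (I.n * 31 + 8) fun s => ∃ j ∈ U, s.ivar 10 = (j : ℕ) ∧ I.r j ≤ x ∧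
      ∀ l ∈ U, I.r l ≤ x → I.D j ≤ I.D l := by
  refine (Runs.seq_result (P := .iset 10 (.lit (-1))) rfl fun f₁ => Runs.each (K := 23) (N := I.n)
    (fun k s => (s.ivar 10 = -1 ∧ ∀ l ∈ U, (l : ℕ) < k → ¬ I.r l ≤ x) ∨
      ∃ j ∈ U, s.ivar 10 = (j : ℕ) ∧ I.r j ≤ x ∧
        ∀ l ∈ U, (l : ℕ) < k → I.r l ≤ x → I.D j ≤ I.D l)
    (hL.frame f₁).n rfl rfl (by decide) (Or.inl ⟨by simp [Program.result], by simp⟩)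
    (fun i s v h => by simpa using h) fun k s hk hs f hI => ?_).mono ?_ fun s f h => ?_
  · refine Program.runs_result _ rfl _ (by decide) ?_
    have hLs := (hL.frame f₁).frame f
    have hUk : s.iarr 8 (k : ℕ) ≤ 0 ↔ (⟨k, hk⟩ : Fin I.n) ∈ U := by
      rw [f.iarr 8 rfl, f₁.iarr 8 rfl]
      exact hU ⟨k, hk⟩
    have hxs : s.tvar 1 = x := by rw [f.tvar 1 rfl, f₁.tvar 1 rfl, hx]
    have hlt : ∀ l : Fin I.n, (l : ℕ) < k + 1 → (l : ℕ) < k ∨ l = ⟨k, hk⟩ := fun l hl =>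
      (Nat.lt_succ_iff_lt_or_eq.1 hl).imp_right fun h => Fin.ext h
    simp only [Program.result, Test.Holds, IExp.eval, TExp.eval, hs, hUk, hxs, hLs.r, hLs.D,
      toArray_of_lt I.r hk, toArray_of_lt I.D hk]
    rcases hI with ⟨h10, hI⟩ | ⟨j, hj, h10, hjx, hI⟩
    · simp only [h10, show ¬ (0 : ℤ) ≤ -1 by decide, false_and, not_false_eq_true, and_true]
      by_cases hc : (⟨k, hk⟩ : Fin I.n) ∈ U ∧ I.r ⟨k, hk⟩ ≤ x
      · rw [if_pos hc]
        refine Or.inr ⟨⟨k, hk⟩, hc.1, by simp, hc.2, fun l hl hlk hlx => ?_⟩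
        rcases hlt l hlk with h | rfl
        · exact absurd hlx (hI l hl h)
        · exact le_rfl
      · rw [if_neg hc]
        refine Or.inl ⟨h10, fun l hl hlk hlx => ?_⟩
        rcases hlt l hlk with h | rfl
        · exact hI l hl h hlx
        · exact hc ⟨hl, hlx⟩
    · simp only [h10, Int.natCast_nonneg, true_and, toArray_coe, not_le]
      by_cases hc : ((⟨k, hk⟩ : Fin I.n) ∈ U ∧ I.r ⟨k, hk⟩ ≤ x) ∧ I.D ⟨k, hk⟩ < I.D j
      · rw [if_pos hc]
        refine Or.inr ⟨⟨k, hk⟩, hc.1.1, by simp, hc.1.2, fun l hl hlk hlx => ?_⟩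
        rcases hlt l hlk with h | rfl
        · exact hc.2.le.trans (hI l hl h hlx)
        · exact le_rfl
      · rw [if_neg hc]
        refine Or.inr ⟨j, hj, h10, hjx, fun l hl hlk hlx => ?_⟩
        rcases hlt l hlk with h | rfl
        · exact hI l hl h hlx
        · by_contra! hlt
          exact hc ⟨⟨hl, hlx⟩, hlt⟩
  · simp only [Program.time, IExp.cost]
    linarith
  · rcases h with ⟨-, h⟩ | ⟨j, hj, h10, hjx, h⟩
    · obtain ⟨j, hj, hjx⟩ := hne
      exact absurd hjx (h j hj j.2)
    · exact ⟨j, hj, h10, hjx, fun l hl => h l hl l.2⟩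

variable (I) in
/-- The first `q` slots of `σ` are filled with the jobs `π 0, π 1, …` by earliest due date. -/
structure Filled (σ : ℕ → ℝ) (q : ℕ) (π : ℕ → Fin I.n) (s : Store) : Prop where
  inj : ∀ k < q, ∀ l < q, π k = π l → k = l
  free : ∀ j : Fin I.n, s.iarr 8 (j : ℕ) ≤ 0 ↔ ∀ l < q, π l ≠ j
  release : ∀ k < q, I.r (π k) ≤ σ k
  edd : ∀ k < q, ∀ j, (∀ l < k, π l ≠ j) → I.r j ≤ σ k → I.D (π k) ≤ I.D j
  start : ∀ k < q, s.tarr 3 ((π k : ℕ) : ℤ) = σ k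
  machine : ∀ k < q, s.iarr 2 ((π k : ℕ) : ℤ) = ((k % I.m : ℕ) : ℤ)
  next : s.ivar 11 = ((q % I.m : ℕ) : ℤ)

/-- Pigeonhole: `q` slots use up at most `q` of the released jobs. -/
theorem exists_free {q : ℕ} {π : ℕ → Fin I.n} {x : ℝ}
    (hq : q < #{j : Fin I.n | I.r j ≤ x}) :
    ∃ j ∈ ({j | ∀ l < q, π l ≠ j} : Finset (Fin I.n)), I.r j ≤ x := by
  obtain ⟨j, hj, hjq⟩ := exists_mem_notMem_of_card_lt_card
    ((card_image_le (s := range q) (f := π)).trans_lt (by simpa using hq))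
  refine ⟨j, mem_filter.2 ⟨mem_univ _, fun l hl h => hjq ?_⟩, (mem_filter.1 hj).2⟩
  exact mem_image.2 ⟨l, mem_range.2 hl, h⟩

theorem Filled.runs_record {σ : ℕ → ℝ} {q : ℕ} {π : ℕ → Fin I.n} {s : Store}
    (h : I.Filled σ q π s) (hL : I.Loaded s) (hm : 0 < I.m) {j : Fin I.n}
    (hj : ∀ l < q, π l ≠ j) (h10 : s.ivar 10 = (j : ℕ)) (h1 : s.tvar 1 = σ q) (hr : I.r j ≤ σ q)
    (hD : ∀ l, (∀ k < q, π k ≠ l) → I.r l ≤ σ q → I.D j ≤ I.D l) :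
    Runs .record s 21 (I.Filled σ (q + 1) (Function.update π q j)) := by
  have hne : ∀ l < q, Function.update π q j l = π l := fun l hl =>
    Function.update_of_ne hl.ne _ _
  have hlt : ∀ l < q + 1, l < q ∨ l = q := fun l hl => Nat.lt_succ_iff_lt_or_eq.1 hl
  have hjz : ∀ l < q, ((π l : ℕ) : ℤ) ≠ (j : ℕ) := fun l hl h' =>
    hj l hl (Fin.ext (by exact_mod_cast h'))
  have hres : (Program.result .record s).tarr 3 = Function.update (s.tarr 3) (j : ℕ) (σ q) ∧
      (Program.result .record s).iarr 2 =
        Function.update (s.iarr 2) (j : ℕ) ((q % I.m : ℕ) : ℤ) ∧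
      (Program.result .record s).iarr 8 = Function.update (s.iarr 8) (j : ℕ) 1 ∧
      (Program.result .record s).ivar 11 = (((q + 1) % I.m : ℕ) : ℤ) := by
    -- The machine counter is increased and reset to `0` on reaching `m`, which realizes the residue
    -- without division.
    have hmod := Nat.mod_add_mod q I.m 1
    have hq := Nat.mod_lt q hm
    by_cases hc : I.m ≤ q % I.m + 1
    · have hc' : (I.m : ℤ) ≤ (q : ℤ) % I.m + 1 := by exact_mod_cast hc
      have : (q + 1) % I.m = 0 := by
        rw [← hmod, show q % I.m + 1 = I.m by omega, Nat.mod_self]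
      simp only [Program.record, Program.result, Test.Holds, IExp.eval, TExp.eval, Store.iput_ivar,
        Store.tput_ivar, Store.iset_ivar, h.next, h10, h1, hL.m, this]
      norm_num
      simp [hc']
    · have hc' : ¬ (I.m : ℤ) ≤ (q : ℤ) % I.m + 1 := by exact_mod_cast hc
      have : (q + 1) % I.m = q % I.m + 1 := by
        rw [← hmod, Nat.mod_eq_of_lt (by omega)]
      simp only [Program.record, Program.result, Test.Holds, IExp.eval, TExp.eval, Store.iput_ivar,
        Store.tput_ivar, Store.iset_ivar, h.next, h10, h1, hL.m, this]
      norm_num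
      simp [hc']
  obtain ⟨e1, e2, e3, e4⟩ := hres
  refine Program.runs_result _ rfl _ (by decide) ⟨fun k hk l hl hkl => ?_, fun l => ?_,
    fun k hk => ?_, fun k hk l hl hlr => ?_, fun k hk => ?_, fun k hk => ?_, e4⟩
  · rcases hlt k hk with hk | rfl <;> rcases hlt l hl with hl | rfl
    · rw [hne k hk, hne l hl] at hkl
      exact h.inj k hk l hl hkl
    · rw [hne k hk, Function.update_self] at hkl
      exact absurd hkl (hj k hk)
    · rw [hne l hl, Function.update_self] at hkl
      exact absurd hkl.symm (hj l hl)
    · rfl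
  · rw [e3]
    by_cases hlj : l = j
    · subst hlj
      rw [Function.update_self]
      exact iff_of_false (by decide) fun hh => hh q (by omega) (Function.update_self _ _ _)
    · rw [Function.update_of_ne (fun h' => hlj (Fin.ext (by exact_mod_cast h'))), h.free]
      constructor
      · intro hh k hk
        rcases hlt k hk with hk | rfl
        · rw [hne k hk]
          exact hh k hk
        · rw [Function.update_self]
          exact Ne.symm hlj
      · intro hh k hk
        rw [← hne k hk]
        exact hh k (by omega)
  · rcases hlt k hk with hk | rfl
    · rw [hne k hk]
      exact h.release k hk
    · rwa [Function.update_self]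
  · rcases hlt k hk with hk | rfl
    · rw [hne k hk]
      exact h.edd k hk l (fun i hi => hne i (hi.trans hk) ▸ hl i hi) hlr
    · rw [Function.update_self]
      exact hD l (fun i hi => hne i hi ▸ hl i hi) hlr
  · rw [e1]
    rcases hlt k hk with hk | rfl
    · rw [hne k hk, Function.update_of_ne (hjz k hk)]
      exact h.start k hk
    · rw [Function.update_self, Function.update_self]
  · rw [e2]
    rcases hlt k hk with hk | rfl
    · rw [hne k hk, Function.update_of_ne (hjz k hk)]
      exact h.machine k hk
    · rw [Function.update_self, Function.update_self]

theorem Filled.exists_isEDD {σ : ℕ → ℝ} {π : ℕ → Fin I.n} {s : Store}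
    (h : I.Filled σ I.n π s) (hm : 0 < I.m) {y : WithBot ℝ → ℤ} (hn : 0 < I.n)
    (hy : I.LPFeasible fun t => (y t : ℝ))
    (hσ : ∀ k < I.n, σ k ∈ I.T ∧ ∀ t ∈ I.T, y t ≤ k ↔ t < σ k) :
    ∃ S : I.Schedule, S.StoredIn s ∧ S.IsEDD y := by
  have hinj : Function.Injective fun k : Fin I.n => π k := fun k l hkl =>
    Fin.ext (h.inj k k.2 l l.2 hkl)
  let e : Equiv.Perm (Fin I.n) := Equiv.ofBijective _ (Finite.injective_iff_bijective.1 hinj)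
  have he : ∀ k : Fin I.n, e k = π k := fun k => rfl
  have he' : ∀ j : Fin I.n, π (e.symm j) = j := fun j => e.apply_symm_apply j
  refine ⟨⟨fun j => σ (e.symm j), fun j => ⟨(e.symm j : ℕ) % I.m, Nat.mod_lt _ hm⟩⟩,
    fun j => ⟨?_, ?_⟩, fun k => σ k, e, fun k l hkl => slots_mono hσ l.2 hkl,
    fun k => (hσ k k.2).1, fun t ht => card_slots hy hn hσ ht, fun k => ⟨h.release k k.2,
    fun l hkl hl => h.edd k k.2 (π l) (fun i hi hil => ?_) hl, by simp, by simp⟩⟩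
  · have := h.start (e.symm j) (e.symm j).2
    rwa [he'] at this
  · have := h.machine (e.symm j) (e.symm j).2
    rwa [he'] at this
  · have := h.inj i (by omega) l l.2 hil
    omega

theorem runs_slot {s₀ : Store} (hL : I.Loaded s₀) (hP : I.HasPoints s₀) {y : WithBot ℝ → ℤ}
    (hy : I.LPFeasible fun t => (y t : ℝ)) (hn : 0 < I.n)
    (hs : ∀ v, s₀.iarr 1 (I.idx v) = y v) {σ : ℕ → ℝ}
    (hσ : ∀ k < I.n, σ k ∈ I.T ∧ ∀ t ∈ I.T, y t ≤ k ↔ t < σ k) {q : ℕ} (hq : q < I.n)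
    (h4 : s₀.ivar 4 = q) {π : ℕ → Fin I.n} (hF : I.Filled σ q π s₀) :
    Runs .slot s₀ (#I.T * 17 + I.n * 31 + 40) fun s => ∃ π, I.Filled σ (q + 1) π s := by
  have hfree : ∃ j ∈ ({j | ∀ l < q, π l ≠ j} : Finset (Fin I.n)), I.r j ≤ σ q := by
    refine exists_free ?_
    have h1 := hy.le_card_released hn (hσ q hq).1
    have h2 : y (σ q) ≤ #{j : Fin I.n | I.r j ≤ σ q} := by exact_mod_cast h1
    -- At its own start, slot `q` is already counted: `y (σ q) > q`. Hence more than `q` jobs are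
    -- released there.
    have h3 := ((hσ q hq).2 _ (hσ q hq).1).not.2 (lt_irrefl _)
    omega
  refine (Runs.seq (Runs.count (N := #I.T) (fun k => y (s₀.tarr 2 k : ℝ) ≤ q) hP.card (by decide)
    (by decide) (by decide) fun k s hk hs' f => ?_) fun s₁ f₁ h₁ =>
    Runs.seq_result (P := .tset 1 (.arr 2 (.var 6))) rfl fun f₂ => Runs.seq (runs_select
      (U := {j | ∀ l < q, π l ≠ j}) (x := σ q) ((hL.frame f₁).frame f₂) (fun j => ?_) ?_ hfree)
      fun s₃ f₃ h₃ => Runs.mono (K := 21) (Q := fun s => ∃ π, I.Filled σ (q + 1) π s) ?_ le_rfl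
      fun s f h => h).mono ?_ fun s f h => h
  · simp only [Test.Holds, IExp.eval, hs', f.iarr 1 rfl, f.ivar 4 rfl, h4]
    rw [← hs, hP.idx hk]
  · rw [f₂.iarr 8 rfl, f₁.iarr 8 rfl, hF.free]
    simp
  · obtain ⟨z, hz, hzq⟩ := hP.lists.exists (hσ q hq).1
    rw [hP.lists.card_filter fun t => y t ≤ q, filter_congr (hσ q hq).2, ← hzq,
      hP.card_lt hz] at h₁
    simp [Program.result, h₁, f₁.tarr 2 rfl, hzq]
  · obtain ⟨j, hj, h10, hr, hD⟩ := h₃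
    have hF₃ : I.Filled σ q π s₃ :=
      { inj := hF.inj
        free := by rw [f₃.iarr 8 rfl, f₂.iarr 8 rfl, f₁.iarr 8 rfl]; exact hF.free
        release := hF.release
        edd := hF.edd
        start := by rw [f₃.tarr 3 rfl, f₂.tarr 3 rfl, f₁.tarr 3 rfl]; exact hF.start
        machine := by rw [f₃.iarr 2 rfl, f₂.iarr 2 rfl, f₁.iarr 2 rfl]; exact hF.machine
        next := by rw [f₃.ivar 11 rfl, f₂.ivar 11 rfl, f₁.ivar 11 rfl]; exact hF.next }
    refine (hF₃.runs_record (((hL.frame f₁).frame f₂).frame f₃) (hy.m_pos hn)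
      (by simpa using hj) h10 ?_ hr fun l hl => hD l (by simpa using hl)).mono le_rfl
      fun s _ h => ⟨_, h⟩
    obtain ⟨z, hz, hzq⟩ := hP.lists.exists (hσ q hq).1
    rw [hP.lists.card_filter fun t => y t ≤ q, filter_congr (hσ q hq).2, ← hzq,
      hP.card_lt hz] at h₁
    rw [f₃.tvar 1 rfl]
    simp [Program.result, h₁, f₁.tarr 2 rfl, hzq]
  · simp only [Test.cost, Program.time, IExp.cost, TExp.cost]
    linarith

theorem runs_assign {s₀ : Store} (hL : I.Loaded s₀) (hP : I.HasPoints s₀) (hn : 0 < I.n)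
    (h2 : s₀.ivar 2 = 1) (h8 : s₀.iarr 8 = fun _ => 0) {y : WithBot ℝ → ℤ}
    (hy : I.LPFeasible fun t => (y t : ℝ)) (hs : ∀ v, s₀.iarr 1 (I.idx v) = y v) :
    Runs .assign s₀ (200 * I.n ^ 4) fun s => ∃ S : I.Schedule, S.StoredIn s ∧ S.IsEDD y := by
  obtain ⟨σ, hσ⟩ := hy.exists_slots hn
  refine (Runs.branch (K := I.n * (#I.T * 17 + I.n * 31 + 48) + 8) (fun _ =>
    (Runs.seq_result (P := .iset 11 (.lit 0)) rfl fun f₁ => Runs.each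
      (K := #I.T * 17 + I.n * 31 + 40) (N := I.n) (fun q s => ∃ π, I.Filled σ q π s)
      (hL.frame f₁).n rfl rfl (by decide) ?_ (fun i s v h => ?_) fun q s hq h4 f h => ?_).mono
      (by simp only [Program.time, IExp.cost]; linarith) fun s f h => h) fun h => ?_).mono ?_
      fun s f h => ?_
  -- Any `π` will do before the first slot. The zero array `8` marks all jobs as free.
  · exact ⟨fun _ => ⟨0, hn⟩, by simp, by simp [Program.result, h8], by simp, by simp, by simp,
      by simp, by simp [Program.result]⟩
  · obtain ⟨π, h⟩ := h
    exact ⟨π, h.inj, h.free, h.release, h.edd, h.start, h.machine, by simpa using h.next⟩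
  · obtain ⟨π, h⟩ := h
    exact runs_slot ((hL.frame f₁).frame f) ((hP.frame f₁).frame f) hy hn
      (by rw [f.iarr 1 rfl, f₁.iarr 1 rfl]; exact hs) hσ hq h4 h
  · simp [h2] at h
  · have hT := I.card_T_le
    have hn2 : I.n ≤ I.n ^ 2 := Nat.le_self_pow (by decide) _
    have h4 : I.n ^ 4 = I.n ^ 2 * I.n ^ 2 := by ring
    have h24 : I.n ^ 2 ≤ I.n ^ 2 * I.n ^ 2 := Nat.le_mul_self _
    simp only [Test.cost, IExp.cost]
    calc _ ≤ 1 + 1 + 1 + (I.n ^ 2 * (I.n ^ 2 * 17 + I.n ^ 2 * 31 + 48) + 8) := by gcongr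
      _ ≤ 200 * I.n ^ 4 := by
        rw [h4]
        nlinarith
  · obtain ⟨π, h⟩ := h
    exact h.exists_isEDD (hy.m_pos hn) hn hy hσ

theorem HasPoints.storesSkeleton {I : JobInstance} {s : Store} (h : I.HasPoints s) :
    I.StoresSkeleton s fun v => s.iarr 1 (I.idx v) := by
  refine ⟨h.card, fun k => ⟨h.point k, ?_⟩⟩
  have := h.idx k.2
  rw [h.point k] at this
  simp only [this]

end JobInstance

end EqualLengthJobs

theorem mainTheorem5 :
    ∃ (P₁ P₂ P₃ : Program) (C : ℕ), ∀ I : JobInstance, 0 < I.n →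
      I.T.card ≤ I.n ^ 2 ∧
      ∃ (s₁ s₂ s₃ : Store) (k₁ k₂ k₃ : ℕ),
        -- one run of the program `P₁; P₂; P₃` on the instance, in time `O(n ^ 4)`
        Exec P₁ I.input s₁ k₁ ∧ Exec P₂ s₁ s₂ k₂ ∧ Exec P₃ s₂ s₃ k₃ ∧
        k₁ + k₂ + k₃ ≤ C * I.n ^ 4 ∧
        -- the numbers `c i j` are computed in time `O(n ^ 2)`
        k₁ ≤ C * I.n ^ 2 ∧ I.StoresC s₁ ∧
        -- either the instance is found to be infeasible
        ((s₂.ivar 2 = 0 ∧ s₃.ivar 2 = 0 ∧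
            (¬ ∃ y, I.LPFeasible y) ∧ ¬ ∃ S : I.Schedule, S.Valid) ∨
        -- or the linear program, and then the scheduling problem, is solved
          (s₂.ivar 2 = 1 ∧ s₃.ivar 2 = 1 ∧
            ∃ y : WithBot ℝ → ℤ,
              I.StoresSkeleton s₂ y ∧
              I.LPOptimal (fun t => (y t : ℝ)) ∧
              I.IsDistance y ∧
              (∃ f, I.IsMinCostFlow f ∧ ∀ τ : ℝ, IsGreatest (I.T : Set ℝ) τ →
                I.lpObjective (fun t => (y t : ℝ)) = I.n * (τ + I.p) - I.flowCost f) ∧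
              ∃ S : I.Schedule, S.StoredIn s₃ ∧ S.IsEDD y ∧ S.Optimal)) := by
  refine ⟨.matrix, .solve, .assign, 2000, fun I hn => ⟨I.card_T_le, ?_⟩⟩
  obtain ⟨s₁, k₁, e₁, hk₁, f₁, hC⟩ := I.runs_matrix I.loaded_input hn rfl
  have hL₁ := I.loaded_input.frame f₁
  obtain ⟨s₂, k₂, e₂, hk₂, f₂, hP, h₂⟩ := JobInstance.runs_solve hL₁ hC hn
  have hL₂ := hL₁.frame f₂
  have hpow : I.n ^ 2 ≤ I.n ^ 4 := Nat.pow_le_pow_right hn (by decide)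
  rcases h₂ with ⟨h2, hD⟩ | ⟨h2, hno⟩
  -- The marks of assigned jobs still have their initial value, because neither earlier program
  -- writes to this array.
  · have h8 : s₂.iarr 8 = fun _ => 0 := by
      rw [f₂.iarr 8 rfl, f₁.iarr 8 rfl]
      rfl
    obtain ⟨s₃, k₃, e₃, hk₃, f₃, S, hS, hE⟩ :=
      JobInstance.runs_assign hL₂ hP hn h2 h8 hD.lpFeasible fun _ => rfl
    exact ⟨s₁, s₂, s₃, k₁, k₂, k₃, e₁, e₂, e₃, by omega, by omega, hC, Or.inr ⟨h2,
      (f₃.ivar 2 rfl).trans h2, _, hP.storesSkeleton, hD.lpOptimal hn, hD,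
      hD.exists_isMinCostFlow hn, S, hS, hE, hE.optimal (hD.lpOptimal hn)⟩⟩
  · have h2' : ¬ (Test.ile (.lit 1) (.var 2)).Holds s₂ := by simp [h2]
    refine ⟨s₁, s₂, s₂, k₁, k₂, _, e₁, e₂, .branch_false h2' (.nop s₂), ?_, by omega, hC,
      Or.inl ⟨h2, h2, hno, ?_⟩⟩
    · have : 0 < I.n ^ 4 := by positivity
      simp only [Test.cost, IExp.cost]
      omega
    -- A valid schedule, shifted to the left, would yield a feasible solution of the linear program.
    · rintro ⟨S, hS⟩
      obtain ⟨y, hy, -⟩ := hS.exists_lpObjective_le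
      exact hno ⟨y, hy⟩
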